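/- All graphs are finite and simple. For a graph $G$ and $S\subseteq V(G)$, let $\rho(S)$ be the number of edges of $G$ with at least one end in $S$, and let $N(S)$ be the set of vertices outside $S$ with a neighbour in $S$. Let $X\subseteq V(G)$. A *separation* of $(G,X)$ is an ordered pair $(A,B)$ with $A\cup B=V(G)$, $X\subseteq A$, and no edge of $G$ between $A\setminus B$ and $B\setminus A$; its *order* is $|A\cap B|$. The pair $(G,X)$ is *$5$-massed* if $\rho(V(G)\setminus X)>5|V(G)\setminus X|$, and $\rho(B\setminus A)\le 5|B\setminus A|$ for every separation $(A,B)$ of $(G,X)$ of order less than $|X|$. The pair $(G,X)$ is *cycle-linked* if either $k:=|X|\ge 3$ and for every ordering $y_1,\dots,y_k$ of the vertices of $X$ there are pairwise disjoint sets $Y_1,\dots,Y_k\subseteq V(G)$ such that, for all $i$, $y_i\in Y_i$, $G[Y_i]$ is connected, and $G$ has an edge between $Y_i$ and $Y_{i+1}$ (where $Y_{k+1}=Y_1$); or $|X|\in\{1,2\}$ and $G$ contains a path between the vertices of $X$ (a single vertex counts as a path). **Theorem.** Let $G$ be a graph and let $X\subseteq V(G)$ be nonempty with $|X|\le 5$,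 such that $(G,X)$ is $5$-massed. Suppose that $(G,X)$ is not cycle-linked. Then $|X|=5$ and $\rho(V(G)\setminus X)=5|V(G)\setminus X|+1$. Moreover, the vertices of $X$ may be labelled $x_1,\dots,x_5$ such that $x_ix_{i+1}\notin E(G)$ for $1\le i\le 5$ (indices modulo $5$), and there exist $a,b\in V(G)\setminus X$ such that 1. $ab\in E(G)$, and $a$ and $b$ are both adjacent to $x_i$ for all $1\le i\le 5$; and 2. for every component $C$ of $G-(X\cup\{a,b\})$, $\rho(V(C))=5|V(C)|$ and $N(V(C))\subseteq\{a,b,x_i,x_{i+2}\}$ for some $1\le i\le 5$ (indices modulo $5$). -/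

import Mathlib

namespace RootedCycle

/-- `ρ_G(S)`: the number of edges of `G` with at least one end in `S`. -/
noncomputable def rho {V : Type*} (G : SimpleGraph V) (S : Set V) : ℕ :=
  {e : Sym2 V | e ∈ G.edgeSet ∧ ∃ v ∈ S, v ∈ e}.ncard

/-- `N_G(S)`: the vertices outside `S` that have a neighbour in `S`. -/
def nbhd {V : Type*} (G : SimpleGraph V) (S : Set V) : Set V :=
  {v | v ∉ S ∧ ∃ u ∈ S, G.Adj u v}

/-- `(G, x₁x₂…x_k)` has a `C_k`-minor: there are pairwise disjoint connected vertex sets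
`Y₁, …, Y_k` with `x_i ∈ Y_i` and an edge between `Y_i` and `Y_{i+1}` for every `i`, indices
cyclic (`finRotate k i` is the cyclic successor of `i`). -/
def HasCycleMinor {V : Type*} (G : SimpleGraph V) {k : ℕ} (x : Fin k → V) : Prop :=
  ∃ Y : Fin k → Set V,
    (∀ i j, i ≠ j → Disjoint (Y i) (Y j)) ∧
    (∀ i, (G.induce (Y i)).Connected) ∧
    (∀ i, x i ∈ Y i) ∧
    (∀ i, ∃ u ∈ Y i, ∃ v ∈ Y (finRotate k i), G.Adj u v)

/-- `(G, X)` is cycle-linked: `|X| ≥ 3` and every ordering of `X` has a `C_{|X|}`-minor, or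
`|X| ∈ {1, 2}` and `G` has a path between the vertices of `X`. -/
def CycleLinked {V : Type*} (G : SimpleGraph V) (X : Set V) : Prop :=
  (3 ≤ X.ncard ∧
    ∀ x : Fin X.ncard → V, Function.Injective x → Set.range x = X → HasCycleMinor G x) ∨
  ((X.ncard = 1 ∨ X.ncard = 2) ∧
    ∀ u ∈ X, ∀ v ∈ X, ∃ p : G.Walk u v, p.IsPath)

/-- `(A, B)` is a separation of `(G, X)`. Its order is `(A ∩ B).ncard`. -/
structure IsSeparation {V : Type*} (G : SimpleGraph V) (X A B : Set V) : Prop where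
  union_eq : A ∪ B = Set.univ
  subset_left : X ⊆ A
  no_edge : ∀ u ∈ A \ B, ∀ v ∈ B \ A, ¬ G.Adj u v

/-- `(G, X)` is `lam`-massed. -/
structure Massed {V : Type*} (lam : ℝ) (G : SimpleGraph V) (X : Set V) : Prop where
  mass : lam * (Xᶜ.ncard : ℝ) < (rho G Xᶜ : ℝ)
  separation_le : ∀ A B : Set V, IsSeparation G X A B → (A ∩ B).ncard < X.ncard →
    (rho G (B \ A) : ℝ) ≤ lam * ((B \ A).ncard : ℝ)

end RootedCycle

/-! Write W for the complement of X and S for X. The core statement, `Good`, concerns one fixed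
ordering of at most five roots: a massed pair either has a cycle minor for that ordering, or there
are five roots and two vertices a, b of W adjacent to all of them. The rest of the conclusion is
then counting (`Mass.bdry_comp_subset`, `Mass.apex_structure`). A component of G[W] minus a, b that
sees two cyclically consecutive roots would complete the cycle together with a and b. Hence each
component has a boundary of order at most 4 and satisfies ρ ≤ 5|C|. As a and b contribute at most 11
further edges, the mass condition forces equality everywhere, including the edge ab.

`Good` is proved by induction on |W| and then on ρ(W). In a minimal counterexample, call a set D ⊆ W
with boundary inside T rigid if every ordering of T has a cycle minor in D ∪ T. A rigid set behaves
like a clique on T: a minor that uses clique edges lifts to G after T is sorted by branch sets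
(`Rigid.lift`). With Menger's theorem and induction this rules out nonempty rigid sets with |T| ≤
|S| (`MinCex.not_rigidSep`). Consequently a smaller D with boundary of order at most |S| and ρ(D) >
5|D| must itself be exceptional (`MinCex.exceptional_of_mass`).

Deleting an edge now shows ρ(W) = 5|W| + 1 (`MinCex.rho_eq`). Contracting an edge uv with v in W
must destroy at least five edges besides uv (`MinCex.five_le_lostNbr`); otherwise the contraction is
a smaller massed pair, and both a minor and two apexes there lead back to G. So every neighbourhood
in W is dense.

If there are at least three roots, averaging yields a vertex v of W of degree at most 9, and fewer
if v sees roots (`MinCex.exists_small_degree`). Density then gives a cycle minor in v and its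
neighbours, for five roots chosen there (`DenseNbr.model`). A minimum separation between S and N(v)
in G − v, linked to N(v) by Menger, turns this into a rigid set containing v, a contradiction
(`MinCex.lt_three`). At most two roots are handled directly. -/

namespace RootedCycle

/-! ### Connected sets, cyclic families, and merging along monotone labels -/

section Connectivity

variable {V : Type*}

/-- `Y` is nonempty and no proper nonempty part of `Y` is closed under adjacency within `Y`. -/
def Conn (G : SimpleGraph V) (Y : Set V) : Prop :=
  Y.Nonempty ∧ ∀ P : Set V, (P ∩ Y).Nonempty →
    (∀ u ∈ P, u ∈ Y → ∀ v ∈ Y, G.Adj u v → v ∈ P) → Y ⊆ P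

/-- The sets `A` and `B` share a vertex or are joined by an edge. -/
def Touch (G : SimpleGraph V) (A B : Set V) : Prop :=
  ∃ u ∈ A, ∃ v ∈ B, u = v ∨ G.Adj u v

theorem Touch.symm {G : SimpleGraph V} {A B : Set V} (h : Touch G A B) : Touch G B A := by
  obtain ⟨u, hu, v, hv, h⟩ := h
  exact ⟨v, hv, u, hu, h.imp Eq.symm SimpleGraph.Adj.symm⟩

theorem Touch.mono {G : SimpleGraph V} {A B A' B' : Set V} (h : Touch G A B) (hA : A ⊆ A')
    (hB : B ⊆ B') : Touch G A' B' := by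
  obtain ⟨u, hu, v, hv, h⟩ := h
  exact ⟨u, hA hu, v, hB hv, h⟩

theorem Touch.mono_graph {G H : SimpleGraph V} {A B : Set V} (h : Touch G A B) (hGH : G ≤ H) :
    Touch H A B := by
  obtain ⟨u, hu, v, hv, h⟩ := h
  exact ⟨u, hu, v, hv, h.imp id (fun h => hGH h)⟩

theorem Touch.refl {G : SimpleGraph V} {A : Set V} (h : A.Nonempty) : Touch G A A := by
  obtain ⟨u, hu⟩ := h
  exact ⟨u, hu, u, hu, Or.inl rfl⟩

theorem conn_singleton (G : SimpleGraph V) (v : V) : Conn G {v} := by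
  refine ⟨⟨v, rfl⟩, ?_⟩
  rintro P ⟨u, hu, rfl⟩ _ w rfl
  exact hu

theorem Conn.mono_graph {G H : SimpleGraph V} {Y : Set V} (h : Conn G Y) (hGH : G ≤ H) :
    Conn H Y :=
  ⟨h.1, fun P hP hc => h.2 P hP fun u hu huY v hv huv => hc u hu huY v hv (hGH huv)⟩

theorem Conn.of_adj {G H : SimpleGraph V} {Y : Set V} (h : Conn G Y)
    (hGH : ∀ u ∈ Y, ∀ v ∈ Y, G.Adj u v → H.Adj u v) : Conn H Y :=
  ⟨h.1, fun P hP hc => h.2 P hP fun u hu huY v hv huv => hc u hu huY v hv (hGH u huY v hv huv)⟩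

/-- The basic move of the connectivity proofs: P is closed under adjacency within E, so once it
contains one connected part of E it swallows every connected part touching that one. -/
theorem Conn.absorb {G : SimpleGraph V} {A B E P : Set V} (hB : Conn G B) (hBE : B ⊆ E)
    (hP : ∀ u ∈ P, u ∈ E → ∀ v ∈ E, G.Adj u v → v ∈ P) (ht : Touch G A B) (hAP : A ⊆ P)
    (hAE : A ⊆ E) : B ⊆ P := by
  obtain ⟨u, hu, v, hv, h⟩ := ht
  refine hB.2 P ⟨v, ?_, hv⟩ fun a ha haB b hb hab => hP a ha (hBE haB) b (hBE hb) hab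
  rcases h with rfl | h
  · exact hAP hu
  · exact hP u (hAP hu) (hAE hu) v (hBE hv) h

theorem Conn.subset_of_meets {G : SimpleGraph V} {A E P : Set V} (hA : Conn G A) (hAE : A ⊆ E)
    (hP : ∀ u ∈ P, u ∈ E → ∀ v ∈ E, G.Adj u v → v ∈ P) (h : (P ∩ A).Nonempty) : A ⊆ P :=
  hA.2 P h fun a ha haB b hb hab => hP a ha (hAE haB) b (hAE hb) hab

theorem Conn.union {G : SimpleGraph V} {A B : Set V} (hA : Conn G A) (hB : Conn G B)
    (h : Touch G A B) : Conn G (A ∪ B) := by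
  refine ⟨hA.1.mono Set.subset_union_left, fun P hP hc => ?_⟩
  obtain ⟨u, huP, hu | hu⟩ := hP
  · have h1 : A ⊆ P := hA.subset_of_meets Set.subset_union_left hc ⟨u, huP, hu⟩
    exact Set.union_subset h1
      (hB.absorb Set.subset_union_right hc h h1 Set.subset_union_left)
  · have h1 : B ⊆ P := hB.subset_of_meets Set.subset_union_right hc ⟨u, huP, hu⟩
    exact Set.union_subset
      (hA.absorb Set.subset_union_left hc h.symm h1 Set.subset_union_right) h1

theorem Conn.insert_adj {G : SimpleGraph V} {A : Set V} {u v : V} (hA : Conn G A) (hu : u ∈ A)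
    (h : G.Adj u v) : Conn G (insert v A) := by
  rw [← Set.union_singleton]
  exact hA.union (conn_singleton G v) ⟨u, hu, v, rfl, Or.inr h⟩

/-- The set of vertices reachable from `t` inside `Y`. -/
def comp (G : SimpleGraph V) (Y : Set V) (t : V) : Set V :=
  {w | ∀ P : Set V, t ∈ P → (∀ u ∈ P, u ∈ Y → ∀ v ∈ Y, G.Adj u v → v ∈ P) → w ∈ P}

theorem mem_comp_self (G : SimpleGraph V) (Y : Set V) (t : V) : t ∈ comp G Y t :=
  fun _ h _ => h

theorem comp_subset {G : SimpleGraph V} {Y : Set V} {t : V} (ht : t ∈ Y) : comp G Y t ⊆ Y :=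
  fun _ hw => hw Y ht fun _ _ _ _ hv _ => hv

theorem comp_closed {G : SimpleGraph V} {Y : Set V} {t u v : V} (hu : u ∈ comp G Y t)
    (huY : u ∈ Y) (hv : v ∈ Y) (huv : G.Adj u v) : v ∈ comp G Y t :=
  fun P htP hP => hP u (hu P htP hP) huY v hv huv

theorem conn_comp {G : SimpleGraph V} {Y : Set V} {t : V} :
    Conn G (comp G Y t) := by
  refine ⟨⟨t, mem_comp_self G Y t⟩, fun P hP hc => ?_⟩
  by_cases htP : t ∈ P
  · intro w hw
    refine (hw (P ∩ comp G Y t) ⟨htP, mem_comp_self G Y t⟩ ?_).1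
    rintro u ⟨huP, hu⟩ huY v hv huv
    have := comp_closed hu huY hv huv
    exact ⟨hc u huP hu v this huv, this⟩
  · obtain ⟨w, hwP, hw⟩ := hP
    exfalso
    have := hw (Pᶜ ∩ comp G Y t) ⟨htP, mem_comp_self G Y t⟩ ?_
    · exact this.1 hwP
    · rintro u ⟨huP, hu⟩ huY v hv huv
      have h2 := comp_closed hu huY hv huv
      exact ⟨fun hvP => huP (hc v hvP h2 u hu huv.symm), h2⟩

/-- A connected set containing `t` and meeting `N` contains a connected set that contains `t` and
meets `N` exactly once. -/
theorem Conn.truncate {G : SimpleGraph V} {Z N : Set V} {t : V} (hZ : Conn G Z) (ht : t ∈ Z)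
    (hN : (Z ∩ N).Nonempty) :
    ∃ Z' ⊆ Z, Conn G Z' ∧ t ∈ Z' ∧ ∃ y, Z' ∩ N = {y} := by
  by_cases htN : t ∈ N
  · refine ⟨{t}, by simpa using ht, conn_singleton G t, rfl, t, ?_⟩
    ext w
    constructor
    · rintro ⟨rfl, _⟩
      rfl
    · rintro rfl
      exact ⟨rfl, htN⟩
  have htY : t ∈ Z \ N := ⟨ht, htN⟩
  set C := comp G (Z \ N) t with hC
  have hCs : C ⊆ Z \ N := comp_subset htY
  have : ∃ u ∈ C, ∃ v ∈ Z ∩ N, G.Adj u v := by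
    by_contra hcon
    push Not at hcon
    obtain ⟨y, hyZ, hyN⟩ := hN
    have h1 := hZ.2 C ⟨t, mem_comp_self G _ t, ht⟩ ?_
    · exact (hCs (h1 hyZ)).2 hyN
    · intro u hu _ v hv huv
      by_cases hvN : v ∈ N
      · exact absurd huv (hcon u hu v ⟨hv, hvN⟩)
      · exact comp_closed hu (hCs hu) ⟨hv, hvN⟩ huv
  obtain ⟨u, hu, v, hv, huv⟩ := this
  refine ⟨insert v C, Set.insert_subset hv.1 (hCs.trans Set.sdiff_subset),
    (conn_comp).insert_adj hu huv, Or.inr (mem_comp_self G _ t), v, ?_⟩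
  ext w
  constructor
  · rintro ⟨rfl | hw, hwN⟩
    · rfl
    · exact absurd hwN (hCs hw).2
  · rintro rfl
    exact ⟨Or.inl rfl, hv.2⟩

theorem Conn.induce_connected {G : SimpleGraph V} {Y : Set V} (h : Conn G Y) :
    (G.induce Y).Connected := by
  have : Nonempty Y := h.1.to_subtype
  refine SimpleGraph.Connected.mk fun a b => ?_
  have := h.2 {w | ∃ hw : w ∈ Y, (G.induce Y).Reachable a ⟨w, hw⟩}
    ⟨a, ⟨a.2, SimpleGraph.Reachable.refl _⟩, a.2⟩ ?_ b.2
  · exact this.2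
  · rintro u ⟨hu, hr⟩ _ v hv huv
    refine ⟨hv, hr.trans (SimpleGraph.Adj.reachable ?_)⟩
    simpa using huv

theorem Conn.exists_walk {G : SimpleGraph V} {Y : Set V} (h : Conn G Y) {u v : V} (hu : u ∈ Y)
    (hv : v ∈ Y) : G.Reachable u v :=
  h.2 {w | G.Reachable u w} ⟨u, SimpleGraph.Reachable.refl _, hu⟩
    (fun _ ha _ _ _ hab => SimpleGraph.Reachable.trans ha (SimpleGraph.Adj.reachable hab)) hv

/-! ### Cyclic models -/

/-- `j` is the cyclic successor of `i` in `Fin k`. -/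
def CycNext {k : ℕ} (i j : Fin k) : Prop :=
  i.val + 1 = j.val ∨ (i.val + 1 = k ∧ j.val = 0)

/-- Pairwise disjoint connected sets, cyclically consecutive ones touching. -/
structure IsCyc (G : SimpleGraph V) {k : ℕ} (Y : Fin k → Set V) : Prop where
  disj : ∀ i j, i ≠ j → Disjoint (Y i) (Y j)
  conn : ∀ i, Conn G (Y i)
  touch : ∀ i j, CycNext i j → Touch G (Y i) (Y j)

/-- A cycle minor rooted at `x` inside `U`. -/
def Model (G : SimpleGraph V) (U : Set V) {k : ℕ} (x : Fin k → V) : Prop :=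
  ∃ Y : Fin k → Set V, IsCyc G Y ∧ (∀ i, Y i ⊆ U) ∧ ∀ i, x i ∈ Y i

theorem IsCyc.mono_graph {G H : SimpleGraph V} {k : ℕ} {Y : Fin k → Set V} (h : IsCyc G Y)
    (hGH : G ≤ H) : IsCyc H Y :=
  ⟨h.disj, fun i => (h.conn i).mono_graph hGH, fun i j hij => (h.touch i j hij).mono_graph hGH⟩

theorem Model.mono {G H : SimpleGraph V} {U U' : Set V} {k : ℕ} {x : Fin k → V}
    (h : Model G U x) (hGH : G ≤ H) (hU : U ⊆ U') : Model H U' x := by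
  obtain ⟨Y, hY, hYU, hx⟩ := h
  exact ⟨Y, hY.mono_graph hGH, fun i => (hYU i).trans hU, hx⟩

theorem cycNext_finRotate {k : ℕ} (i : Fin k) : CycNext i (finRotate k i) := by
  rcases k with _ | n
  · exact i.elim0
  · rcases eq_or_ne i (Fin.last n) with rfl | h
    · right
      simp
    · left
      rw [coe_finRotate_of_ne_last h]

theorem Model.hasCycleMinor {G : SimpleGraph V} {U : Set V} {k : ℕ} (hk : 2 ≤ k) {x : Fin k → V}
    (h : Model G U x) : HasCycleMinor G x := by
  obtain ⟨Y, hY, -, hx⟩ := h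
  refine ⟨Y, hY.disj, fun i => (hY.conn i).induce_connected, hx, fun i => ?_⟩
  have hn := cycNext_finRotate i
  have hne : i ≠ finRotate k i := by
    intro he
    rw [← he] at hn
    rcases hn with hn | hn <;> omega
  obtain ⟨u, hu, v, hv, rfl | huv⟩ := hY.touch _ _ hn
  · exact absurd hv (Set.disjoint_left.mp (hY.disj _ _ hne) hu)
  · exact ⟨u, hu, v, hv, huv⟩

theorem model_of_fin_zero (G : SimpleGraph V) (U : Set V) (x : Fin 0 → V) : Model G U x :=
  ⟨fun _ => ∅, ⟨fun i => i.elim0, fun i => i.elim0, fun i => i.elim0⟩, fun i => i.elim0,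
    fun i => i.elim0⟩

theorem model_of_fin_one (G : SimpleGraph V) {U : Set V} (x : Fin 1 → V) (hx : x 0 ∈ U) :
    Model G U x := by
  refine ⟨fun _ => {x 0}, ⟨fun i j h => absurd (Subsingleton.elim i j) h,
    fun i => conn_singleton G _, fun i j _ => Touch.refl ⟨x 0, rfl⟩⟩, fun _ => by simpa using hx,
    fun i => by rw [Subsingleton.elim i 0]; rfl⟩

/-! ### Merging the sets of a cyclic family along a monotone labelling -/

/-- Monotonicity makes each label class an interval of indices, so the closed set P propagates from
one index of the class to another through touching neighbours. -/
theorem IsCyc.subset_iff_of_label {G : SimpleGraph V} {n j : ℕ} {Z : Fin n → Set V}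
    (hZ : IsCyc G Z) {c : Fin n → Fin j} (hc : Monotone c) {i : Fin j} {P : Set V}
    (hP : ∀ u ∈ P, u ∈ (⋃ m, ⋃ (_ : c m = i), Z m) →
      ∀ v ∈ (⋃ m, ⋃ (_ : c m = i), Z m), G.Adj u v → v ∈ P) :
    ∀ d : ℕ, ∀ p q : Fin n, q.val = p.val + d → c p = i → c q = i → (Z p ⊆ P ↔ Z q ⊆ P) := by
  have hsub : ∀ m, c m = i → Z m ⊆ ⋃ m, ⋃ (_ : c m = i), Z m := fun m hm =>
    Set.subset_iUnion₂ (s := fun m (_ : c m = i) => Z m) m hm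
  intro d
  induction d with
  | zero =>
    intro p q hpq _ _
    have : p = q := Fin.ext (by omega)
    rw [this]
  | succ d ih =>
    intro p q hpq hp hq
    have hlt : p.val + 1 < n := by have := q.2; omega
    set r : Fin n := ⟨p.val + 1, hlt⟩ with hr
    have hrv : r.val = p.val + 1 := rfl
    have hcr : c r = i := by
      apply le_antisymm
      · rw [← hq]
        exact hc (Fin.le_def.mpr (by omega))
      · rw [← hp]
        exact hc (Fin.le_def.mpr (by omega))
    have ht := hZ.touch p r (Or.inl hrv.symm)
    have h1 : Z p ⊆ P ↔ Z r ⊆ P :=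
      ⟨fun h => (hZ.conn r).absorb (hsub r hcr) hP ht h (hsub p hp),
       fun h => (hZ.conn p).absorb (hsub p hp) hP ht.symm h (hsub r hcr)⟩
    exact h1.trans (ih r q (by omega) hcr hq)

theorem IsCyc.conn_label {G : SimpleGraph V} {n j : ℕ} {Z : Fin n → Set V} (hZ : IsCyc G Z)
    {c : Fin n → Fin j} (hc : Monotone c) {i : Fin j} (hi : ∃ m, c m = i) :
    Conn G (⋃ m, ⋃ (_ : c m = i), Z m) := by
  obtain ⟨m₀, hm₀⟩ := hi
  have hsub : ∀ m, c m = i → Z m ⊆ ⋃ m, ⋃ (_ : c m = i), Z m := fun m hm =>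
    Set.subset_iUnion₂ (s := fun m (_ : c m = i) => Z m) m hm
  refine ⟨(hZ.conn m₀).1.mono (hsub m₀ hm₀), fun P hP hcl => ?_⟩
  obtain ⟨u, huP, hu⟩ := hP
  obtain ⟨m, hm, hum⟩ := Set.mem_iUnion₂.mp hu
  have h1 : Z m ⊆ P := (hZ.conn m).subset_of_meets (hsub m hm) hcl ⟨u, huP, hum⟩
  refine Set.iUnion₂_subset fun q hq => ?_
  rcases le_total m.val q.val with h | h
  · exact (hZ.subset_iff_of_label hc hcl (q.val - m.val) m q (by omega) hm hq).mp h1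
  · exact (hZ.subset_iff_of_label hc hcl (m.val - q.val) q m (by omega) hq hm).mpr h1

theorem exists_consecutive_labels {n j : ℕ} {c : Fin n → Fin j} (hc : Monotone c) {i i' : Fin j}
    (hi : ∃ m, c m = i) (hi' : ∃ m, c m = i') (hn : CycNext i i') :
    ∃ p q, c p = i ∧ c q = i' ∧ (p = q ∨ CycNext p q) := by
  obtain ⟨m, hm⟩ := hi
  obtain ⟨m', hm'⟩ := hi'
  rcases hn with hn | ⟨hn1, hn2⟩
  · have hlt : m.val < m'.val := by
      by_contra hcon
      have := hc (Fin.le_def.mpr (not_lt.mp hcon))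
      rw [hm, hm', Fin.le_def] at this
      omega
    have key : ∀ d : ℕ, ∀ m : Fin n, c m = i → m'.val = m.val + d →
        ∃ p q, c p = i ∧ c q = i' ∧ (p = q ∨ CycNext p q) := by
      intro d
      induction d with
      | zero =>
        intro m hm hd
        have : m = m' := Fin.ext (by omega)
        rw [this, hm'] at hm
        rw [hm] at hn
        omega
      | succ d ih =>
        intro m hm hd
        have hlt : m.val + 1 < n := by have := m'.2; omega
        set r : Fin n := ⟨m.val + 1, hlt⟩ with hr
        have hrv : r.val = m.val + 1 := rfl
        have h1 := hc (show m ≤ r from Fin.le_def.mpr (by omega))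
        have h2 := hc (show r ≤ m' from Fin.le_def.mpr (by omega))
        rw [hm, Fin.le_def] at h1
        rw [hm', Fin.le_def] at h2
        rcases Nat.eq_or_lt_of_le h1 with h3 | h3
        · exact ih r (Fin.ext h3.symm) (by omega)
        · exact ⟨m, r, hm, Fin.ext (by omega), Or.inr (Or.inl hrv.symm)⟩
    exact key (m'.val - m.val) m hm (by omega)
  -- Wrap-around case: since the labels are monotone and the extreme ones occur, the last index has
  -- the last label and index 0 has label 0.
  · have hnpos : 0 < n := lt_of_le_of_lt (Nat.zero_le _) m.2
    refine ⟨⟨n - 1, by omega⟩, ⟨0, hnpos⟩, ?_, ?_, Or.inr (Or.inr ⟨by simp; omega, rfl⟩)⟩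
    · have h1 := hc (show m ≤ ⟨n - 1, by omega⟩ from Fin.le_def.mpr (by have := m.2; simp; omega))
      rw [hm, Fin.le_def] at h1
      exact Fin.ext (by have := (c ⟨n - 1, by omega⟩).2; omega)
    · have h1 := hc (show ⟨0, hnpos⟩ ≤ m' from Fin.le_def.mpr (Nat.zero_le _))
      rw [hm', Fin.le_def] at h1
      exact Fin.ext (by omega)

theorem IsCyc.touch_label {G : SimpleGraph V} {n j : ℕ} {Z : Fin n → Set V} (hZ : IsCyc G Z)
    {c : Fin n → Fin j} (hc : Monotone c) {i i' : Fin j}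
    (hi : ∃ m, c m = i) (hi' : ∃ m, c m = i') (hn : CycNext i i') :
    Touch G (⋃ m, ⋃ (_ : c m = i), Z m) (⋃ m, ⋃ (_ : c m = i'), Z m) := by
  obtain ⟨p, q, hp, hq, h⟩ := exists_consecutive_labels hc hi hi' hn
  have hsub : ∀ i m, c m = i → Z m ⊆ ⋃ m, ⋃ (_ : c m = i), Z m := fun i m hm =>
    Set.subset_iUnion₂ (s := fun m (_ : c m = i) => Z m) m hm
  rcases h with rfl | h
  · exact (Touch.refl (hZ.conn p).1).mono (hsub i p hp) (hsub i' p hq)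
  · exact (hZ.touch p q h).mono (hsub i p hp) (hsub i' q hq)

end Connectivity
end RootedCycle
namespace RootedCycle

/-! ### Replacing a rigid set by a clique on its boundary -/

section Cliques

variable {V : Type*}

/-- The graph obtained from `G` by isolating the vertices of `D` and making `S` a clique. -/
def cliqueOn (G : SimpleGraph V) (D S : Set V) : SimpleGraph V where
  Adj u v := u ≠ v ∧ u ∉ D ∧ v ∉ D ∧ (G.Adj u v ∨ (u ∈ S ∧ v ∈ S))
  symm := ⟨fun _ _ h =>
    ⟨h.1.symm, h.2.2.1, h.2.1, h.2.2.2.imp SimpleGraph.Adj.symm And.symm⟩⟩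
  loopless := ⟨fun _ h => h.1 rfl⟩

/-- Every ordering of `S` has a cycle minor inside `D ∪ S`. -/
def Rigid (G : SimpleGraph V) (D S : Finset V) : Prop :=
  ∀ s : Fin S.card → V, Function.Injective s → Set.range s = ↑S → Model G (↑D ∪ ↑S) s

/-- Each vertex of S is labelled by the branch set containing it, and S is sorted by label. The
cycle minor that rigidity provides for this order is merged along the labels; the merged sets are
connected, consecutive ones touch, and they replace the clique edges inside and between branch sets.
-/
theorem Rigid.lift {G : SimpleGraph V} {D S : Finset V} (hR : Rigid G D S)
    {k : ℕ} {U : Set V} (hUD : Disjoint U ↑D) {x : Fin k → V}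
    (h : Model (cliqueOn G D S) U x) : Model G (U ∪ ↑D ∪ ↑S) x := by
  classical
  obtain ⟨Y, hY, hYU, hx⟩ := h
  have hUS : U ⊆ U ∪ ↑D ∪ ↑S := Set.subset_union_left.trans Set.subset_union_left
  by_cases hS : ∃ s ∈ S, ∃ i, s ∈ Y i
  swap
  · push Not at hS
    refine ⟨Y, ⟨hY.disj, fun i => (hY.conn i).of_adj ?_, fun i j hij => ?_⟩,
      fun i => (hYU i).trans hUS, hx⟩
    · rintro u hu v hv ⟨-, -, -, h | h⟩
      · exact h
      · exact absurd hu (hS u h.1 i)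
    · obtain ⟨u, hu, v, hv, rfl | ⟨-, -, -, h | h⟩⟩ := hY.touch i j hij
      · exact ⟨u, hu, u, hv, Or.inl rfl⟩
      · exact ⟨u, hu, v, hv, Or.inr h⟩
      · exact absurd hu (hS u h.1 i)
  obtain ⟨s₀, hs₀, i₀, hi₀⟩ := hS
  -- Vertices of S outside all branch sets get the label `i₀` of a branch set that does meet S. Thus
  -- every label in use belongs to a branch set meeting S, and each merged set is attached to its
  -- branch set.
  let c₀ : V → Fin k := fun s => if h : ∃ i, s ∈ Y i then h.choose else i₀
  have hc₀ : ∀ s i, s ∈ Y i → c₀ s = i := by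
    intro s i hs
    have h : ∃ i, s ∈ Y i := ⟨i, hs⟩
    have h1 : c₀ s = h.choose := dif_pos h
    rw [h1]
    by_contra hne
    exact Set.disjoint_left.mp (hY.disj _ _ hne) h.choose_spec hs
  let e := S.equivFin.symm
  let σ := Tuple.sort (fun m => c₀ (e m))
  let s : Fin S.card → V := fun m => e (σ m)
  let c : Fin S.card → Fin k := fun m => c₀ (s m)
  have hc : Monotone c := Tuple.monotone_sort (fun m => c₀ (e m))
  have hsinj : Function.Injective s :=
    Subtype.val_injective.comp (e.injective.comp σ.injective)
  have hsS : ∀ m, s m ∈ S := fun m => (e (σ m)).2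
  have hssurj : ∀ w ∈ S, ∃ m, s m = w := by
    intro w hw
    refine ⟨σ.symm (e.symm ⟨w, hw⟩), ?_⟩
    simp [s]
  have hrange : Set.range s = ↑S := by
    ext w
    constructor
    · rintro ⟨m, rfl⟩
      exact hsS m
    · exact fun hw => hssurj w hw
  obtain ⟨Z, hZ, hZU, hsZ⟩ := hR s hsinj hrange
  have hZS : ∀ m w, w ∈ Z m → w ∈ S → w = s m := by
    intro m w hw hwS
    obtain ⟨m', rfl⟩ := hssurj w hwS
    by_contra hne
    have : m' ≠ m := fun h => hne (by rw [h])
    exact Set.disjoint_left.mp (hZ.disj _ _ this) (hsZ m') hw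
  let E : Fin k → Set V := fun i => ⋃ m, ⋃ (_ : c m = i), Z m
  have hE : ∀ i m, c m = i → Z m ⊆ E i := fun i m hm =>
    Set.subset_iUnion₂ (s := fun m (_ : c m = i) => Z m) m hm
  have hE' : ∀ i w, w ∈ E i → ∃ m, c m = i ∧ w ∈ Z m := by
    intro i w hw
    obtain ⟨m, hm, hwm⟩ := Set.mem_iUnion₂.mp hw
    exact ⟨m, hm, hwm⟩
  have hlab : ∀ i, (∃ m, c m = i) → ∃ w ∈ S, w ∈ Y i := by
    rintro i ⟨m, hm⟩
    by_cases h : ∃ i', s m ∈ Y i'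
    · obtain ⟨i', hi'⟩ := h
      have : c m = i' := hc₀ _ _ hi'
      rw [hm] at this
      exact ⟨s m, hsS m, by rw [this]; exact hi'⟩
    · have h1 : c m = i₀ := dif_neg h
      rw [← hm, h1]
      exact ⟨s₀, hs₀, hi₀⟩
  have hSE : ∀ i w, w ∈ S → w ∈ Y i → (∃ m, c m = i) ∧ w ∈ E i := by
    intro i w hw hwY
    obtain ⟨m, rfl⟩ := hssurj w hw
    have : c m = i := hc₀ _ _ hwY
    exact ⟨⟨m, this⟩, hE i m this (hsZ m)⟩
  -- The branch sets avoid D, so a vertex shared with a merged set lies in S; there the merged sets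
  -- contain only vertices of their own label.
  have hEY : ∀ i j, i ≠ j → Disjoint (E i) (Y j) := by
    intro i j hij
    refine Set.disjoint_left.mpr fun w hw hwY => ?_
    obtain ⟨m, hm, hwm⟩ := hE' i w hw
    have hwS : w ∈ S := by
      rcases hZU m hwm with h | h
      · exact absurd h (Set.disjoint_left.mp hUD (hYU j hwY))
      · exact h
    have := hZS m w hwm hwS
    subst this
    exact hij (hm.symm.trans (hc₀ _ _ hwY))
  refine ⟨fun i => Y i ∪ E i, ⟨fun i j hij => ?_, fun i => ?_, fun i j hij => ?_⟩, fun i => ?_,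
    fun i => Or.inl (hx i)⟩
  · rw [Set.disjoint_union_left, Set.disjoint_union_right, Set.disjoint_union_right]
    refine ⟨⟨hY.disj i j hij, (hEY j i hij.symm).symm⟩, hEY i j hij, ?_⟩
    refine Set.disjoint_left.mpr fun w hw hw' => ?_
    obtain ⟨m, hm, hwm⟩ := hE' i w hw
    obtain ⟨m', hm', hwm'⟩ := hE' j w hw'
    have : m ≠ m' := by
      rintro rfl
      exact hij (hm.symm.trans hm')
    exact Set.disjoint_left.mp (hZ.disj _ _ this) hwm hwm'
  · by_cases hi : ∃ m, c m = i
    · have hconnE : Conn G (E i) := hZ.conn_label hc hi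
      obtain ⟨w, hwS, hwY⟩ := hlab i hi
      have hwE := (hSE i w hwS hwY).2
      refine ⟨⟨w, Or.inl hwY⟩, fun P hP hcl => ?_⟩
      have hEP : (P ∩ E i).Nonempty → E i ⊆ P :=
        hconnE.subset_of_meets Set.subset_union_right hcl
      have hYP : (P ∩ Y i).Nonempty → (∀ v ∈ S, v ∈ Y i → (P ∩ E i).Nonempty → v ∈ P) →
          Y i ⊆ P := by
        intro hne hv
        refine (hY.conn i).2 P hne ?_
        rintro u hu huY v hvY ⟨-, -, -, h | h⟩
        · exact hcl u hu (Or.inl huY) v (Or.inl hvY) h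
        · exact hv v h.2 hvY ⟨u, hu, (hSE i u h.1 huY).2⟩
      have hv : ∀ v ∈ S, v ∈ Y i → (P ∩ E i).Nonempty → v ∈ P := fun v hvS hvY hne =>
        hEP hne (hSE i v hvS hvY).2
      obtain ⟨u, huP, hu | hu⟩ := hP
      · have h1 := hYP ⟨u, huP, hu⟩ hv
        exact Set.union_subset h1 (hEP ⟨w, h1 hwY, hwE⟩)
      · have h1 := hEP ⟨u, huP, hu⟩
        exact Set.union_subset (hYP ⟨w, h1 hwE, hwY⟩ hv) h1
    · have hEi : E i = ∅ := by
        refine Set.eq_empty_of_forall_notMem fun w hw => ?_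
        obtain ⟨m, hm, -⟩ := hE' i w hw
        exact hi ⟨m, hm⟩
      rw [hEi, Set.union_empty]
      refine (hY.conn i).of_adj ?_
      rintro u hu v hv ⟨-, -, -, h | h⟩
      · exact h
      · exact absurd (hSE i u h.1 hu).1 hi
  · obtain ⟨u, hu, v, hv, rfl | ⟨-, -, -, h | h⟩⟩ := hY.touch i j hij
    · exact ⟨u, Or.inl hu, u, Or.inl hv, Or.inl rfl⟩
    · exact ⟨u, Or.inl hu, v, Or.inl hv, Or.inr h⟩
    · exact (hZ.touch_label hc (hSE i u h.1 hu).1 (hSE j v h.2 hv).1 hij).mono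
        Set.subset_union_right Set.subset_union_right
  · refine Set.union_subset ((hYU i).trans hUS) fun w hw => ?_
    obtain ⟨m, -, hwm⟩ := hE' i w hw
    rcases hZU m hwm with h | h
    · exact Or.inl (Or.inr h)
    · exact Or.inr h

/-- A model on an initial segment of the roots, absorbing the sets of the remaining roots. -/
theorem IsCyc.castLE {G : SimpleGraph V} {n j : ℕ} (hj : 0 < j) (hjn : j ≤ n)
    {Y : Fin n → Set V} (hY : IsCyc G Y) :
    ∃ Y' : Fin j → Set V, IsCyc G Y' ∧ (∀ i, Y (Fin.castLE hjn i) ⊆ Y' i) ∧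
      (∀ i w, w ∈ Y' i → ∃ m : Fin n, w ∈ Y m ∧ (m = Fin.castLE hjn i ∨ j ≤ m.val)) := by
  -- All indices from j − 1 on collapse to the last label, so the labelling is monotone and onto.
  let c : Fin n → Fin j := fun m => ⟨min m.val (j - 1), by omega⟩
  have hc : Monotone c := by
    intro a b hab
    rw [Fin.le_def] at hab ⊢
    simp only [c]
    omega
  have hci : ∀ i, c (Fin.castLE hjn i) = i := by
    intro i
    apply Fin.ext
    simp only [c, Fin.val_castLE]
    omega
  have hsurj : ∀ i, ∃ m, c m = i := fun i => ⟨_, hci i⟩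
  refine ⟨fun i => ⋃ m, ⋃ (_ : c m = i), Y m, ⟨?_, fun i => hY.conn_label hc (hsurj i),
    fun i i' h => hY.touch_label hc (hsurj i) (hsurj i') h⟩, fun i =>
      Set.subset_iUnion₂ (s := fun m (_ : c m = i) => Y m) _ (hci i), fun i w hw => ?_⟩
  · intro i i' hii
    refine Set.disjoint_left.mpr fun w hw hw' => ?_
    obtain ⟨m, hm, hwm⟩ := Set.mem_iUnion₂.mp hw
    obtain ⟨m', hm', hwm'⟩ := Set.mem_iUnion₂.mp hw'
    have : m ≠ m' := by
      rintro rfl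
      exact hii (hm.symm.trans hm')
    exact Set.disjoint_left.mp (hY.disj _ _ this) hwm hwm'
  · obtain ⟨m, hm, hwm⟩ := Set.mem_iUnion₂.mp hw
    refine ⟨m, hwm, ?_⟩
    by_cases h : j ≤ m.val
    · exact Or.inr h
    · left
      rw [← hm]
      apply Fin.ext
      simp only [c, Fin.val_castLE]
      omega

end Cliques

/-! ### Five-root minors whose branch sets are a root with attached blobs -/

section Stars

variable {V : Type*}

theorem isCyc_five_rotate {G : SimpleGraph V} {Y : Fin 5 → Set V} (c : Fin 5) (h : IsCyc G Y) :
    IsCyc G (fun i => Y (i + c)) where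
  disj i j hij := h.disj _ _ fun he => hij (add_right_cancel he)
  conn i := h.conn _
  touch i j hij := h.touch _ _ (by
    revert hij
    unfold CycNext
    revert i j c
    decide)

theorem model_five_of_rotate {G : SimpleGraph V} {U : Set V} {x : Fin 5 → V} (c : Fin 5)
    (h : Model G U (fun i => x (i + c))) : Model G U x := by
  obtain ⟨Y, hY, hYU, hx⟩ := h
  refine ⟨fun i => Y (i + -c), isCyc_five_rotate (-c) hY, fun i => hYU _, fun i => ?_⟩
  have h : x (i + -c + c) ∈ Y (i + -c) := hx (i + -c)
  rwa [neg_add_cancel_right] at h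

theorem isCyc_of_succ {G : SimpleGraph V} {Y : Fin 5 → Set V}
    (hd : ∀ i j, i ≠ j → Disjoint (Y i) (Y j)) (hc : ∀ i, Conn G (Y i))
    (ht : ∀ i : Fin 5, Touch G (Y i) (Y (i + 1))) : IsCyc G Y := by
  refine ⟨hd, hc, fun i j hij => ?_⟩
  have : j = i + 1 := by
    revert hij
    unfold CycNext
    revert i j
    decide
  rw [this]
  exact ht i

/-- The union of `y i` and of the blobs with label `i`. -/
def star {ι : Type*} (y : Fin 5 → V) (B : ι → Set V) (lab : ι → Fin 5) (i : Fin 5) : Set V :=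
  {w | w = y i ∨ ∃ h, lab h = i ∧ w ∈ B h}

theorem conn_star {G : SimpleGraph V} {ι : Type*} {y : Fin 5 → V} {B : ι → Set V}
    {lab : ι → Fin 5} (hB : ∀ h, Conn G (B h)) (hadj : ∀ h, ∃ w ∈ B h, G.Adj w (y (lab h)))
    (i : Fin 5) : Conn G (star y B lab i) := by
  have hsub : ∀ h, lab h = i → B h ⊆ star y B lab i := fun h hh w hw => Or.inr ⟨h, hh, hw⟩
  have hy : y i ∈ star y B lab i := Or.inl rfl
  refine ⟨⟨y i, hy⟩, fun P hP hcl => ?_⟩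
  have hyP : y i ∈ P := by
    obtain ⟨u, huP, rfl | ⟨h, hh, huB⟩⟩ := hP
    · exact huP
    · have h1 := (hB h).subset_of_meets (hsub h hh) hcl ⟨u, huP, huB⟩
      obtain ⟨w, hw, hwy⟩ := hadj h
      rw [hh] at hwy
      exact hcl w (h1 hw) (hsub h hh hw) _ hy hwy
  rintro w (rfl | ⟨h, hh, hw⟩)
  · exact hyP
  · obtain ⟨w', hw', hwy⟩ := hadj h
    rw [hh] at hwy
    refine (hB h).absorb (A := {y i}) (hsub h hh) hcl ⟨y i, rfl, w', hw', Or.inr hwy.symm⟩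
      (by simpa using hyP) (by simpa using hy) hw

/-- Each blob is adjacent to the root it is assigned to. The four ways to realise a link are a
root–root edge, a blob of one root seeing the next root, a blob of the next root seeing the first,
or an edge between two blobs. -/
theorem isCyc_star {G : SimpleGraph V} {ι : Type*} {y : Fin 5 → V} (hy : Function.Injective y)
    {B : ι → Set V} {lab : ι → Fin 5} (hB : ∀ h, Conn G (B h))
    (hdisj : ∀ h h', h ≠ h' → Disjoint (B h) (B h')) (hyB : ∀ h i, y i ∉ B h)
    (hadj : ∀ h, ∃ w ∈ B h, G.Adj w (y (lab h)))
    (hlink : ∀ i : Fin 5, G.Adj (y i) (y (i + 1)) ∨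
      (∃ h, lab h = i ∧ ∃ w ∈ B h, G.Adj w (y (i + 1))) ∨
      (∃ h, lab h = i + 1 ∧ ∃ w ∈ B h, G.Adj w (y i)) ∨
      (∃ h h', lab h = i ∧ lab h' = i + 1 ∧ ∃ w ∈ B h, ∃ w' ∈ B h', G.Adj w w')) :
    IsCyc G (star y B lab) := by
  refine isCyc_of_succ (fun i j hij => ?_) (conn_star hB hadj) fun i => ?_
  · refine Set.disjoint_left.mpr ?_
    rintro w (rfl | ⟨h, hh, hw⟩) (hw' | ⟨h', hh', hw'⟩)
    · exact hij (hy hw')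
    · exact hyB _ _ hw'
    · exact hyB h j (hw' ▸ hw)
    · have : h ≠ h' := by
        rintro rfl
        exact hij (hh.symm.trans hh')
      exact Set.disjoint_left.mp (hdisj _ _ this) hw hw'
  · rcases hlink i with h | ⟨h, hh, w, hw, ha⟩ | ⟨h, hh, w, hw, ha⟩ | ⟨h, h', hh, hh', w, hw, w', hw', ha⟩
    · exact ⟨_, Or.inl rfl, _, Or.inl rfl, Or.inr h⟩
    · exact ⟨w, Or.inr ⟨h, hh, hw⟩, _, Or.inl rfl, Or.inr ha⟩
    · exact ⟨_, Or.inl rfl, w, Or.inr ⟨h, hh, hw⟩, Or.inr ha.symm⟩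
    · exact ⟨w, Or.inr ⟨h, hh, hw⟩, w', Or.inr ⟨h', hh', hw'⟩, Or.inr ha⟩

theorem star_subset {ι : Type*} {y : Fin 5 → V} {B : ι → Set V} {lab : ι → Fin 5}
    {U : Set V} (hy : ∀ i, y i ∈ U) (hB : ∀ h, B h ⊆ U) (i : Fin 5) : star y B lab i ⊆ U := by
  rintro w (rfl | ⟨h, -, hw⟩)
  · exact hy i
  · exact hB h hw

end Stars
end RootedCycle
namespace RootedCycle

/-! ### Menger's theorem, with disjoint connected sets in place of paths -/

section Menger

variable {V : Type*}

/-- `(P, Q)` is a separation of `G[A]` with `X ⊆ P` and `S ⊆ Q`. -/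
structure SepIn (G : SimpleGraph V) (A X S P Q : Finset V) : Prop where
  mem_or : ∀ v, v ∈ A ↔ v ∈ P ∨ v ∈ Q
  left : X ⊆ P
  right : S ⊆ Q
  no_edge : ∀ u ∈ P, u ∉ Q → ∀ v ∈ Q, v ∉ P → ¬ G.Adj u v

-- Induction on the number of edges. If deleting an edge creates a separation of order below |X|,
-- the edge must cross it as pq and the order is |X| − 1. Adding p to the cut for the X-side and q
-- for the S-side gives two instances without the edge; their linkages are glued through the cut and
-- the edge pq.
open Classical in
theorem menger_aux [Fintype V] : ∀ n : ℕ, ∀ (G : SimpleGraph V), G.edgeSet.ncard = n →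
    ∀ A X S : Finset V, X ⊆ A → S ⊆ A →
    (∀ P Q, SepIn G A X S P Q → X.card ≤ (P ∩ Q).card) →
    ∃ Z : V → Set V, (∀ x ∈ X, x ∈ Z x ∧ Z x ⊆ ↑A ∧ Conn G (Z x) ∧ (Z x ∩ ↑S).Nonempty) ∧
      ∀ x ∈ X, ∀ y ∈ X, x ≠ y → Disjoint (Z x) (Z y) := by
  intro n
  induction n using Nat.strong_induction_on with
  | _ n ih =>
  intro G hG A X S hXA hSA hsep
  by_cases hcut : ∀ u ∈ A, ∀ v ∈ A, ¬ G.Adj u v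
  · have h1 := hsep X A ⟨fun v => ⟨Or.inr, fun h => h.elim (fun h => hXA h) id⟩,
      subset_rfl, hSA, fun u hu hu' => absurd (hXA hu) hu'⟩
    -- Without edges every such cover is a separation; this one has intersection X ∩ S, which forces
    -- X ⊆ S, and singletons suffice.
    have h2 := hsep X (S ∪ (A \ X)) ⟨fun v => ⟨fun h => by
        by_cases hv : v ∈ X
        · exact Or.inl hv
        · exact Or.inr (by simp [h, hv]), fun h => h.elim (fun h => hXA h) fun h => by
        rcases Finset.mem_union.mp h with h | h
        · exact hSA h
        · exact (Finset.mem_sdiff.mp h).1⟩, subset_rfl, Finset.subset_union_left,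
      fun u hu _ v hv _ => hcut u (hXA hu) v (by
        rcases Finset.mem_union.mp hv with h | h
        · exact hSA h
        · exact (Finset.mem_sdiff.mp h).1)⟩
    have h3 : X ∩ (S ∪ (A \ X)) = X := Finset.eq_of_subset_of_card_le Finset.inter_subset_left h2
    refine ⟨fun x => {x}, fun x hx => ⟨rfl, by simpa using hXA hx, conn_singleton G x, x, rfl, ?_⟩,
      fun x _ y _ hxy => by simpa using hxy⟩
    have : x ∈ X ∩ (S ∪ (A \ X)) := h3.symm ▸ hx
    simp only [Finset.mem_inter, Finset.mem_union, Finset.mem_sdiff] at this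
    simp only [Finset.mem_coe]
    tauto
  push Not at hcut
  obtain ⟨a, haA, b, hbA, hab⟩ := hcut
  set G₁ := G.deleteEdges {s(a, b)} with hG₁
  have hle : G₁ ≤ G := SimpleGraph.deleteEdges_le _
  have hadj : ∀ u v, G₁.Adj u v ↔ G.Adj u v ∧ s(u, v) ≠ s(a, b) := by
    intro u v
    rw [hG₁, SimpleGraph.deleteEdges_adj, Set.mem_singleton_iff]
  have hcard : G₁.edgeSet.ncard < n := by
    rw [← hG]
    refine Set.ncard_lt_ncard ⟨SimpleGraph.edgeSet_mono hle, fun hcon => ?_⟩ (Set.toFinite _)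
    have : s(a, b) ∈ G₁.edgeSet := hcon hab
    rw [SimpleGraph.mem_edgeSet, hadj] at this
    exact this.2 rfl
  by_cases hsep₁ : ∀ P Q, SepIn G₁ A X S P Q → X.card ≤ (P ∩ Q).card
  · obtain ⟨Z, hZ, hd⟩ := ih _ hcard G₁ rfl A X S hXA hSA hsep₁
    exact ⟨Z, fun x hx => ⟨(hZ x hx).1, (hZ x hx).2.1, (hZ x hx).2.2.1.mono_graph hle,
      (hZ x hx).2.2.2⟩, hd⟩
  push Not at hsep₁
  obtain ⟨P, Q, hPQ, hlt⟩ := hsep₁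
  -- the deleted edge crosses the separation
  have hcross : ∃ p q, p ∈ P ∧ p ∉ Q ∧ q ∈ Q ∧ q ∉ P ∧ G.Adj p q ∧ s(p, q) = s(a, b) := by
    by_contra hcon
    push Not at hcon
    refine absurd (hsep P Q ⟨hPQ.mem_or, hPQ.left, hPQ.right, fun u hu hu' v hv hv' huv => ?_⟩)
      (not_le.mpr hlt)
    exact hPQ.no_edge u hu hu' v hv hv' ((hadj u v).mpr ⟨huv, hcon u v hu hu' hv hv' huv⟩)
  obtain ⟨p, q, hpP, hpQ, hqQ, hqP, hpq, hpqe⟩ := hcross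
  rw [← hpqe] at hadj
  have hPA : P ⊆ A := fun v hv => (hPQ.mem_or v).mpr (Or.inl hv)
  have hQA : Q ⊆ A := fun v hv => (hPQ.mem_or v).mpr (Or.inr hv)
  set T := P ∩ Q with hT
  have hTP : T ⊆ P := Finset.inter_subset_left
  have hTQ : T ⊆ Q := Finset.inter_subset_right
  have hpT : p ∉ T := fun h => hpQ (hTQ h)
  have hqT : q ∉ T := fun h => hqP (hTP h)
  -- any crossing edge of `G` is `pq`
  have hedge : ∀ u ∈ P, u ∉ Q → ∀ v ∈ Q, v ∉ P → G.Adj u v → u = p ∧ v = q := by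
    intro u hu hu' v hv hv' huv
    by_contra hcon
    refine hPQ.no_edge u hu hu' v hv hv' ((hadj u v).mpr ⟨huv, fun he => ?_⟩)
    rcases Sym2.eq_iff.mp he with h | ⟨h, -⟩
    · exact hcon h
    · exact hu' (h ▸ hqQ)
  have hTcard : T.card + 1 = X.card := by
    have h1 := hsep P (insert p Q) ⟨fun v => by
      rw [hPQ.mem_or, Finset.mem_insert]
      constructor
      · rintro (h | h)
        · exact Or.inl h
        · exact Or.inr (Or.inr h)
      · rintro (h | rfl | h)
        · exact Or.inl h
        · exact Or.inl hpP
        · exact Or.inr h, hPQ.left, hPQ.right.trans (Finset.subset_insert _ _), by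
        intro u hu hu' v hv hv' huv
        rw [Finset.mem_insert, not_or] at hu'
        rcases Finset.mem_insert.mp hv with rfl | hv
        · exact hv' hpP
        · exact hu'.1 (hedge u hu hu'.2 v hv hv' huv).1⟩
    have h2 : P ∩ insert p Q = insert p T := by
      rw [Finset.inter_insert_of_mem hpP]
    rw [h2, Finset.card_insert_of_notMem hpT] at h1
    omega
  have hcard' : ∀ v, v ∉ T → (insert v T).card = X.card := by
    intro v hv
    rw [Finset.card_insert_of_notMem hv, hTcard]
  -- the side of `X`
  obtain ⟨Z₁, hZ₁, hd₁⟩ := ih _ hcard G₁ rfl P X (insert p T) hPQ.left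
    (Finset.insert_subset hpP hTP) (by
      intro C D hCD
      have hCP : C ⊆ P := fun v hv => (hCD.mem_or v).mpr (Or.inl hv)
      have hDP : D ⊆ P := fun v hv => (hCD.mem_or v).mpr (Or.inr hv)
      have hTD : T ⊆ D := (Finset.subset_insert _ _).trans hCD.right
      have hpD : p ∈ D := hCD.right (Finset.mem_insert_self _ _)
      have h1 := hsep C (D ∪ Q) ⟨fun v => by
        rw [hPQ.mem_or, hCD.mem_or, Finset.mem_union, or_assoc], hCD.left,
        hPQ.right.trans Finset.subset_union_right, by
        intro u hu hu' v hv hv' huv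
        rw [Finset.mem_union, not_or] at hu'
        by_cases hvP : v ∈ P
        · have hvD : v ∈ D := ((hCD.mem_or v).mp hvP).resolve_left hv'
          refine hCD.no_edge u hu hu'.1 v hvD hv' ((hadj u v).mpr ⟨huv, fun he => ?_⟩)
          rcases Sym2.eq_iff.mp he with ⟨h, -⟩ | ⟨h, -⟩
          · exact hu'.1 (h ▸ hpD)
          · exact hu'.2 (h ▸ hqQ)
        · have hvQ : v ∈ Q := (Finset.mem_union.mp hv).resolve_left fun h => hvP (hDP h)
          have := (hedge u (hCP hu) hu'.2 v hvQ hvP huv).1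
          exact hu'.1 (this ▸ hpD)⟩
      refine h1.trans (Finset.card_le_card ?_)
      intro v hv
      rw [Finset.mem_inter, Finset.mem_union] at hv
      rw [Finset.mem_inter]
      refine ⟨hv.1, hv.2.elim id fun h => hTD ?_⟩
      exact Finset.mem_inter.mpr ⟨hCP hv.1, h⟩)
  -- the side of `S`
  obtain ⟨Z₂, hZ₂, hd₂⟩ := ih _ hcard G₁ rfl Q (insert q T) S
    (Finset.insert_subset hqQ hTQ) hPQ.right (by
      intro C D hCD
      have hCQ : C ⊆ Q := fun v hv => (hCD.mem_or v).mpr (Or.inl hv)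
      have hDQ : D ⊆ Q := fun v hv => (hCD.mem_or v).mpr (Or.inr hv)
      have hTC : T ⊆ C := (Finset.subset_insert _ _).trans hCD.left
      have hqC : q ∈ C := hCD.left (Finset.mem_insert_self _ _)
      rw [hcard' q hqT]
      have h1 := hsep (P ∪ C) D ⟨fun v => by
        rw [hPQ.mem_or, hCD.mem_or, Finset.mem_union, or_assoc],
        hPQ.left.trans Finset.subset_union_left, hCD.right, by
        intro u hu hu' v hv hv' huv
        rw [Finset.mem_union, not_or] at hv'
        by_cases huQ : u ∈ Q
        · have huC : u ∈ C := ((hCD.mem_or u).mp huQ).resolve_right hu'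
          refine hCD.no_edge u huC hu' v hv hv'.2 ((hadj u v).mpr ⟨huv, fun he => ?_⟩)
          rcases Sym2.eq_iff.mp he with ⟨-, h⟩ | ⟨-, h⟩
          · exact hv'.2 (h ▸ hqC)
          · exact hv'.1 (h ▸ hpP)
        · have huP : u ∈ P := (Finset.mem_union.mp hu).resolve_right fun h => huQ (hCQ h)
          have := (hedge u huP huQ v (hDQ hv) hv'.1 huv).2
          exact hv'.2 (this ▸ hqC)⟩
      refine h1.trans (Finset.card_le_card ?_)
      intro v hv
      rw [Finset.mem_inter, Finset.mem_union] at hv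
      rw [Finset.mem_inter]
      refine ⟨hv.1.elim (fun h => hTC ?_) id, hv.2⟩
      exact Finset.mem_inter.mpr ⟨h, hDQ hv.2⟩)
  -- each `Z₁ x` has exactly one vertex in `insert p T`
  choose! f hf using fun x hx => (hZ₁ x hx).2.2.2
  have hfmem : ∀ x ∈ X, f x ∈ insert p T := fun x hx => by
    simpa using (hf x hx).2
  have hfinj : Set.InjOn f X := by
    intro x hx y hy hxy
    by_contra hne
    exact Set.disjoint_left.mp (hd₁ x hx y hy hne) (hf x hx).1 (hxy ▸ (hf y hy).1)
  have hfimg : X.image f = insert p T := by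
    apply Finset.eq_of_subset_of_card_le
    · intro w hw
      obtain ⟨x, hx, rfl⟩ := Finset.mem_image.mp hw
      exact hfmem x hx
    · rw [Finset.card_image_of_injOn hfinj, hcard' p hpT]
  have hfuniq : ∀ x ∈ X, ∀ w ∈ Z₁ x, w ∈ insert p T → w = f x := by
    intro x hx w hw hwT
    rw [← hfimg] at hwT
    obtain ⟨y, hy, rfl⟩ := Finset.mem_image.mp hwT
    by_contra hne
    have hxy : x ≠ y := by
      rintro rfl
      exact hne rfl
    exact Set.disjoint_left.mp (hd₁ x hx y hy hxy) hw (hf y hy).1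
  -- Matches the two enlarged cuts: the identity on the old cut, with p sent across the deleted edge
  -- to q.
  let g : V → V := fun w => if w = p then q else w
  have hg : ∀ w ∈ insert p T, g w ∈ insert q T := by
    intro w hw
    by_cases h : w = p
    · simp [g, h]
    · simp only [g, h, if_false]
      exact Finset.mem_insert_of_mem ((Finset.mem_insert.mp hw).resolve_left h)
  have hginj : ∀ w ∈ insert p T, ∀ w' ∈ insert p T, g w = g w' → w = w' := by
    intro w hw w' hw' h
    by_cases h1 : w = p <;> by_cases h2 : w' = p
    · rw [h1, h2]
    · simp only [g, h1, h2, if_true, if_false] at h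
      exact absurd (h ▸ (Finset.mem_insert.mp hw').resolve_left h2) hqT
    · simp only [g, h1, h2, if_true, if_false] at h
      exact absurd (h ▸ (Finset.mem_insert.mp hw).resolve_left h1) hqT
    · simpa only [g, h1, h2, if_false] using h
  have hgtouch : ∀ w, Touch G {w} {g w} := by
    intro w
    by_cases h : w = p
    · exact ⟨w, rfl, g w, rfl, Or.inr (by simpa [g, h] using hpq)⟩
    · exact ⟨w, rfl, g w, rfl, Or.inl (by simp [g, h])⟩
  have hcrossdisj : ∀ x ∈ X, ∀ y ∈ X, x ≠ y → Disjoint (Z₁ x) (Z₂ (g (f y))) := by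
    intro x hx y hy hxy
    refine Set.disjoint_left.mpr fun w hw hw' => ?_
    have hwP := (hZ₁ x hx).2.1 hw
    have hwQ := (hZ₂ _ (hg _ (hfmem y hy))).2.1 hw'
    have hwT : w ∈ T := Finset.mem_inter.mpr ⟨hwP, hwQ⟩
    have h1 : w = f x := hfuniq x hx w hw (Finset.mem_insert_of_mem hwT)
    have hwne : w ≠ p := fun h => hpT (h ▸ hwT)
    have hgw : g w = w := by simp [g, hwne]
    have h2 : g (f y) = w := by
      by_contra hne
      exact Set.disjoint_left.mp (hd₂ _ (hg _ (hfmem y hy)) w (Finset.mem_insert_of_mem hwT) hne)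
        hw' (hZ₂ w (Finset.mem_insert_of_mem hwT)).1
    have h3 : f y = w := hginj _ (hfmem y hy) _ (Finset.mem_insert_of_mem hwT) (by rw [h2, hgw])
    exact hxy (hfinj hx hy (h1.symm.trans h3.symm))
  refine ⟨fun x => Z₁ x ∪ Z₂ (g (f x)), fun x hx => ⟨Or.inl (hZ₁ x hx).1, ?_, ?_, ?_⟩,
    fun x hx y hy hxy => ?_⟩
  · exact Set.union_subset ((hZ₁ x hx).2.1.trans (by exact_mod_cast hPA))
      ((hZ₂ _ (hg _ (hfmem x hx))).2.1.trans (by exact_mod_cast hQA))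
  · refine ((hZ₁ x hx).2.2.1.mono_graph hle).union
      ((hZ₂ _ (hg _ (hfmem x hx))).2.2.1.mono_graph hle) ?_
    exact (hgtouch (f x)).mono (by simpa using (hf x hx).1)
      (by simpa using (hZ₂ _ (hg _ (hfmem x hx))).1)
  · obtain ⟨w, hw, hwS⟩ := (hZ₂ _ (hg _ (hfmem x hx))).2.2.2
    exact ⟨w, Or.inr hw, hwS⟩
  · rw [Set.disjoint_union_left, Set.disjoint_union_right, Set.disjoint_union_right]
    refine ⟨⟨hd₁ x hx y hy hxy, hcrossdisj x hx y hy hxy⟩,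
      (hcrossdisj y hy x hx hxy.symm).symm, hd₂ _ (hg _ (hfmem x hx)) _ (hg _ (hfmem y hy)) ?_⟩
    intro h
    exact hxy (hfinj hx hy (hginj _ (hfmem x hx) _ (hfmem y hy) h))

open Classical in
/-- Menger's theorem: a separation of minimum order between `X` and `S`, joined to `S` by disjoint
connected sets. -/
theorem exists_separation_linked [Fintype V] (G : SimpleGraph V) {A X S : Finset V} (hXA : X ⊆ A)
    (hSA : S ⊆ A) :
    ∃ P Q, SepIn G A X S P Q ∧ (P ∩ Q = X ∨ (P ∩ Q).card < X.card) ∧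
      (P ∩ Q).card ≤ S.card ∧
      ∃ Z : V → Set V, (∀ x ∈ P ∩ Q, x ∈ Z x ∧ Z x ⊆ ↑Q ∧ Conn G (Z x) ∧ (Z x ∩ ↑S).Nonempty) ∧
        ∀ x ∈ P ∩ Q, ∀ y ∈ P ∩ Q, x ≠ y → Disjoint (Z x) (Z y) := by
  have htriv : SepIn G A X S X A := ⟨fun v => ⟨Or.inr, fun h => h.elim (fun h => hXA h) id⟩,
      subset_rfl, hSA, fun u hu hu' => absurd (hXA hu) hu'⟩
  have hXAi : X ∩ A = X := Finset.inter_eq_left.mpr hXA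
  have key : ∀ P Q, SepIn G A X S P Q →
      (∀ P' Q', SepIn G A X S P' Q' → (P ∩ Q).card ≤ (P' ∩ Q').card) →
      ∃ Z : V → Set V, (∀ x ∈ P ∩ Q, x ∈ Z x ∧ Z x ⊆ ↑Q ∧ Conn G (Z x) ∧ (Z x ∩ ↑S).Nonempty) ∧
        ∀ x ∈ P ∩ Q, ∀ y ∈ P ∩ Q, x ≠ y → Disjoint (Z x) (Z y) := by
    intro P Q hPQ hmin
    refine menger_aux _ G rfl Q (P ∩ Q) S Finset.inter_subset_right hPQ.right ?_
    intro C D hCD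
    have hCQ : C ⊆ Q := fun v hv => (hCD.mem_or v).mpr (Or.inl hv)
    have hDQ : D ⊆ Q := fun v hv => (hCD.mem_or v).mpr (Or.inr hv)
    have h1 := hmin (P ∪ C) D ⟨fun v => by
        rw [hPQ.mem_or, hCD.mem_or, Finset.mem_union, or_assoc],
        hPQ.left.trans Finset.subset_union_left, hCD.right, by
        intro u hu hu' v hv hv' huv
        rw [Finset.mem_union, not_or] at hv'
        by_cases huQ : u ∈ Q
        · exact hCD.no_edge u (((hCD.mem_or u).mp huQ).resolve_right hu') hu' v hv hv'.2 huv
        · exact hPQ.no_edge u ((Finset.mem_union.mp hu).resolve_right fun h => huQ (hCQ h)) huQ v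
            (hDQ hv) hv'.1 huv⟩
    refine h1.trans (Finset.card_le_card ?_)
    intro v hv
    rw [Finset.mem_inter, Finset.mem_union] at hv
    rw [Finset.mem_inter]
    exact ⟨hv.1.elim (fun h => hCD.left (Finset.mem_inter.mpr ⟨h, hDQ hv.2⟩)) id, hv.2⟩
  have hcardle : ∀ P Q : Finset V, (∃ Z : V → Set V,
      (∀ x ∈ P ∩ Q, x ∈ Z x ∧ Z x ⊆ ↑Q ∧ Conn G (Z x) ∧ (Z x ∩ ↑S).Nonempty) ∧
        ∀ x ∈ P ∩ Q, ∀ y ∈ P ∩ Q, x ≠ y → Disjoint (Z x) (Z y)) → (P ∩ Q).card ≤ S.card := by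
    rintro P Q ⟨Z, hZ, hd⟩
    choose! f hf using fun x hx => (hZ x hx).2.2.2
    refine Finset.card_le_card_of_injOn f (fun x hx => (hf x (Finset.mem_coe.mp hx)).2) ?_
    intro x hx y hy hxy
    rw [Finset.mem_coe] at hx hy
    by_contra hne
    exact Set.disjoint_left.mp (hd x hx y hy hne) (hf x hx).1 (hxy ▸ (hf y hy).1)
  by_cases h : ∀ P Q, SepIn G A X S P Q → X.card ≤ (P ∩ Q).card
  · have := key X A htriv (by rwa [hXAi])
    exact ⟨X, A, htriv, Or.inl hXAi, hcardle _ _ this, this⟩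
  · push Not at h
    obtain ⟨P₀, Q₀, h₀, hlt⟩ := h
    let p : ℕ → Prop := fun m => ∃ P Q, SepIn G A X S P Q ∧ (P ∩ Q).card = m
    have hp : ∃ m, p m := ⟨_, P₀, Q₀, h₀, rfl⟩
    obtain ⟨P, Q, hPQ, hm⟩ := Nat.find_spec hp
    have hmin : ∀ P' Q', SepIn G A X S P' Q' → (P ∩ Q).card ≤ (P' ∩ Q').card := fun P' Q' h' =>
      hm ▸ Nat.find_min' hp ⟨P', Q', h', rfl⟩
    have := key P Q hPQ hmin
    exact ⟨P, Q, hPQ, Or.inr (lt_of_le_of_lt (hmin P₀ Q₀ h₀) hlt), hcardle _ _ this, this⟩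

end Menger
end RootedCycle
namespace RootedCycle

/-! ### Counting the edges that meet a vertex set -/

section EdgeCounts

theorem rho_empty {V : Type*} (G : SimpleGraph V) : rho G ∅ = 0 := by
  have : {e : Sym2 V | e ∈ G.edgeSet ∧ ∃ v ∈ (∅ : Set V), v ∈ e} = ∅ := by
    ext e
    simp
  rw [rho, this, Set.ncard_empty]

variable {V : Type*} [Fintype V]

open Classical in
/-- The neighbours of `a` outside `D`. -/
noncomputable def outNbr (G : SimpleGraph V) (D : Finset V) (a : V) : Finset V :=
  Finset.univ.filter fun w => G.Adj a w ∧ w ∉ D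

open Classical in
/-- The vertices outside `D` with a neighbour in `D`. -/
noncomputable def bdry (G : SimpleGraph V) (D : Finset V) : Finset V :=
  Finset.univ.filter fun v => v ∉ D ∧ ∃ u ∈ D, G.Adj u v

theorem mem_outNbr {G : SimpleGraph V} {D : Finset V} {a w : V} :
    w ∈ outNbr G D a ↔ G.Adj a w ∧ w ∉ D := by
  simp [outNbr]

theorem mem_bdry {G : SimpleGraph V} {D : Finset V} {v : V} :
    v ∈ bdry G D ↔ v ∉ D ∧ ∃ u ∈ D, G.Adj u v := by
  simp [bdry]

theorem bdry_subset_iff {G : SimpleGraph V} {D S : Finset V} :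
    bdry G D ⊆ S ↔ ∀ u ∈ D, ∀ v, G.Adj u v → v ∈ D ∨ v ∈ S := by
  constructor
  · intro h u hu v huv
    by_cases hv : v ∈ D
    · exact Or.inl hv
    · exact Or.inr (h (mem_bdry.mpr ⟨hv, u, hu, huv⟩))
  · intro h v hv
    obtain ⟨hvD, u, hu, huv⟩ := mem_bdry.mp hv
    exact (h u hu v huv).resolve_left hvD

theorem disjoint_bdry (G : SimpleGraph V) (D : Finset V) : Disjoint D (bdry G D) :=
  Finset.disjoint_left.mpr fun _ hv hv' => (mem_bdry.mp hv').1 hv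

theorem rho_le_of_imp {G H : SimpleGraph V} {D E : Set V}
    (h : ∀ u v, G.Adj u v → u ∈ D → H.Adj u v ∧ (u ∈ E ∨ v ∈ E)) : rho G D ≤ rho H E := by
  refine Set.ncard_le_ncard ?_ (Set.toFinite _)
  rintro e ⟨he, v, hv, hve⟩
  induction e with | _ a b
  rw [SimpleGraph.mem_edgeSet] at he
  have key : H.Adj a b ∧ (a ∈ E ∨ b ∈ E) := by
    rcases Sym2.mem_iff.mp hve with rfl | rfl
    · exact h _ _ he hv
    · have := h _ _ he.symm hv
      exact ⟨this.1.symm, this.2.symm⟩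
  refine ⟨key.1, ?_⟩
  rcases key.2 with h | h
  · exact ⟨a, h, Sym2.mem_mk_left a b⟩
  · exact ⟨b, h, Sym2.mem_mk_right a b⟩

theorem rho_congr {G H : SimpleGraph V} {D : Set V} (h : ∀ u ∈ D, ∀ v, G.Adj u v ↔ H.Adj u v) :
    rho G D = rho H D :=
  le_antisymm (rho_le_of_imp fun u v huv hu => ⟨(h u hu v).mp huv, Or.inl hu⟩)
    (rho_le_of_imp fun u v huv hu => ⟨(h u hu v).mpr huv, Or.inl hu⟩)

open Classical in
theorem rho_insert (G : SimpleGraph V) {D : Finset V} {a : V} (ha : a ∉ D) :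
    rho G ↑(insert a D) = rho G ↑D + (outNbr G D a).card := by
  have h1 : {e : Sym2 V | e ∈ G.edgeSet ∧ ∃ v ∈ (↑(insert a D) : Set V), v ∈ e} =
      {e : Sym2 V | e ∈ G.edgeSet ∧ ∃ v ∈ (↑D : Set V), v ∈ e} ∪
        (fun w => s(a, w)) '' (↑(outNbr G D a) : Set V) := by
    ext e
    constructor
    · rintro ⟨he, v, hv, hve⟩
      by_cases h : ∃ v ∈ (↑D : Set V), v ∈ e
      · exact Or.inl ⟨he, h⟩
      · right
        have hva : v = a := by
          rcases Finset.mem_insert.mp (Finset.mem_coe.mp hv) with h1 | h1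
          · exact h1
          · exact absurd ⟨v, h1, hve⟩ h
        subst hva
        obtain ⟨w, rfl⟩ := Sym2.mem_iff_exists.mp hve
        refine ⟨w, ?_, rfl⟩
        rw [Finset.mem_coe, mem_outNbr]
        exact ⟨he, fun hw => h ⟨w, hw, Sym2.mem_mk_right _ _⟩⟩
    · rintro (⟨he, v, hv, hve⟩ | ⟨w, hw, rfl⟩)
      · exact ⟨he, v, Finset.mem_insert_of_mem hv, hve⟩
      · rw [Finset.mem_coe, mem_outNbr] at hw
        exact ⟨hw.1, a, Finset.mem_insert_self _ _, Sym2.mem_mk_left _ _⟩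
  rw [rho, h1, Set.ncard_union_eq ?_ (Set.toFinite _) (Set.toFinite _), rho,
    Set.ncard_image_of_injective _ (fun x y h => Sym2.congr_right.mp h), Set.ncard_coe_finset]
  refine Set.disjoint_left.mpr ?_
  rintro _ ⟨_, v, hv, hve⟩ ⟨w, hw, rfl⟩
  rw [Finset.mem_coe, mem_outNbr] at hw
  rcases Sym2.mem_iff.mp hve with rfl | rfl
  · exact ha hv
  · exact hw.2 hv

theorem rho_union_le (G : SimpleGraph V) (D E : Set V) : rho G (D ∪ E) ≤ rho G D + rho G E := by
  refine le_trans (Set.ncard_le_ncard ?_ (Set.toFinite _)) (Set.ncard_union_le _ _)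
  rintro e ⟨he, v, hv | hv, hve⟩
  · exact Or.inl ⟨he, v, hv, hve⟩
  · exact Or.inr ⟨he, v, hv, hve⟩

theorem rho_union_eq {G : SimpleGraph V} {D E : Set V} (hd : Disjoint D E)
    (h : ∀ u ∈ D, ∀ v ∈ E, ¬ G.Adj u v) : rho G (D ∪ E) = rho G D + rho G E := by
  refine le_antisymm (rho_union_le G D E) ?_
  rw [rho, rho, rho, ← Set.ncard_union_eq ?_ (Set.toFinite _) (Set.toFinite _)]
  · refine Set.ncard_le_ncard ?_ (Set.toFinite _)
    rintro e (⟨he, v, hv, hve⟩ | ⟨he, v, hv, hve⟩)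
    · exact ⟨he, v, Or.inl hv, hve⟩
    · exact ⟨he, v, Or.inr hv, hve⟩
  · refine Set.disjoint_left.mpr ?_
    rintro e ⟨he, v, hv, hve⟩ ⟨_, w, hw, hwe⟩
    have hne : v ≠ w := by
      rintro rfl
      exact Set.disjoint_left.mp hd hv hw
    have : e = s(v, w) := (Sym2.mem_and_mem_iff hne).mp ⟨hve, hwe⟩
    subst this
    exact h v hv w hw he

/-- An edge inside D is counted by the degrees of both ends; an edge leaving D is counted once as a
degree and once as an outgoing edge at the same end. -/
theorem two_mul_rho (G : SimpleGraph V) (D : Finset V) :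
    2 * rho G ↑D = ∑ v ∈ D, ((outNbr G ∅ v).card + (outNbr G D v).card) := by
  classical
  induction D using Finset.induction_on with
  | empty => simp [rho_empty]
  | insert a D ha ih =>
    rw [rho_insert G ha, mul_add, ih, Finset.sum_insert ha]
    have h1 : outNbr G (insert a D) a = outNbr G D a := by
      ext w
      simp only [mem_outNbr, Finset.mem_insert, not_or]
      constructor
      · exact fun h => ⟨h.1, h.2.2⟩
      · exact fun h => ⟨h.1, fun he => h.1.ne he.symm, h.2⟩
    have h2 : ∀ v ∈ D, (outNbr G D v).card =
        (outNbr G (insert a D) v).card + if G.Adj a v then 1 else 0 := by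
      intro v hv
      split_ifs with hav
      · have : outNbr G D v = insert a (outNbr G (insert a D) v) := by
          ext w
          simp only [mem_outNbr, Finset.mem_insert, not_or]
          constructor
          · rintro ⟨h, hw⟩
            by_cases hwa : w = a
            · exact Or.inl hwa
            · exact Or.inr ⟨h, hwa, hw⟩
          · rintro (rfl | ⟨h, -, hw⟩)
            · exact ⟨hav.symm, ha⟩
            · exact ⟨h, hw⟩
        rw [this, Finset.card_insert_of_notMem]
        simp [mem_outNbr]
      · have : outNbr G D v = outNbr G (insert a D) v := by
          ext w
          simp only [mem_outNbr, Finset.mem_insert, not_or]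
          constructor
          · rintro ⟨h, hw⟩
            exact ⟨h, fun hwa => hav (hwa ▸ h.symm), hw⟩
          · rintro ⟨h, -, hw⟩
            exact ⟨h, hw⟩
        rw [this, add_zero]
    have h3 : (outNbr G ∅ a).card = (outNbr G D a).card + ∑ v ∈ D, if G.Adj a v then 1 else 0 := by
      rw [← Finset.card_filter, ← Finset.card_union_of_disjoint]
      · congr 1
        ext w
        simp only [mem_outNbr, Finset.mem_union, Finset.mem_filter, Finset.notMem_empty,
          not_false_eq_true, and_true]
        tauto
      · refine Finset.disjoint_left.mpr fun w hw hw' => ?_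
        exact (mem_outNbr.mp hw).2 (Finset.mem_filter.mp hw').1
    have h4 : ∑ v ∈ D, ((outNbr G ∅ v).card + (outNbr G D v).card) =
        ∑ v ∈ D, ((outNbr G ∅ v).card + (outNbr G (insert a D) v).card) +
          ∑ v ∈ D, if G.Adj a v then 1 else 0 := by
      rw [← Finset.sum_add_distrib]
      exact Finset.sum_congr rfl fun v hv => by rw [h2 v hv, add_assoc]
    rw [h4, h1, h3]
    ring

theorem rho_deleteEdges_of_mem {G : SimpleGraph V} {D : Set V} {a b : V} (hab : G.Adj a b)
    (h : a ∈ D ∨ b ∈ D) : rho (G.deleteEdges {s(a, b)}) D + 1 = rho G D := by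
  have hmem : s(a, b) ∈ {e : Sym2 V | e ∈ G.edgeSet ∧ ∃ v ∈ D, v ∈ e} := by
    refine ⟨hab, ?_⟩
    rcases h with h | h
    · exact ⟨a, h, Sym2.mem_mk_left _ _⟩
    · exact ⟨b, h, Sym2.mem_mk_right _ _⟩
  rw [rho, rho, ← Set.ncard_sdiff_singleton_add_one hmem (Set.toFinite _)]
  congr 2
  ext e
  simp only [SimpleGraph.edgeSet_deleteEdges, Set.mem_sdiff, Set.mem_ofPred_eq,
    Set.mem_singleton_iff]
  tauto

open Classical in
theorem rho_le_cliqueOn (G : SimpleGraph V) (W D : Finset V) (S : Set V) :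
    rho G ↑W ≤ rho G ↑D + rho (cliqueOn G ↑D S) ↑(W \ D) := by
  refine le_trans (Set.ncard_le_ncard ?_ (Set.toFinite _)) (Set.ncard_union_le _ _)
  rintro e ⟨he, v, hv, hve⟩
  by_cases hD : ∃ u ∈ (↑D : Set V), u ∈ e
  · exact Or.inl ⟨he, hD⟩
  · obtain ⟨w, rfl⟩ := Sym2.mem_iff_exists.mp hve
    have hvD : v ∉ (↑D : Set V) := fun h => hD ⟨v, h, Sym2.mem_mk_left _ _⟩
    have hwD : w ∉ (↑D : Set V) := fun h => hD ⟨w, h, Sym2.mem_mk_right _ _⟩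
    exact Or.inr ⟨⟨SimpleGraph.Adj.ne he, hvD, hwD, Or.inl he⟩, v, by
      simpa using ⟨hv, hvD⟩, hve⟩

-- The strict form is used when counts are tight, to show that the clique contributed no new edge at
-- W.
open Classical in
theorem rho_lt_cliqueOn {G : SimpleGraph V} {W D : Finset V} {S : Set V} {a b : V}
    (hab : (cliqueOn G ↑D S).Adj a b) (hab' : ¬ G.Adj a b) (ha : a ∈ W) :
    rho G ↑W < rho G ↑D + rho (cliqueOn G ↑D S) ↑(W \ D) := by
  have h1 : (Set.ncard (insert s(a, b)
      {e : Sym2 V | e ∈ G.edgeSet ∧ ∃ v ∈ (↑W : Set V), v ∈ e})) = rho G ↑W + 1 :=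
    Set.ncard_insert_of_notMem (fun h => hab' h.1) (Set.toFinite _)
  rw [← Nat.succ_le_iff, Nat.succ_eq_add_one, ← h1]
  refine le_trans (Set.ncard_le_ncard ?_ (Set.toFinite _)) (Set.ncard_union_le _ _)
  rintro e (rfl | ⟨he, v, hv, hve⟩)
  · exact Or.inr ⟨hab, a, by simpa using ⟨ha, hab.2.1⟩, Sym2.mem_mk_left _ _⟩
  by_cases hD : ∃ u ∈ (↑D : Set V), u ∈ e
  · exact Or.inl ⟨he, hD⟩
  · obtain ⟨w, rfl⟩ := Sym2.mem_iff_exists.mp hve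
    have hvD : v ∉ (↑D : Set V) := fun h => hD ⟨v, h, Sym2.mem_mk_left _ _⟩
    have hwD : w ∉ (↑D : Set V) := fun h => hD ⟨w, h, Sym2.mem_mk_right _ _⟩
    exact Or.inr ⟨⟨SimpleGraph.Adj.ne he, hvD, hwD, Or.inl he⟩, v, by
      simpa using ⟨hv, hvD⟩, hve⟩

end EdgeCounts

/-! ### Contractions and the edges they lose -/

section Contraction

variable {V : Type*}

/-- The graph obtained by redirecting the edges at `v` to `u`. -/
def contract (G : SimpleGraph V) (u v : V) : SimpleGraph V where
  Adj a b := a ≠ b ∧ a ≠ v ∧ b ≠ v ∧ (G.Adj a b ∨ (a = u ∧ G.Adj v b) ∨ (b = u ∧ G.Adj v a))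
  symm := ⟨fun _ _ h =>
    ⟨h.1.symm, h.2.2.1, h.2.1, h.2.2.2.imp SimpleGraph.Adj.symm Or.symm⟩⟩
  loopless := ⟨fun _ h => h.1 rfl⟩

theorem contract_adj {G : SimpleGraph V} {u v a b : V} : (contract G u v).Adj a b ↔
    a ≠ b ∧ a ≠ v ∧ b ≠ v ∧ (G.Adj a b ∨ (a = u ∧ G.Adj v b) ∨ (b = u ∧ G.Adj v a)) := Iff.rfl

theorem contract_adj_of_ne {G : SimpleGraph V} {u v a b : V} (ha : a ≠ u) (hb : b ≠ u) :
    (contract G u v).Adj a b ↔ a ≠ v ∧ b ≠ v ∧ G.Adj a b := by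
  rw [contract_adj]
  constructor
  · rintro ⟨-, h1, h2, h | ⟨h, -⟩ | ⟨h, -⟩⟩
    · exact ⟨h1, h2, h⟩
    · exact absurd h ha
    · exact absurd h hb
  · rintro ⟨h1, h2, h⟩
    exact ⟨h.ne, h1, h2, Or.inl h⟩

variable [Fintype V]

-- For a common neighbour w of u and v in D, the edges wu and wv become one. The comparison is made
-- vertex by vertex on both summands of `two_mul_rho`.
open Classical in
theorem rho_contract_add_le {G : SimpleGraph V} {D : Finset V} {u v : V} (hu : u ∉ D)
    (hv : v ∉ D) : rho (contract G u v) ↑D + (D.filter fun w => G.Adj u w ∧ G.Adj v w).card ≤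
      rho G ↑D := by
  have key : ∀ K : Finset V, u ∉ K → v ∉ K → ∀ w ∈ D,
      (outNbr (contract G u v) K w).card + (if G.Adj u w ∧ G.Adj v w then 1 else 0) ≤
        (outNbr G K w).card := by
    intro K huK hvK w hw
    have hwu : w ≠ u := fun h => hu (h ▸ hw)
    have hwv : w ≠ v := fun h => hv (h ▸ hw)
    by_cases hvw : G.Adj v w
    · have hvo : v ∈ outNbr G K w := mem_outNbr.mpr ⟨hvw.symm, hvK⟩
      have hpos : 0 < (outNbr G K w).card := Finset.card_pos.mpr ⟨v, hvo⟩
      have hsub : outNbr (contract G u v) K w ⊆ insert u ((outNbr G K w).erase v) := by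
        intro z hz
        obtain ⟨⟨-, -, hzv, h | ⟨h, -⟩ | ⟨h, -⟩⟩, hzK⟩ := mem_outNbr.mp hz
        · exact Finset.mem_insert_of_mem (Finset.mem_erase.mpr ⟨hzv, mem_outNbr.mpr ⟨h, hzK⟩⟩)
        · exact absurd h hwu
        · exact h ▸ Finset.mem_insert_self _ _
      by_cases huw : G.Adj u w
      · rw [if_pos ⟨huw, hvw⟩]
        have h1 := Finset.card_le_card hsub
        by_cases huv : u = v
        · subst huv
          have h2 : outNbr (contract G u u) K w ⊆ (outNbr G K w).erase u := by
            intro z hz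
            have h3 := hsub hz
            have hzv := (mem_outNbr.mp hz).1.2.2.1
            exact (Finset.mem_insert.mp h3).resolve_left hzv
          have := Finset.card_le_card h2
          rw [Finset.card_erase_of_mem hvo] at this
          omega
        · rw [Finset.insert_eq_of_mem (Finset.mem_erase.mpr
            ⟨huv, mem_outNbr.mpr ⟨huw.symm, huK⟩⟩), Finset.card_erase_of_mem hvo] at h1
          omega
      · rw [if_neg fun h => huw h.1]
        have h1 := (Finset.card_le_card hsub).trans (Finset.card_insert_le _ _)
        rw [Finset.card_erase_of_mem hvo] at h1
        omega
    · rw [if_neg fun h => hvw h.2, add_zero]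
      refine Finset.card_le_card fun z hz => ?_
      obtain ⟨⟨-, -, hzv, h | ⟨h, -⟩ | ⟨h, h'⟩⟩, hzK⟩ := mem_outNbr.mp hz
      · exact mem_outNbr.mpr ⟨h, hzK⟩
      · exact absurd h hwu
      · exact absurd h' hvw
  have h1 := two_mul_rho G D
  have h2 := two_mul_rho (contract G u v) D
  have h3 : ∑ w ∈ D, ((outNbr (contract G u v) ∅ w).card +
      (outNbr (contract G u v) D w).card) + 2 * ∑ w ∈ D,
        (if G.Adj u w ∧ G.Adj v w then 1 else 0) ≤
      ∑ w ∈ D, ((outNbr G ∅ w).card + (outNbr G D w).card) := by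
    rw [Finset.mul_sum, ← Finset.sum_add_distrib]
    refine Finset.sum_le_sum fun w hw => ?_
    have a1 := key ∅ (Finset.notMem_empty _) (Finset.notMem_empty _) w hw
    have a2 := key D hu hv w hw
    omega
  rw [← h1, ← h2] at h3
  rw [Finset.card_filter]
  omega

open Classical in
/-- The neighbours `w ≠ u` of `v` such that contracting `uv` loses the edge `vw`. -/
noncomputable def lostNbr (G : SimpleGraph V) (W : Finset V) (u v : V) : Finset V :=
  (outNbr G ∅ v).filter fun w => w ≠ u ∧ (G.Adj u w ∨ (u ∉ W ∧ w ∉ W))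

theorem mem_lostNbr {G : SimpleGraph V} {W : Finset V} {u v w : V} :
    w ∈ lostNbr G W u v ↔ G.Adj v w ∧ w ≠ u ∧ (G.Adj u w ∨ (u ∉ W ∧ w ∉ W)) := by
  simp [lostNbr, mem_outNbr]

-- Edges avoiding v survive, and an edge vw with w not lost becomes a new counted edge uw. What
-- disappears is uv itself, the 1 in the bound, and the edges to lost neighbours.
open Classical in
theorem rho_le_contract {G : SimpleGraph V} {W : Finset V} {u v : V}
    (huv : u ≠ v) :
    rho G ↑W ≤ rho (contract G u v) ↑(W.erase v) + 1 + (lostNbr G W u v).card := by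
  set O := (outNbr G ∅ v).filter fun w => w ≠ u ∧ ¬ (G.Adj u w ∨ (u ∉ W ∧ w ∉ W)) with hO
  have hdeg : (outNbr G ∅ v).card ≤ 1 + (lostNbr G W u v).card + O.card := by
    have : outNbr G ∅ v ⊆ {u} ∪ lostNbr G W u v ∪ O := by
      intro w hw
      simp only [hO, lostNbr, Finset.mem_union, Finset.mem_filter, Finset.mem_singleton, hw]
      tauto
    refine (Finset.card_le_card this).trans ((Finset.card_union_le _ _).trans ?_)
    refine Nat.add_le_add_right ((Finset.card_union_le _ _).trans ?_) _
    simp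
  set E₁ : Set (Sym2 V) := {e | e ∈ G.edgeSet ∧ (∃ w ∈ (↑W : Set V), w ∈ e) ∧ v ∉ e} with hE₁
  have h1 : rho G ↑W ≤ E₁.ncard + (outNbr G ∅ v).card := by
    rw [← Set.ncard_coe_finset, ← Set.ncard_image_of_injective (f := fun w => s(v, w)) _
      (fun x y h => Sym2.congr_right.mp h)]
    refine le_trans (Set.ncard_le_ncard ?_ (Set.toFinite _)) (Set.ncard_union_le _ _)
    rintro e ⟨he, w, hw, hwe⟩
    by_cases hve : v ∈ e
    · obtain ⟨z, rfl⟩ := Sym2.mem_iff_exists.mp hve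
      exact Or.inr ⟨z, by simpa [mem_outNbr] using he, rfl⟩
    · exact Or.inl ⟨he, ⟨w, hw, hwe⟩, hve⟩
  have h2 : E₁.ncard + O.card ≤ rho (contract G u v) ↑(W.erase v) := by
    rw [← Set.ncard_coe_finset O, ← Set.ncard_image_of_injective (f := fun w => s(u, w)) (↑O)
      (fun x y h => Sym2.congr_right.mp h), ← Set.ncard_union_eq ?_ (Set.toFinite _) (Set.toFinite _)]
    · refine Set.ncard_le_ncard ?_ (Set.toFinite _)
      rintro e (⟨he, ⟨w, hw, hwe⟩, hve⟩ | ⟨w, hw, rfl⟩)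
      · obtain ⟨z, rfl⟩ := Sym2.mem_iff_exists.mp hwe
        have hvw : w ≠ v := fun h => hve (h ▸ Sym2.mem_mk_left _ _)
        have hvz : z ≠ v := fun h => hve (h ▸ Sym2.mem_mk_right _ _)
        exact ⟨⟨SimpleGraph.Adj.ne he, hvw, hvz, Or.inl he⟩, w,
          by simpa using ⟨hw, hvw⟩, hwe⟩
      · simp only [hO, Finset.coe_filter, Set.mem_ofPred_eq, mem_outNbr, not_or, not_and,
          not_not] at hw
        obtain ⟨⟨hvw, -⟩, hwu, -, hW⟩ := hw
        refine ⟨⟨hwu.symm, huv, hvw.ne', Or.inr (Or.inl ⟨rfl, hvw⟩)⟩, ?_⟩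
        by_cases huW : u ∈ W
        · exact ⟨u, by simpa using ⟨huW, huv⟩, Sym2.mem_mk_left _ _⟩
        · exact ⟨w, by simpa using ⟨hW huW, hvw.ne'⟩, Sym2.mem_mk_right _ _⟩
    · refine Set.disjoint_left.mpr ?_
      rintro _ ⟨he, -, -⟩ ⟨w, hw, rfl⟩
      simp only [hO, Finset.coe_filter, Set.mem_ofPred_eq, not_or] at hw
      exact hw.2.2.1 he
  omega

end Contraction
end RootedCycle
namespace RootedCycle

/-! ### Minors from two vertices complete to five roots -/

section Helpers

variable {V : Type*}

theorem model_of_helpers {G : SimpleGraph V} {m : ℕ} {U : Set V} {y : Fin 5 → V}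
    (hy : Function.Injective y) (hyU : ∀ i, y i ∈ U) (w : Fin m → V) (hw : Function.Injective w)
    (hwU : ∀ h, w h ∈ U) (hwy : ∀ h i, w h ≠ y i) (lab : Fin m → Fin 5)
    (hadj : ∀ h, G.Adj (w h) (y (lab h)))
    (hlink : ∀ i : Fin 5, G.Adj (y i) (y (i + 1)) ∨
      (∃ h, lab h = i ∧ G.Adj (w h) (y (i + 1))) ∨
      (∃ h, lab h = i + 1 ∧ G.Adj (w h) (y i)) ∨
      (∃ h h', lab h = i ∧ lab h' = i + 1 ∧ G.Adj (w h) (w h'))) :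
    Model G U y := by
  refine ⟨star y (fun h => {w h}) lab, isCyc_star hy (fun h => conn_singleton G _) ?_ ?_ ?_ ?_,
    star_subset hyU fun h => by simpa using hwU h, fun i => Or.inl rfl⟩
  · intro h h' hne
    rw [Set.disjoint_singleton]
    exact fun he => hne (hw he)
  · exact fun h i he => hwy h i he.symm
  · exact fun h => ⟨w h, rfl, hadj h⟩
  · intro i
    rcases hlink i with h | ⟨h, h1, h2⟩ | ⟨h, h1, h2⟩ | ⟨h, h', h1, h2, h3⟩
    · exact Or.inl h
    · exact Or.inr (Or.inl ⟨h, h1, _, rfl, h2⟩)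
    · exact Or.inr (Or.inr (Or.inl ⟨h, h1, _, rfl, h2⟩))
    · exact Or.inr (Or.inr (Or.inr ⟨h, h', h1, h2, _, rfl, _, rfl, h3⟩))

/-- Two vertices complete to the roots, and a connected set attached to two consecutive roots. -/
theorem model_of_blob_zero {G : SimpleGraph V} {U C : Set V} {x : Fin 5 → V}
    (hx : Function.Injective x) (hxU : ∀ i, x i ∈ U) {a b : V} (hab : a ≠ b) (haU : a ∈ U)
    (hbU : b ∈ U) (hax : ∀ i, G.Adj (x i) a) (hbx : ∀ i, G.Adj (x i) b) (hC : Conn G C)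
    (hCU : C ⊆ U) (hCx : ∀ i, x i ∉ C) (haC : a ∉ C) (hbC : b ∉ C)
    (h0 : ∃ w ∈ C, G.Adj w (x 0)) (h1 : ∃ w ∈ C, G.Adj w (x 1)) : Model G U x := by
  have hax' : ∀ i, x i ≠ a := fun i => (hax i).ne
  have hbx' : ∀ i, x i ≠ b := fun i => (hbx i).ne
  -- Attached to roots 0, 2, 4: C realises the link 0–1, a the links 1–2 and 2–3, b the links 3–4
  -- and 4–0.
  refine ⟨star x ![C, {a}, {b}] ![0, 2, 4], isCyc_star hx ?_ ?_ ?_ ?_ ?_,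
    star_subset hxU ?_, fun i => Or.inl rfl⟩
  · intro h
    fin_cases h
    · exact hC
    · exact conn_singleton G a
    · exact conn_singleton G b
  · intro h h' hne
    fin_cases h <;> fin_cases h' <;> simp_all [eq_comm]
  · intro h i
    fin_cases h <;> simp_all
  · intro h
    fin_cases h
    · exact h0
    · exact ⟨a, rfl, (hax 2).symm⟩
    · exact ⟨b, rfl, (hbx 4).symm⟩
  · intro i
    right
    fin_cases i
    · exact Or.inl ⟨0, rfl, h1⟩
    · exact Or.inr (Or.inl ⟨1, rfl, a, rfl, (hax 1).symm⟩)
    · exact Or.inl ⟨1, rfl, a, rfl, (hax 3).symm⟩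
    · exact Or.inr (Or.inl ⟨2, rfl, b, rfl, (hbx 3).symm⟩)
    · exact Or.inl ⟨2, rfl, b, rfl, (hbx 0).symm⟩
  · intro h
    fin_cases h <;> simp_all

theorem model_of_blob {G : SimpleGraph V} {U C : Set V} {x : Fin 5 → V}
    (hx : Function.Injective x) (hxU : ∀ i, x i ∈ U) {a b : V} (hab : a ≠ b) (haU : a ∈ U)
    (hbU : b ∈ U) (hax : ∀ i, G.Adj (x i) a) (hbx : ∀ i, G.Adj (x i) b) (hC : Conn G C)
    (hCU : C ⊆ U) (hCx : ∀ i, x i ∉ C) (haC : a ∉ C) (hbC : b ∉ C) (i : Fin 5)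
    (h0 : ∃ w ∈ C, G.Adj w (x i)) (h1 : ∃ w ∈ C, G.Adj w (x (i + 1))) : Model G U x := by
  refine model_five_of_rotate i (model_of_blob_zero (fun p q h => add_right_cancel (hx h))
    (fun j => hxU _) hab haU hbU (fun j => hax _) (fun j => hbx _) hC hCU (fun j => hCx _) haC hbC
    ?_ ?_)
  · simpa using h0
  · simpa [add_comm] using h1

theorem model_of_adj {G : SimpleGraph V} {U : Set V} {x : Fin 5 → V}
    (hx : Function.Injective x) (hxU : ∀ i, x i ∈ U) {a b : V} (hab : a ≠ b) (haU : a ∈ U)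
    (hbU : b ∈ U) (hax : ∀ i, G.Adj (x i) a) (hbx : ∀ i, G.Adj (x i) b) (i : Fin 5)
    (h : G.Adj (x i) (x (i + 1))) : Model G U x := by
  refine model_five_of_rotate i (model_of_helpers (fun p q h => add_right_cancel (hx h))
    (fun j => hxU _) ![a, b] ?_ ?_ ?_ ![2, 4] ?_ ?_)
  · intro p q hpq
    fin_cases p <;> fin_cases q <;> simp_all
  · intro p
    fin_cases p
    · exact haU
    · exact hbU
  · intro p j
    fin_cases p
    · exact (hax _).ne'
    · exact (hbx _).ne'
  · intro p
    fin_cases p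
    · exact (hax _).symm
    · exact (hbx _).symm
  · intro j
    fin_cases j
    · left
      simpa [add_comm] using h
    · exact Or.inr (Or.inr (Or.inl ⟨0, rfl, (hax _).symm⟩))
    · exact Or.inr (Or.inl ⟨0, rfl, (hax _).symm⟩)
    · exact Or.inr (Or.inr (Or.inl ⟨1, rfl, (hbx _).symm⟩))
    · exact Or.inr (Or.inl ⟨1, rfl, (hbx _).symm⟩)

/-- Independent sets of a 5-cycle lie in a pair at distance two; this is the source of the pairs i,
i + 2 in the conclusion. -/
theorem independent_five : ∀ p : Fin 5 → Bool, (∀ i, ¬ (p i = true ∧ p (i + 1) = true)) →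
    ∃ i, ∀ j, p j = true → j = i ∨ j = i + 2 := by
  decide

end Helpers

/-! ### Massed pairs with two apexes -/

section Massed

variable {V : Type*} [Fintype V]

/-- `(G[W ∪ S], S)` is `5`-massed, in terms of subsets of `W` and their boundaries. -/
structure Mass (G : SimpleGraph V) (W S : Finset V) : Prop where
  disj : Disjoint W S
  bdry_subset : bdry G W ⊆ S
  mass : 5 * W.card < rho G ↑W
  sep : ∀ D ⊆ W, (bdry G D).card < S.card → rho G ↑D ≤ 5 * D.card

/-- Two vertices of `W` are complete to the roots. -/
def HasTwoApexes (G : SimpleGraph V) (W : Finset V) {k : ℕ} (x : Fin k → V) : Prop :=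
  ∃ a ∈ W, ∃ b ∈ W, a ≠ b ∧ ∀ i, G.Adj (x i) a ∧ G.Adj (x i) b

theorem Mass.adj {G : SimpleGraph V} {W S : Finset V} (h : Mass G W S) {u v : V} (hu : u ∈ W)
    (huv : G.Adj u v) : v ∈ W ∨ v ∈ S :=
  bdry_subset_iff.mp h.bdry_subset u hu v huv

variable {G : SimpleGraph V} {W S : Finset V} {x : Fin 5 → V} {a b : V}

-- If C saw two consecutive roots, it would serve the link between them while a and b serve the
-- other four. So the roots seen by C are independent in the 5-cycle.
open Classical in
theorem Mass.bdry_comp_subset (h : Mass G W S) (hx : Function.Injective x)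
    (hS : ∀ v, v ∈ S ↔ v ∈ Set.range x) (hno : ¬ Model G (↑W ∪ ↑S) x) (ha : a ∈ W) (hb : b ∈ W)
    (hab : a ≠ b) (hcomp : ∀ i, G.Adj (x i) a ∧ G.Adj (x i) b) {C : Finset V}
    (hC : Conn G ↑C) (hCW : C ⊆ W \ {a, b})
    (hcl : ∀ u ∈ C, ∀ v ∈ W \ {a, b}, G.Adj u v → v ∈ C) :
    ∃ i, bdry G C ⊆ {a, b, x i, x (i + 2)} := by
  have hxS : ∀ i, x i ∈ S := fun i => (hS _).mpr ⟨i, rfl⟩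
  have hxW : ∀ i, x i ∉ W := fun i hi => Finset.disjoint_left.mp h.disj hi (hxS i)
  have haC : a ∉ C := fun h => by simpa using hCW h
  have hbC : b ∉ C := fun h => by simpa using hCW h
  obtain ⟨i, hi⟩ := independent_five (fun i => decide (∃ w ∈ C, G.Adj w (x i))) (by
    rintro i ⟨h1, h2⟩
    refine hno (model_of_blob hx (fun j => Or.inr (hxS j)) hab (Or.inl ha) (Or.inl hb)
      (fun j => (hcomp j).1) (fun j => (hcomp j).2) hC ?_ ?_ haC hbC i (of_decide_eq_true h1)
      (of_decide_eq_true h2))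
    · exact fun v hv => Or.inl (Finset.mem_sdiff.mp (hCW hv)).1
    · exact fun j hj => hxW j (Finset.mem_sdiff.mp (hCW hj)).1)
  refine ⟨i, bdry_subset_iff.mpr fun u hu v huv => ?_⟩
  by_cases hv : v ∈ W \ {a, b}
  · exact Or.inl (hcl u hu v hv huv)
  right
  rcases h.adj (Finset.mem_sdiff.mp (hCW hu)).1 huv with hvW | hvS
  · simp only [Finset.mem_sdiff, hvW, true_and, not_not, Finset.mem_insert,
      Finset.mem_singleton] at hv
    simp only [Finset.mem_insert, Finset.mem_singleton]
    tauto
  · obtain ⟨j, rfl⟩ := (hS v).mp hvS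
    rcases hi j (decide_eq_true ⟨u, hu, huv⟩) with rfl | rfl <;> simp

open Classical in
/-- The component of `t` in `G[R]`, as a finite set. -/
noncomputable def compFinset (G : SimpleGraph V) (R : Finset V) (t : V) : Finset V :=
  Finset.univ.filter fun w => w ∈ comp G ↑R t

theorem coe_compFinset (G : SimpleGraph V) (R : Finset V) (t : V) :
    (↑(compFinset G R t) : Set V) = comp G ↑R t := by
  ext w
  simp [compFinset]

theorem compFinset_subset {R : Finset V} {t : V} (ht : t ∈ R) : compFinset G R t ⊆ R := by
  rw [← Finset.coe_subset, coe_compFinset]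
  exact comp_subset ht

theorem compFinset_closed {R : Finset V} {t : V} (ht : t ∈ R) {u v : V}
    (hu : u ∈ compFinset G R t) (hv : v ∈ R) (huv : G.Adj u v) : v ∈ compFinset G R t := by
  have huR := compFinset_subset ht hu
  rw [← Finset.mem_coe, coe_compFinset] at hu ⊢
  exact comp_closed hu huR hv huv

-- Components are peeled off one at a time: each has a boundary of order at most 4 < 5, so the
-- separation condition bounds it, and no edges run between components.
open Classical in
theorem Mass.rho_closed_le (h : Mass G W S) (hx : Function.Injective x)
    (hS : ∀ v, v ∈ S ↔ v ∈ Set.range x) (hno : ¬ Model G (↑W ∪ ↑S) x) (ha : a ∈ W) (hb : b ∈ W)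
    (hab : a ≠ b) (hcomp : ∀ i, G.Adj (x i) a ∧ G.Adj (x i) b) :
    ∀ n : ℕ, ∀ C : Finset V, C.card = n → C ⊆ W \ {a, b} →
      (∀ u ∈ C, ∀ v ∈ W \ {a, b}, G.Adj u v → v ∈ C) → rho G ↑C ≤ 5 * C.card := by
  have hcardS : S.card = 5 := by
    have : S = Finset.univ.image x := by
      ext v
      simp [hS]
    rw [this, Finset.card_image_of_injective _ hx, Finset.card_univ, Fintype.card_fin]
  intro n
  induction n using Nat.strong_induction_on with
  | _ n ih =>
  intro C hn hCR hcl
  rcases C.eq_empty_or_nonempty with rfl | ⟨t, ht⟩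
  · simp [rho_empty]
  set C₁ := compFinset G (W \ {a, b}) t with hC₁
  have htR := hCR ht
  have hconn : Conn G ↑C₁ := by
    rw [hC₁, coe_compFinset]
    exact conn_comp
  have htC₁ : t ∈ C₁ := by
    rw [← Finset.mem_coe, hC₁, coe_compFinset]
    exact mem_comp_self G _ t
  have hC₁C : C₁ ⊆ C := by
    rw [← Finset.coe_subset, hC₁, coe_compFinset]
    exact fun w hw => hw ↑C ht fun u hu _ v hv huv => hcl u hu v hv huv
  obtain ⟨i, hi⟩ := h.bdry_comp_subset hx hS hno ha hb hab hcomp hconn (hC₁C.trans hCR)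
    (fun u hu v hv huv => compFinset_closed htR hu hv huv)
  have h1 : rho G ↑C₁ ≤ 5 * C₁.card := by
    refine h.sep C₁ ((hC₁C.trans hCR).trans Finset.sdiff_subset) ?_
    rw [hcardS]
    exact lt_of_le_of_lt ((Finset.card_le_card hi).trans Finset.card_le_four) (by norm_num)
  have hlt : (C \ C₁).card < n := by
    rw [← hn]
    exact Finset.card_lt_card ⟨Finset.sdiff_subset, fun hcon =>
      (Finset.mem_sdiff.mp (hcon ht)).2 htC₁⟩
  have h2 := ih _ hlt (C \ C₁) rfl (Finset.sdiff_subset.trans hCR) (by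
    intro u hu v hv huv
    rw [Finset.mem_sdiff] at hu ⊢
    exact ⟨hcl u hu.1 v hv huv, fun hv1 =>
      hu.2 (compFinset_closed htR hv1 (hCR hu.1) huv.symm)⟩)
  have h3 : rho G ↑C = rho G ↑C₁ + rho G ↑(C \ C₁) := by
    rw [← rho_union_eq]
    · rw [← Finset.coe_union, Finset.union_sdiff_of_subset hC₁C]
    · rw [Finset.disjoint_coe]
      exact Finset.disjoint_sdiff
    · intro u hu v hv huv
      rw [Finset.mem_coe, Finset.mem_sdiff] at hv
      exact hv.2 (compFinset_closed htR hu (hCR hv.1) huv)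
  have h4 := Finset.card_sdiff_add_card_eq_card hC₁C
  omega

-- The mass condition needs ρ(W) ≥ 5|W| + 1, whereas W minus a, b supplies at most 5 per vertex and
-- a, b supply at most 5 + 5 edges to roots plus ab. Hence ab is an edge and every inequality is
-- tight, also for each union of components.
open Classical in
theorem Mass.apex_structure (h : Mass G W S) (hx : Function.Injective x)
    (hS : ∀ v, v ∈ S ↔ v ∈ Set.range x) (hno : ¬ Model G (↑W ∪ ↑S) x) (ha : a ∈ W) (hb : b ∈ W)
    (hab : a ≠ b) (hcomp : ∀ i, G.Adj (x i) a ∧ G.Adj (x i) b) :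
    G.Adj a b ∧ rho G ↑W = 5 * W.card + 1 ∧
      ∀ C ⊆ W \ {a, b}, (∀ u ∈ C, ∀ v ∈ W \ {a, b}, G.Adj u v → v ∈ C) →
        rho G ↑C = 5 * C.card := by
  have hcardS : S.card = 5 := by
    have : S = Finset.univ.image x := by
      ext v
      simp [hS]
    rw [this, Finset.card_image_of_injective _ hx, Finset.card_univ, Fintype.card_fin]
  have hle := h.rho_closed_le hx hS hno ha hb hab hcomp
  set R := W \ {a, b} with hR
  have haR : a ∉ R := by simp [hR]
  have hbR : b ∉ R := by simp [hR]
  have haR' : a ∉ insert b R := by simp [haR, hab]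
  have hW : W = insert a (insert b R) := by
    ext v
    simp only [hR, Finset.mem_insert, Finset.mem_sdiff, Finset.mem_singleton]
    constructor
    · intro hv
      by_cases h1 : v = a
      · exact Or.inl h1
      · by_cases h2 : v = b
        · exact Or.inr (Or.inl h2)
        · exact Or.inr (Or.inr ⟨hv, by tauto⟩)
    · rintro (rfl | rfl | h)
      · exact ha
      · exact hb
      · exact h.1
  have h1 : rho G ↑W = rho G ↑R + (outNbr G R b).card + (outNbr G (insert b R) a).card := by
    conv_lhs => rw [hW]
    rw [rho_insert G haR', rho_insert G hbR]
  have hcard : W.card = R.card + 2 := by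
    conv_lhs => rw [hW]
    rw [Finset.card_insert_of_notMem haR', Finset.card_insert_of_notMem hbR]
  have h2 : (outNbr G (insert b R) a).card ≤ 5 := by
    rw [← hcardS]
    refine Finset.card_le_card fun v hv => ?_
    obtain ⟨hav, hv⟩ := mem_outNbr.mp hv
    refine (h.adj ha hav).resolve_left fun hvW => ?_
    rw [hW] at hvW
    exact hv ((Finset.mem_insert.mp hvW).resolve_left hav.ne')
  have h3 : (outNbr G R b).card ≤ 5 + if G.Adj a b then 1 else 0 := by
    rw [← hcardS]
    split_ifs with hadj
    · refine le_trans (Finset.card_le_card ?_) (Finset.card_insert_le a S)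
      intro v hv
      obtain ⟨hbv, hv⟩ := mem_outNbr.mp hv
      rcases h.adj hb hbv with hvW | hvS
      · rw [hW] at hvW
        rcases Finset.mem_insert.mp hvW with rfl | hvW
        · exact Finset.mem_insert_self _ _
        · exact absurd ((Finset.mem_insert.mp hvW).resolve_left hbv.ne') hv
      · exact Finset.mem_insert_of_mem hvS
    · refine Finset.card_le_card fun v hv => ?_
      obtain ⟨hbv, hv⟩ := mem_outNbr.mp hv
      refine (h.adj hb hbv).resolve_left fun hvW => ?_
      rw [hW] at hvW
      rcases Finset.mem_insert.mp hvW with rfl | hvW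
      · exact hadj hbv.symm
      · exact absurd ((Finset.mem_insert.mp hvW).resolve_left hbv.ne') hv
  have h4 := hle _ R rfl subset_rfl fun u _ v hv _ => hv
  have h5 := h.mass
  have hadj : G.Adj a b := by
    by_contra hcon
    rw [if_neg hcon] at h3
    omega
  rw [if_pos hadj] at h3
  refine ⟨hadj, by omega, fun C hCR hcl => ?_⟩
  have h6 := hle _ C rfl hCR hcl
  have h7 := hle _ (R \ C) rfl Finset.sdiff_subset (by
    intro u hu v hv huv
    rw [Finset.mem_sdiff] at hu ⊢
    exact ⟨hv, fun hvC => hu.2 (hcl v hvC u hu.1 huv.symm)⟩)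
  have h8 : rho G ↑R = rho G ↑C + rho G ↑(R \ C) := by
    rw [← rho_union_eq]
    · rw [← Finset.coe_union, Finset.union_sdiff_of_subset hCR]
    · rw [Finset.disjoint_coe]
      exact Finset.disjoint_sdiff
    · intro u hu v hv huv
      rw [Finset.mem_coe, Finset.mem_sdiff] at hv
      exact hv.2 (hcl u hu v hv.1 huv)
  have h9 := Finset.card_sdiff_add_card_eq_card hCR
  omega

end Massed
end RootedCycle
namespace RootedCycle

/-! ### Minimal counterexamples contain no rigid separation -/

section Minimal

variable {V : Type*} [Fintype V]

/-- The conclusion of the main theorem for the graph `G[W ∪ S]` and all choices of the roots. -/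
def Good (G : SimpleGraph V) (W : Finset V) : Prop :=
  ∀ (k : ℕ) (x : Fin k → V) (S : Finset V), k ≤ 5 → Function.Injective x →
    (∀ v, v ∈ S ↔ v ∈ Set.range x) → Mass G W S →
    Model G (↑W ∪ ↑S) x ∨ (k = 5 ∧ HasTwoApexes G W x)

/-- A counterexample all of whose smaller instances satisfy the theorem. -/
structure MinCex (G : SimpleGraph V) (W S : Finset V) {k : ℕ} (x : Fin k → V) : Prop where
  le_five : k ≤ 5
  inj : Function.Injective x
  mem_iff : ∀ v, v ∈ S ↔ v ∈ Set.range x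
  mass : Mass G W S
  no_model : ¬ Model G (↑W ∪ ↑S) x
  no_apex : ¬ (k = 5 ∧ HasTwoApexes G W x)
  ih : ∀ (G' : SimpleGraph V) (W' : Finset V),
    W'.card < W.card ∨ (W'.card = W.card ∧ rho G' ↑W' < rho G ↑W) → Good G' W'

omit [Fintype V] in
theorem card_of_mem_range {k : ℕ} {x : Fin k → V} (hx : Function.Injective x) {S : Finset V}
    (hS : ∀ v, v ∈ S ↔ v ∈ Set.range x) : S.card = k := by
  classical
  have : S = Finset.univ.image x := by
    ext v
    simp [hS]
  rw [this, Finset.card_image_of_injective _ hx, Finset.card_univ, Fintype.card_fin]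

theorem Mass.of_subset {G : SimpleGraph V} {W S D T : Finset V} (h : Mass G W S) (hD : D ⊆ W)
    (hDT : Disjoint D T) (hT : bdry G D ⊆ T) (hcard : T.card ≤ S.card)
    (hrho : 5 * D.card < rho G ↑D) : Mass G D T :=
  ⟨hDT, hT, hrho, fun E hE hlt => h.sep E (hE.trans hD) (lt_of_lt_of_le hlt hcard)⟩

/-- Taking a violation with boundary of minimum order makes the violating set massed over its own
boundary, so the induction hypothesis applies to it. -/
theorem exists_mass_of_violation {G : SimpleGraph V} {W : Finset V} {n : ℕ}
    (h : ∃ D ⊆ W, (bdry G D).card < n ∧ 5 * D.card < rho G ↑D) :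
    ∃ D ⊆ W, (bdry G D).card < n ∧ Mass G D (bdry G D) := by
  classical
  let p : ℕ → Prop := fun m => ∃ D ⊆ W, (bdry G D).card = m ∧ m < n ∧ 5 * D.card < rho G ↑D
  have hp : ∃ m, p m := by
    obtain ⟨D, h1, h2, h3⟩ := h
    exact ⟨_, D, h1, rfl, h2, h3⟩
  obtain ⟨D, hDW, hcard, hlt, hrho⟩ := Nat.find_spec hp
  refine ⟨D, hDW, hcard ▸ hlt, disjoint_bdry G D, subset_rfl, hrho, fun E hE hElt => ?_⟩
  by_contra hcon
  have := Nat.find_min' hp ⟨E, hE.trans hDW, rfl, by omega, not_le.mp hcon⟩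
  omega

theorem apex_rho {G : SimpleGraph V} {W S : Finset V} {k : ℕ} (hk : k = 5) {x : Fin k → V}
    (hx : Function.Injective x) (hS : ∀ v, v ∈ S ↔ v ∈ Set.range x) (h : Mass G W S)
    (hno : ¬ Model G (↑W ∪ ↑S) x) (hap : HasTwoApexes G W x) :
    rho G ↑W = 5 * W.card + 1 := by
  subst hk
  obtain ⟨a, ha, b, hb, hab, hcomp⟩ := hap
  exact (h.apex_structure hx hS hno ha hb hab hcomp).2.1

/-- An ordering of T without a minor already yields two apexes; as apexes are complete to T, that
single ordering determines the whole exceptional structure. -/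
theorem Good.rigid_or {G : SimpleGraph V} {D T : Finset V} (h : Good G D) (hM : Mass G D T)
    (hT : T.card ≤ 5) : Rigid G D T ∨ (T.card = 5 ∧ rho G ↑D = 5 * D.card + 1 ∧
      ∃ a ∈ D, ∃ b ∈ D, a ≠ b ∧ ∀ s ∈ T, G.Adj s a ∧ G.Adj s b) := by
  by_cases hR : Rigid G D T
  · exact Or.inl hR
  right
  unfold Rigid at hR
  push Not at hR
  obtain ⟨s, hs, hrange, hno⟩ := hR
  have hmem : ∀ v, v ∈ T ↔ v ∈ Set.range s := fun v => by rw [hrange, Finset.mem_coe]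
  obtain hm | ⟨h5, hap⟩ := h _ s T hT hs hmem hM
  · exact absurd hm hno
  refine ⟨h5, apex_rho h5 hs hmem hM hno hap, ?_⟩
  obtain ⟨a, ha, b, hb, hab, hcomp⟩ := hap
  refine ⟨a, ha, b, hb, hab, fun v hv => ?_⟩
  obtain ⟨i, rfl⟩ := (hmem v).mp hv
  exact hcomp i

theorem Good.rigid_of_card_lt {G : SimpleGraph V} {D T : Finset V} (h : Good G D)
    (hM : Mass G D T) (hT : T.card < 5) : Rigid G D T :=
  (h.rigid_or hM hT.le).resolve_right fun h => by omega

-- Disjoint connected sets ending in T pairwise touch once T is made a clique, hence form a cyclic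
-- family in any order; `Rigid.lift` removes the clique edges.
omit [Fintype V] in
theorem Rigid.model_of_linked {G : SimpleGraph V} {D T Q : Finset V} (hR : Rigid G D T)
    (hQD : Disjoint Q D) (hTQ : T ⊆ Q) {T' : Finset V} {Z : V → Set V}
    (hZ : ∀ x ∈ T', x ∈ Z x ∧ Z x ⊆ ↑Q ∧ Conn G (Z x) ∧ (Z x ∩ ↑T).Nonempty)
    (hd : ∀ x ∈ T', ∀ y ∈ T', x ≠ y → Disjoint (Z x) (Z y)) {k : ℕ} {s : Fin k → V}
    (hs : Function.Injective s) (hsT : ∀ i, s i ∈ T') : Model G (↑Q ∪ ↑D) s := by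
  have hnD : ∀ v ∈ Q, v ∉ (↑D : Set V) := fun v hv hvD => Finset.disjoint_left.mp hQD hv hvD
  have hm : Model (cliqueOn G ↑D ↑T) ↑Q s := by
    refine ⟨fun i => Z (s i), ⟨fun i j hij => hd _ (hsT i) _ (hsT j) (hs.ne hij), fun i => ?_,
      fun i j _ => ?_⟩, fun i => (hZ _ (hsT i)).2.1, fun i => (hZ _ (hsT i)).1⟩
    · refine (hZ _ (hsT i)).2.2.1.of_adj fun u hu v hv huv => ⟨huv.ne, ?_, ?_, Or.inl huv⟩
      · exact hnD u ((hZ _ (hsT i)).2.1 hu)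
      · exact hnD v ((hZ _ (hsT i)).2.1 hv)
    · obtain ⟨t, ht, htT⟩ := (hZ _ (hsT i)).2.2.2
      obtain ⟨t', ht', htT'⟩ := (hZ _ (hsT j)).2.2.2
      refine ⟨t, ht, t', ht', ?_⟩
      by_cases h : t = t'
      · exact Or.inl h
      · exact Or.inr ⟨h, hnD t (hTQ htT), hnD t' (hTQ htT'), Or.inr ⟨htT, htT'⟩⟩
  refine (hR.lift (by exact_mod_cast hQD) hm).mono le_rfl ?_
  exact Set.union_subset subset_rfl (Set.subset_union_of_subset_left (by exact_mod_cast hTQ) _)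

variable {G : SimpleGraph V} {W S : Finset V} {k : ℕ} {x : Fin k → V}

theorem MinCex.card (h : MinCex G W S x) : S.card = k := card_of_mem_range h.inj h.mem_iff

theorem MinCex.mem (h : MinCex G W S x) (i : Fin k) : x i ∈ S := (h.mem_iff _).mpr ⟨i, rfl⟩

theorem MinCex.notMem (h : MinCex G W S x) (i : Fin k) : x i ∉ W := fun hi =>
  Finset.disjoint_left.mp h.mass.disj hi (h.mem i)

open Classical in
/-- Data of a rigid separation of small order. -/
structure RigidSep (G : SimpleGraph V) (W S D T : Finset V) : Prop where
  subset : D ⊆ W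
  nonempty : D.Nonempty
  bdry_subset : bdry G D ⊆ T
  disj : Disjoint D T
  subset_union : T ⊆ W ∪ S
  card_le : T.card ≤ S.card
  rigid : Rigid G D T

-- By Menger, either S is fully linked to T outside D, giving the forbidden minor for x, or a
-- separation of smaller order is linked to T. In the latter case everything beyond it, together
-- with D, is a larger rigid set.
open Classical in
theorem MinCex.rigidSep_extend_of_eq (h : MinCex G W S x) {D T : Finset V}
    (hs : RigidSep G W S D T) (hT : T.card = S.card) :
    ∃ D' T', RigidSep G W S D' T' ∧ D.card < D'.card := by
  set A := (W ∪ S) \ D with hA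
  have hSA : S ⊆ A := fun v hv => Finset.mem_sdiff.mpr ⟨Finset.mem_union_right _ hv,
    fun hvD => Finset.disjoint_left.mp h.mass.disj (hs.subset hvD) hv⟩
  have hTA : T ⊆ A := fun v hv => Finset.mem_sdiff.mpr ⟨hs.subset_union hv,
    fun hvD => Finset.disjoint_left.mp hs.disj hvD hv⟩
  obtain ⟨P, Q, hPQ, hcase, -, Z, hZ, hd⟩ := exists_separation_linked G hSA hTA
  have hQA : Q ⊆ A := fun v hv => (hPQ.mem_or v).mpr (Or.inr hv)
  have hQD : Disjoint Q D := Finset.disjoint_left.mpr fun v hv hvD =>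
    (Finset.mem_sdiff.mp (hQA hv)).2 hvD
  rcases hcase with hcase | hcase
  · exfalso
    have hm := hs.rigid.model_of_linked hQD hPQ.right hZ hd h.inj
      (fun i => by rw [hcase]; exact h.mem i)
    refine h.no_model (hm.mono le_rfl (Set.union_subset (fun v hv => ?_) fun v hv =>
      Or.inl (hs.subset hv)))
    exact (Finset.mem_union.mp (Finset.mem_sdiff.mp (hQA hv)).1)
  · have hQP : ∀ v ∈ Q \ P, v ∈ W := by
      intro v hv
      rw [Finset.mem_sdiff] at hv
      have := (Finset.mem_sdiff.mp (hQA hv.1)).1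
      exact (Finset.mem_union.mp this).resolve_right fun hvS => hv.2 (hPQ.left hvS)
    have hDW : Q \ P ∪ D ⊆ W := Finset.union_subset hQP hs.subset
    refine ⟨Q \ P ∪ D, P ∩ Q, ⟨hDW, hs.nonempty.mono Finset.subset_union_right,
      bdry_subset_iff.mpr ?_, ?_, ?_, hcase.le, ?_⟩, ?_⟩
    · intro u hu v huv
      have hvWS : v ∈ W ∪ S := Finset.mem_union.mpr (h.mass.adj (hDW hu) huv)
      by_cases hvD : v ∈ D
      · exact Or.inl (Finset.mem_union_right _ hvD)
      have hvA : v ∈ A := Finset.mem_sdiff.mpr ⟨hvWS, hvD⟩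
      have hvQ : v ∈ Q := by
        rcases Finset.mem_union.mp hu with hu | hu
        · by_contra hvQ
          rw [Finset.mem_sdiff] at hu
          exact hPQ.no_edge v (((hPQ.mem_or v).mp hvA).resolve_right hvQ) hvQ u hu.1 hu.2 huv.symm
        · exact hPQ.right ((bdry_subset_iff.mp hs.bdry_subset u hu v huv).resolve_left hvD)
      by_cases hvP : v ∈ P
      · exact Or.inr (Finset.mem_inter.mpr ⟨hvP, hvQ⟩)
      · exact Or.inl (Finset.mem_union_left _ (Finset.mem_sdiff.mpr ⟨hvQ, hvP⟩))
    · refine Finset.disjoint_left.mpr fun v hv hv' => ?_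
      rw [Finset.mem_inter] at hv'
      rcases Finset.mem_union.mp hv with hv | hv
      · exact (Finset.mem_sdiff.mp hv).2 hv'.1
      · exact Finset.disjoint_left.mp hQD hv'.2 hv
    · exact fun v hv => (Finset.mem_sdiff.mp (hQA (Finset.mem_inter.mp hv).2)).1
    · intro s hsinj hsr
      have hm := hs.rigid.model_of_linked hQD hPQ.right hZ hd hsinj
        (fun i => by rw [← Finset.mem_coe, ← hsr]; exact ⟨i, rfl⟩)
      refine hm.mono le_rfl (Set.union_subset (fun v hv => ?_) fun v hv =>
        Or.inl (Finset.mem_union_right _ hv))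
      by_cases hvP : v ∈ P
      · exact Or.inr (Finset.mem_inter.mpr ⟨hvP, hv⟩)
      · exact Or.inl (Finset.mem_union_left _ (Finset.mem_sdiff.mpr ⟨hv, hvP⟩))
    · obtain ⟨t, htT, ht⟩ := Finset.exists_mem_notMem_of_card_lt_card (hcase.trans_eq hT.symm)
      refine Finset.card_lt_card ⟨Finset.subset_union_right, fun hcon => ?_⟩
      have htQ := hPQ.right htT
      have htP : t ∉ P := fun h => ht (Finset.mem_inter.mpr ⟨h, htQ⟩)
      have := hcon (Finset.mem_union_left _ (Finset.mem_sdiff.mpr ⟨htQ, htP⟩))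
      exact Finset.disjoint_left.mp hQD htQ this

-- Replace D by a clique on T. Either a separation of the new pair violates the mass bound and
-- enlarges the rigid set or contradicts mass in G, or the new pair is a smaller massed instance
-- whose minor or apexes transfer to G.
open Classical in
theorem MinCex.rigidSep_extend_of_lt (h : MinCex G W S x) {D T : Finset V}
    (hs : RigidSep G W S D T) (hT : T.card < S.card) :
    ∃ D' T', RigidSep G W S D' T' ∧ D.card < D'.card := by
  by_contra hmax
  push Not at hmax
  set G' := cliqueOn G ↑D ↑T with hG'
  set W' := W \ D with hW'
  have hcardW' : W'.card + D.card = W.card := Finset.card_sdiff_add_card_eq_card hs.subset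
  have hDpos : 0 < D.card := hs.nonempty.card_pos
  have hTD : ∀ t ∈ T, t ∉ D := fun t ht htD => Finset.disjoint_left.mp hs.disj htD ht
  have hWS : ∀ u ∈ W', ∀ v, G'.Adj u v → v ∈ W ∪ S := by
    rintro u hu v ⟨-, -, -, huv | ⟨-, hvT⟩⟩
    · exact Finset.mem_union.mpr (h.mass.adj (Finset.mem_sdiff.mp hu).1 huv)
    · exact hs.subset_union hvT
  have hrhoD : rho G ↑D ≤ 5 * D.card := h.mass.sep D hs.subset
    (lt_of_le_of_lt (Finset.card_le_card hs.bdry_subset) hT)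
  have hrho : rho G ↑W ≤ rho G ↑D + rho G' ↑W' := rho_le_cliqueOn G W D (↑T : Set V)
  have hmW := h.mass.mass
  have hMass : Mass G' W' S := by
    refine ⟨?_, bdry_subset_iff.mpr fun u hu v huv => ?_, by omega, ?_⟩
    · exact Finset.disjoint_of_subset_left Finset.sdiff_subset h.mass.disj
    · have hvD : v ∉ D := huv.2.2.1
      rcases Finset.mem_union.mp (hWS u hu v huv) with hv | hv
      · exact Or.inl (Finset.mem_sdiff.mpr ⟨hv, hvD⟩)
      · exact Or.inr hv
    · by_contra hcon
      push Not at hcon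
      obtain ⟨E, hEW, hElt, hEM⟩ := exists_mass_of_violation hcon
      have hEcard := Finset.card_le_card hEW
      have hER : Rigid G' E (bdry G' E) := (h.ih G' E (Or.inl (by omega))).rigid_of_card_lt hEM
        (by have := h.card; have := h.le_five; omega)
      have hED : ∀ v ∈ E, v ∉ D := fun v hv => (Finset.mem_sdiff.mp (hEW hv)).2
      -- If E meets the clique T, then T lies in E and its boundary, so D can be added to E without
      -- enlarging the boundary. If not, E has the same incident edges in G, where it would violate
      -- the mass bound.
      by_cases hET : ∃ e ∈ E, e ∈ T
      · obtain ⟨e, heE, heT⟩ := hET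
        have hTsub : ∀ t ∈ T, t ∈ E ∨ t ∈ bdry G' E := by
          intro t ht
          by_cases htE : t ∈ E
          · exact Or.inl htE
          · refine Or.inr (mem_bdry.mpr ⟨htE, e, heE, ?_, hED e heE, hTD t ht, Or.inr ⟨heT, ht⟩⟩)
            rintro rfl
            exact htE heE
        have hbD : ∀ v ∈ bdry G' E, v ∉ D := by
          intro v hv
          obtain ⟨-, u, -, huv⟩ := mem_bdry.mp hv
          exact huv.2.2.1
        refine absurd (hmax (E ∪ D) (bdry G' E) ⟨?_, ⟨e, Finset.mem_union_left _ heE⟩,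
          bdry_subset_iff.mpr ?_, ?_, ?_, hElt.le, ?_⟩) (not_le.mpr ?_)
        · exact Finset.union_subset (hEW.trans Finset.sdiff_subset) hs.subset
        · intro u hu v huv
          rcases Finset.mem_union.mp hu with hu | hu
          · by_cases hvD : v ∈ D
            · exact Or.inl (Finset.mem_union_right _ hvD)
            · by_cases hvE : v ∈ E
              · exact Or.inl (Finset.mem_union_left _ hvE)
              · exact Or.inr (mem_bdry.mpr ⟨hvE, u, hu, huv.ne, hED u hu, hvD, Or.inl huv⟩)
          · rcases bdry_subset_iff.mp hs.bdry_subset u hu v huv with hv | hv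
            · exact Or.inl (Finset.mem_union_right _ hv)
            · exact (hTsub v hv).imp (Finset.mem_union_left _) id
        · refine Finset.disjoint_left.mpr fun v hv hv' => ?_
          rcases Finset.mem_union.mp hv with hv | hv
          · exact Finset.disjoint_left.mp (disjoint_bdry G' E) hv hv'
          · exact hbD v hv' hv
        · intro v hv
          obtain ⟨-, u, hu, huv⟩ := mem_bdry.mp hv
          exact hWS u (hEW hu) v huv
        · intro s hsinj hsr
          have hdisj : Disjoint (↑E ∪ ↑(bdry G' E) : Set V) ↑D := by
            refine Set.disjoint_left.mpr ?_
            rintro v (hv | hv) hvD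
            · exact hED v hv hvD
            · exact hbD v hv hvD
          refine (hs.rigid.lift hdisj (hER s hsinj hsr)).mono le_rfl ?_
          rintro v (((hv | hv) | hv) | hv)
          · exact Or.inl (Finset.mem_union_left _ hv)
          · exact Or.inr hv
          · exact Or.inl (Finset.mem_union_right _ hv)
          · exact (hTsub v hv).imp (fun h => Finset.mem_union_left _ h) id
        · refine Finset.card_lt_card ⟨Finset.subset_union_right, fun hcon => ?_⟩
          exact hED e heE (hcon (Finset.mem_union_left _ heE))
      · push Not at hET
        have hadj : ∀ u ∈ E, ∀ v, G'.Adj u v ↔ G.Adj u v := by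
          intro u hu v
          constructor
          · rintro ⟨-, -, -, huv | ⟨huT, -⟩⟩
            · exact huv
            · exact absurd huT (hET u hu)
          · intro huv
            refine ⟨huv.ne, hED u hu, fun hvD => ?_, Or.inl huv⟩
            exact hET u hu ((bdry_subset_iff.mp hs.bdry_subset v hvD u huv.symm).resolve_left
              (hED u hu))
        have hb : bdry G E ⊆ bdry G' E := by
          intro v hv
          obtain ⟨hvE, u, hu, huv⟩ := mem_bdry.mp hv
          exact mem_bdry.mpr ⟨hvE, u, hu, (hadj u hu v).mpr huv⟩
        have h1 := h.mass.sep E (hEW.trans Finset.sdiff_subset)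
          (lt_of_le_of_lt (Finset.card_le_card hb) hElt)
        have h2 := hEM.mass
        rw [rho_congr (D := (↑E : Set V)) hadj] at h2
        omega
  have hdisj : Disjoint (↑W' ∪ ↑S : Set V) ↑D := by
    refine Set.disjoint_left.mpr ?_
    rintro v (hv | hv) hvD
    · exact (Finset.mem_sdiff.mp hv).2 hvD
    · exact Finset.disjoint_left.mp h.mass.disj (hs.subset hvD) hv
  have hno : ¬ Model G' (↑W' ∪ ↑S) x := by
    intro hm
    refine h.no_model ((hs.rigid.lift hdisj hm).mono le_rfl ?_)
    rintro v (((hv | hv) | hv) | hv)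
    · exact Or.inl (Finset.mem_sdiff.mp hv).1
    · exact Or.inr hv
    · exact Or.inl (hs.subset hv)
    · exact Finset.mem_union.mp (hs.subset_union hv)
  obtain ⟨hk, hap⟩ := (h.ih G' W' (Or.inl (by omega)) k x S h.le_five h.inj h.mem_iff
    hMass).resolve_left hno
  have hrho' := apex_rho hk h.inj h.mem_iff hMass hno hap
  -- The counts ρ(D) ≤ 5|D|, ρ(W') = 5|W'| + 1 and ρ(W) > 5|W| leave no slack, so the edges of the
  -- new graph at its apexes were already edges of G.
  have hnew : ∀ a ∈ W', ∀ v, G'.Adj v a → G.Adj v a := by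
    intro a ha v hva
    by_contra hcon
    have : rho G ↑W < rho G ↑D + rho G' ↑W' :=
      rho_lt_cliqueOn (W := W) hva.symm (fun h => hcon h.symm) (Finset.mem_sdiff.mp ha).1
    omega
  obtain ⟨a, ha, b, hb, hab, hcomp⟩ := hap
  exact h.no_apex ⟨hk, a, (Finset.mem_sdiff.mp ha).1, b, (Finset.mem_sdiff.mp hb).1, hab,
    fun i => ⟨hnew a ha _ (hcomp i).1, hnew b hb _ (hcomp i).2⟩⟩

/-- Any rigid separation extends to one with more vertices, which cannot continue inside the finite
set W. -/
theorem MinCex.not_rigidSep (h : MinCex G W S x) (D T : Finset V) : ¬ RigidSep G W S D T := by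
  have key : ∀ n : ℕ, ∀ D T : Finset V, W.card - D.card = n → ¬ RigidSep G W S D T := by
    intro n
    induction n using Nat.strong_induction_on with
    | _ n ih =>
    intro D T hn hs
    obtain ⟨D', T', hs', hlt⟩ : ∃ D' T', RigidSep G W S D' T' ∧ D.card < D'.card := by
      rcases hs.card_le.eq_or_lt with hT | hT
      · exact h.rigidSep_extend_of_eq hs hT
      · exact h.rigidSep_extend_of_lt hs hT
    have := Finset.card_le_card hs'.subset
    exact ih _ (by omega) D' T' rfl hs'
  exact key _ D T rfl

/-- Every boundary of order at most `|S|` that carries too many edges is exceptional. -/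
theorem MinCex.exceptional_of_mass (h : MinCex G W S x) {D T : Finset V} (hD : D ⊆ W)
    (hlt : D.card < W.card) (hDT : Disjoint D T) (hT : bdry G D ⊆ T)
    (hTWS : ∀ t ∈ T, t ∈ W ∨ t ∈ S) (hcard : T.card ≤ S.card) (hrho : 5 * D.card < rho G ↑D) :
    rho G ↑D = 5 * D.card + 1 ∧ ∃ a ∈ D, ∃ b ∈ D, a ≠ b ∧ ∀ s ∈ T, G.Adj s a ∧ G.Adj s b := by
  classical
  have hM := h.mass.of_subset hD hDT hT hcard hrho
  have hT5 : T.card ≤ 5 := by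
    have := h.card
    have := h.le_five
    omega
  rcases (h.ih G D (Or.inl hlt)).rigid_or hM hT5 with hR | hR
  · refine absurd ⟨hD, ?_, hT, hDT, fun t ht => Finset.mem_union.mpr (hTWS t ht), hcard, hR⟩
      (h.not_rigidSep D T)
    rw [Finset.nonempty_iff_ne_empty]
    rintro rfl
    simp [rho_empty] at hrho
  · exact hR.2

end Minimal
end RootedCycle
namespace RootedCycle

/-! ### Lifting models from a contraction -/

section ContractLift

variable {V : Type*}

open Classical in
theorem Model.of_contract {G : SimpleGraph V} {u v : V} (huv : G.Adj u v) {U : Set V}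
    (hvU : v ∉ U) {k : ℕ} {x : Fin k → V} (h : Model (contract G u v) U x) :
    Model G (insert v U) x := by
  obtain ⟨Y, hY, hYU, hx⟩ := h
  have hvY : ∀ i, v ∉ Y i := fun i hv => hvU (hYU i hv)
  refine ⟨fun i => if u ∈ Y i then insert v (Y i) else Y i, ⟨fun i j hij => ?_, fun i => ?_,
    fun i j hij => ?_⟩, fun i => ?_, fun i => ?_⟩
  · have := hY.disj i j hij
    split_ifs with h1 h2 h2
    · exact absurd h2 (Set.disjoint_left.mp this h1)
    · exact Set.disjoint_insert_left.mpr ⟨hvY j, this⟩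
    · exact Set.disjoint_insert_right.mpr ⟨hvY i, this⟩
    · exact this
  · split_ifs with hu
    · refine ⟨⟨v, Or.inl rfl⟩, fun P hP hcl => ?_⟩
      have h1 : u ∈ P → v ∈ P := fun h => hcl u h (Or.inr hu) v (Or.inl rfl) huv
      have h2 : v ∈ P → u ∈ P := fun h => hcl v h (Or.inl rfl) u (Or.inr hu) huv.symm
      have h3 : Y i ⊆ P := by
        refine (hY.conn i).2 P ?_ ?_
        · obtain ⟨w, hwP, rfl | hw⟩ := hP
          · exact ⟨u, h2 hwP, hu⟩
          · exact ⟨w, hwP, hw⟩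
        · rintro a ha haY b hb ⟨-, -, -, hab | ⟨rfl, hvb⟩ | ⟨rfl, hva⟩⟩
          · exact hcl a ha (Or.inr haY) b (Or.inr hb) hab
          · exact hcl v (h1 ha) (Or.inl rfl) b (Or.inr hb) hvb
          · exact h2 (hcl a ha (Or.inr haY) v (Or.inl rfl) hva.symm)
      exact Set.insert_subset (h1 (h3 hu)) h3
    · refine (hY.conn i).of_adj ?_
      rintro a ha b hb ⟨-, -, -, hab | ⟨rfl, -⟩ | ⟨rfl, -⟩⟩
      · exact hab
      · exact absurd ha hu
      · exact absurd hb hu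
  · have hsub : ∀ i, Y i ⊆ if u ∈ Y i then insert v (Y i) else Y i := by
      intro i
      split_ifs
      · exact Set.subset_insert _ _
      · exact subset_rfl
    have hv : ∀ i, u ∈ Y i → v ∈ if u ∈ Y i then insert v (Y i) else Y i := by
      intro i hi
      rw [if_pos hi]
      exact Or.inl rfl
    obtain ⟨a, ha, b, hb, rfl | ⟨-, -, -, hab | ⟨rfl, hvb⟩ | ⟨rfl, hva⟩⟩⟩ := hY.touch i j hij
    · exact ⟨a, hsub i ha, a, hsub j hb, Or.inl rfl⟩
    · exact ⟨a, hsub i ha, b, hsub j hb, Or.inr hab⟩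
    · exact ⟨v, hv i ha, b, hsub j hb, Or.inr hvb⟩
    · exact ⟨a, hsub i ha, v, hv j hb, Or.inr hva.symm⟩
  · dsimp only
    split_ifs
    · exact Set.insert_subset_insert (hYU i)
    · exact (hYU i).trans (Set.subset_insert _ _)
  · dsimp only
    split_ifs
    · exact Or.inr (hx i)
    · exact hx i

end ContractLift

/-! ### Deleting an edge: ρ(W) = 5|W| + 1 -/

section Deletion

variable {V : Type*} [Fintype V] {G : SimpleGraph V} {W S : Finset V} {k : ℕ} {x : Fin k → V}

omit [Fintype V] in
theorem HasTwoApexes.mono {G H : SimpleGraph V} (h : HasTwoApexes G W x) (hGH : G ≤ H) :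
    HasTwoApexes H W x := by
  obtain ⟨a, ha, b, hb, hab, hc⟩ := h
  exact ⟨a, ha, b, hb, hab, fun i => ⟨hGH (hc i).1, hGH (hc i).2⟩⟩

/-- With an edge to spare, deleting uv must create a violating set D whose boundary has lost a
vertex. In G this D has boundary of order at most |S| and at least 5|D| + 2 edges, one more than an
exceptional set has, so D = W. The lost boundary vertex is then a root whose only edge into W was
deleted. -/
theorem MinCex.pendant_of_lt (h : MinCex G W S x) (hf : 5 * W.card + 1 < rho G ↑W) {u v : V}
    (hv : v ∈ W) (huv : G.Adj u v) : u ∈ S ∧ ∀ v' ∈ W, G.Adj u v' → v' = v := by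
  classical
  set G₁ := G.deleteEdges {s(u, v)} with hG₁
  have hle : G₁ ≤ G := SimpleGraph.deleteEdges_le _
  have hadj : ∀ a b, G₁.Adj a b ↔ G.Adj a b ∧ s(a, b) ≠ s(u, v) := by
    intro a b
    rw [hG₁, SimpleGraph.deleteEdges_adj, Set.mem_singleton_iff]
  have hrho : rho G₁ ↑W + 1 = rho G ↑W := rho_deleteEdges_of_mem huv (Or.inr hv)
  have hM : ¬ Mass G₁ W S := by
    intro hM
    rcases h.ih G₁ W (Or.inr ⟨rfl, by omega⟩) k x S h.le_five h.inj h.mem_iff hM with hm | hap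
    · exact h.no_model (hm.mono hle subset_rfl)
    · exact h.no_apex ⟨hap.1, hap.2.mono hle⟩
  obtain ⟨D, hDW, hDlt, hDrho⟩ : ∃ D ⊆ W, (bdry G₁ D).card < S.card ∧ 5 * D.card < rho G₁ ↑D := by
    by_contra hcon
    push Not at hcon
    refine hM ⟨h.mass.disj, bdry_subset_iff.mpr fun a ha b hab => h.mass.adj ha (hle hab),
      by omega, hcon⟩
  have hDle : rho G₁ ↑D ≤ rho G ↑D := rho_le_of_imp fun a b hab ha => ⟨hle hab, Or.inl ha⟩
  have hSle : S.card ≤ (bdry G D).card := by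
    by_contra hcon
    have := h.mass.sep D hDW (not_le.mp hcon)
    omega
  have hnot : ¬ bdry G D ⊆ bdry G₁ D := fun hcon => by
    have := Finset.card_le_card hcon
    omega
  obtain ⟨z, hz, hz'⟩ := Finset.not_subset.mp hnot
  obtain ⟨hzD, y, hy, hyz⟩ := mem_bdry.mp hz
  have hyze : s(y, z) = s(u, v) := by
    by_contra hne
    exact hz' (mem_bdry.mpr ⟨hzD, y, hy, (hadj y z).mpr ⟨hyz, hne⟩⟩)
  have huniq : ∀ y' ∈ D, G.Adj y' z → y' = y := by
    intro y' hy' hyz'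
    have : s(y', z) = s(u, v) := by
      by_contra hne
      exact hz' (mem_bdry.mpr ⟨hzD, y', hy', (hadj y' z).mpr ⟨hyz', hne⟩⟩)
    exact Sym2.congr_left.mp (this.trans hyze.symm)
  have hDrho' : rho G₁ ↑D + 1 = rho G ↑D := by
    refine rho_deleteEdges_of_mem huv ?_
    rcases Sym2.eq_iff.mp hyze with ⟨rfl, -⟩ | ⟨rfl, -⟩
    · exact Or.inl hy
    · exact Or.inr hy
  have hTcard : (bdry G D).card ≤ S.card := by
    refine le_trans (Finset.card_le_card ?_) ((Finset.card_insert_le z (bdry G₁ D)).trans hDlt)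
    intro b hb
    obtain ⟨hbD, a, ha, hab⟩ := mem_bdry.mp hb
    by_cases hbz : b = z
    · exact Finset.mem_insert.mpr (Or.inl hbz)
    · refine Finset.mem_insert_of_mem (mem_bdry.mpr ⟨hbD, a, ha, (hadj a b).mpr ⟨hab, fun he => ?_⟩⟩)
      rcases Sym2.eq_iff.mp (he.trans hyze.symm) with ⟨-, h⟩ | ⟨h, -⟩
      · exact hbz h
      · exact hzD (h ▸ ha)
  by_cases hlt : D.card < W.card
  · have := h.exceptional_of_mass hDW hlt (disjoint_bdry G D) subset_rfl (by
      intro t ht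
      obtain ⟨-, a, ha, hat⟩ := mem_bdry.mp ht
      exact h.mass.adj (hDW ha) hat) hTcard (by omega)
    omega
  · have hDeq : D = W := Finset.eq_of_subset_of_card_le hDW (not_lt.mp hlt)
    subst hDeq
    rcases Sym2.eq_iff.mp hyze with ⟨rfl, rfl⟩ | ⟨rfl, rfl⟩
    · exact absurd hv hzD
    · exact ⟨(h.mass.adj hy hyz).resolve_left hzD, fun v' hv' hzv' => huniq v' hv' hzv'.symm⟩

/-- Otherwise each edge at W is the only edge from some root into W, so there are at most |S| ≤ 5
edges at W, contradicting ρ(W) > 5|W| + 1 with W nonempty. -/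
theorem MinCex.rho_eq (h : MinCex G W S x) : rho G ↑W = 5 * W.card + 1 := by
  classical
  have hmass := h.mass.mass
  by_contra hne
  have hlt : 5 * W.card + 1 < rho G ↑W := by omega
  have hpend := fun u v (hv : v ∈ W) (huv : G.Adj u v) => h.pendant_of_lt hlt hv huv
  let f : V → V := fun u => if hu : ∃ v ∈ W, G.Adj u v then hu.choose else u
  have hsub : {e : Sym2 V | e ∈ G.edgeSet ∧ ∃ v ∈ (↑W : Set V), v ∈ e} ⊆
      (fun u => s(u, f u)) '' (↑S : Set V) := by
    rintro e ⟨he, v, hv, hve⟩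
    obtain ⟨u, rfl⟩ := Sym2.mem_iff_exists.mp hve
    have huv : G.Adj u v := SimpleGraph.Adj.symm he
    obtain ⟨huS, huniq⟩ := hpend u v hv huv
    refine ⟨u, huS, ?_⟩
    have hu : ∃ v ∈ W, G.Adj u v := ⟨v, hv, huv⟩
    have hfu : f u = v := by
      have : f u = hu.choose := dif_pos hu
      rw [this]
      exact huniq _ hu.choose_spec.1 hu.choose_spec.2
    simp only [hfu]
    exact Sym2.eq_swap
  have h1 : rho G ↑W ≤ S.card := by
    rw [← Set.ncard_coe_finset S]
    exact (Set.ncard_le_ncard hsub (Set.toFinite _)).trans (Set.ncard_image_le (Set.toFinite _))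
  have h2 := h.card
  have h3 := h.le_five
  have h4 : W.card ≠ 0 := by
    intro h0
    rw [Finset.card_eq_zero] at h0
    rw [h0] at hlt
    simp [rho_empty] at hlt
  omega

end Deletion

/-! ### Contracting an edge that loses few others -/

section ContractionStep

variable {V : Type*} [Fintype V] {G : SimpleGraph V} {W S : Finset V} {k : ℕ} {x : Fin k → V}
  {u v : V}

-- If ρ(D) were larger in G, adding v to the boundary of the contraction would make D exceptional,
-- with both apexes adjacent to u and v. Contracting would then cost two edges and leave at most
-- 5|D| − 1.
open Classical in
theorem MinCex.rho_le_of_contract (h : MinCex G W S x) (hv : v ∈ W) (huv : G.Adj u v)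
    {D : Finset V} (hD : D ⊆ W.erase v) (hu : u ∉ D)
    (hlt : (bdry (contract G u v) D).card < S.card)
    (hrho : 5 * D.card ≤ rho (contract G u v) ↑D) : rho G ↑D ≤ 5 * D.card := by
  by_contra hcon
  have hvD : v ∉ D := fun hvD => (Finset.mem_erase.mp (hD hvD)).1 rfl
  have hDW : D ⊆ W := hD.trans (Finset.erase_subset _ _)
  have hWcard : D.card < W.card :=
    lt_of_le_of_lt (Finset.card_le_card hD) (Finset.card_erase_lt_of_mem hv)
  have hcadj : ∀ w ∈ D, ∀ z, z ≠ v → G.Adj w z → (contract G u v).Adj w z := fun w hw z hz hwz =>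
    ⟨hwz.ne, fun h => hvD (h ▸ hw), hz, Or.inl hwz⟩
  have hub : ∀ w ∈ D, G.Adj v w → u ∈ bdry (contract G u v) D := by
    intro w hw hvw
    exact mem_bdry.mpr ⟨hu, w, hw, fun h => hu (h ▸ hw), hvw.ne', huv.ne,
      Or.inr (Or.inr ⟨rfl, hvw⟩)⟩
  set T := insert v (bdry (contract G u v) D) with hT
  have hDT : Disjoint D T := Finset.disjoint_insert_right.mpr ⟨hvD, disjoint_bdry _ D⟩
  have hbT : bdry G D ⊆ T := by
    refine bdry_subset_iff.mpr fun w hw z hwz => ?_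
    by_cases hz : z = v
    · exact Or.inr (Finset.mem_insert.mpr (Or.inl hz))
    · rcases bdry_subset_iff.mp subset_rfl w hw z (hcadj w hw z hz hwz) with h | h
      · exact Or.inl h
      · exact Or.inr (Finset.mem_insert_of_mem h)
  have hTWS : ∀ t ∈ T, t ∈ W ∨ t ∈ S := by
    intro t ht
    rcases Finset.mem_insert.mp ht with rfl | ht
    · exact Or.inl hv
    · obtain ⟨-, w, hw, -, -, -, hwt | ⟨rfl, -⟩ | ⟨rfl, -⟩⟩ := mem_bdry.mp ht
      · exact h.mass.adj (hDW hw) hwt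
      · exact absurd hw hu
      · exact h.mass.adj hv huv.symm
  have hTcard : T.card ≤ S.card := (Finset.card_insert_le _ _).trans hlt
  obtain ⟨hr, a, ha, b, hb, hab, hc⟩ :=
    h.exceptional_of_mass hDW hWcard hDT hbT hTWS hTcard (not_le.mp hcon)
  have hva := (hc v (Finset.mem_insert_self _ _)).1
  have huT := Finset.mem_insert_of_mem (b := v) (hub a ha hva)
  have h1 := rho_contract_add_le (G := G) hu hvD
  have h2 : 2 ≤ (D.filter fun w => G.Adj u w ∧ G.Adj v w).card := by
    rw [← Finset.card_pair hab]
    refine Finset.card_le_card fun w hw => ?_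
    rw [Finset.mem_filter]
    rcases Finset.mem_insert.mp hw with rfl | hw
    · exact ⟨ha, (hc _ huT).1, hva⟩
    · rw [Finset.mem_singleton.mp hw]
      exact ⟨hb, (hc _ huT).2, (hc v (Finset.mem_insert_self _ _)).2⟩
  omega

-- At most 1 + 4 edges disappear with one vertex, so the surplus survives. A violating set
-- containing u would be rigid in the contraction, and with v restored rigid in G; one avoiding u is
-- excluded by `MinCex.rho_le_of_contract`.
open Classical in
theorem MinCex.mass_contract (h : MinCex G W S x) (hv : v ∈ W) (huv : G.Adj u v)
    (ht : (lostNbr G W u v).card ≤ 4) : Mass (contract G u v) (W.erase v) S := by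
  have hvS : v ∉ S := fun hvS => Finset.disjoint_left.mp h.mass.disj hv hvS
  have hcard : (W.erase v).card + 1 = W.card := Finset.card_erase_add_one hv
  have huWS : u ∈ W ∨ u ∈ S := h.mass.adj hv huv.symm
  have hadj : ∀ a ∈ W.erase v, ∀ b, (contract G u v).Adj a b → b ∈ W.erase v ∨ b ∈ S := by
    rintro a ha b ⟨-, -, hbv, hab | ⟨rfl, hvb⟩ | ⟨rfl, hva⟩⟩
    · exact (h.mass.adj (Finset.mem_erase.mp ha).2 hab).imp
        (fun h => Finset.mem_erase.mpr ⟨hbv, h⟩) id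
    · exact (h.mass.adj hv hvb).imp (fun h => Finset.mem_erase.mpr ⟨hbv, h⟩) id
    · exact huWS.imp (fun h => Finset.mem_erase.mpr ⟨hbv, h⟩) id
  refine ⟨Finset.disjoint_of_subset_left (Finset.erase_subset _ _) h.mass.disj,
    bdry_subset_iff.mpr hadj, ?_, ?_⟩
  · have h1 := rho_le_contract (G := G) (W := W) huv.ne
    have h2 := h.rho_eq
    omega
  · by_contra hcon
    push Not at hcon
    obtain ⟨D, hDW, hDlt, hDM⟩ := exists_mass_of_violation hcon
    have hvD : v ∉ D := fun hvD => (Finset.mem_erase.mp (hDW hvD)).1 rfl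
    have hDM' := hDM.mass
    by_cases hu : u ∈ D
    · have hDcard := Finset.card_le_card hDW
      have hR := (h.ih (contract G u v) D (Or.inl (by omega))).rigid_of_card_lt hDM
        (by have := h.card; have := h.le_five; omega)
      have hvb : v ∉ bdry (contract G u v) D := by
        intro hvb
        obtain ⟨-, w, -, hwv⟩ := mem_bdry.mp hvb
        exact hwv.2.2.1 rfl
      refine h.not_rigidSep (insert v D) (bdry (contract G u v) D) ⟨?_, ⟨v, Finset.mem_insert_self _ _⟩,
        bdry_subset_iff.mpr ?_, Finset.disjoint_insert_left.mpr ⟨hvb, disjoint_bdry _ D⟩, ?_,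
        hDlt.le, ?_⟩
      · exact Finset.insert_subset hv (hDW.trans (Finset.erase_subset _ _))
      · intro a ha b hab
        by_cases hbv : b = v
        · exact Or.inl (Finset.mem_insert.mpr (Or.inl hbv))
        by_cases hbu : b = u
        · exact Or.inl (Finset.mem_insert_of_mem (hbu ▸ hu))
        rcases Finset.mem_insert.mp ha with hav | ha
        · exact ((bdry_subset_iff (G := contract G u v)).mp subset_rfl u hu b ⟨fun h => hbu h.symm, huv.ne, hbv,
            Or.inr (Or.inl ⟨rfl, hav ▸ hab⟩)⟩).imp Finset.mem_insert_of_mem id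
        · exact ((bdry_subset_iff (G := contract G u v)).mp subset_rfl a ha b ⟨hab.ne, fun h => hvD (h ▸ ha), hbv,
            Or.inl hab⟩).imp Finset.mem_insert_of_mem id
      · intro b hb
        obtain ⟨-, a, ha, hab⟩ := mem_bdry.mp hb
        exact Finset.mem_union.mpr ((hadj a (hDW ha) b hab).imp
          (fun h => (Finset.mem_erase.mp h).2) id)
      · intro s hs hsr
        refine (Model.of_contract huv ?_ (hR s hs hsr)).mono le_rfl ?_
        · rintro (h | h)
          · exact hvD h
          · exact hvb h
        · rintro w (rfl | hw | hw)
          · exact Or.inl (Finset.mem_insert_self _ _)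
          · exact Or.inl (Finset.mem_insert_of_mem hw)
          · exact Or.inr hw
    · have h1 := h.rho_le_of_contract hv huv hDW hu hDlt hDM'.le
      have h2 := rho_contract_add_le (G := G) hu hvD
      omega

open Classical in
theorem MinCex.apexes_contract (h : MinCex G W S x) (hv : v ∈ W) (huv : G.Adj u v)
    (ht : (lostNbr G W u v).card ≤ 4) :
    ¬ Model (contract G u v) (↑(W.erase v) ∪ ↑S) x ∧ k = 5 ∧
      HasTwoApexes (contract G u v) (W.erase v) x := by
  classical
  have hvS : v ∉ S := fun hvS => Finset.disjoint_left.mp h.mass.disj hv hvS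
  have hM := h.mass_contract hv huv ht
  have hno : ¬ Model (contract G u v) (↑(W.erase v) ∪ ↑S) x := by
    intro hm
    refine h.no_model ((Model.of_contract huv ?_ hm).mono le_rfl ?_)
    · rintro (h | h)
      · exact (Finset.mem_erase.mp h).1 rfl
      · exact hvS h
    · rintro w (rfl | hw | hw)
      · exact Or.inl hv
      · exact Or.inl (Finset.mem_erase.mp hw).2
      · exact Or.inr hw
  exact ⟨hno, (h.ih (contract G u v) (W.erase v) (Or.inl (Finset.card_erase_lt_of_mem hv)) k x S
    h.le_five h.inj h.mem_iff hM).resolve_left hno⟩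

end ContractionStep
end RootedCycle
namespace RootedCycle

/-! ### Five-root minors from three helper vertices -/

section FiveRoots

variable {V : Type*} {G : SimpleGraph V} {U : Set V} {x : Fin 5 → V} {a b c : V}

/-- `b` serves `x 4, x 0, x 1`, `a` serves `x 1, x 2, x 3` and `c` serves `x 3, x 4`. -/
theorem model_of_three_helpers (hx : Function.Injective x) (hxU : ∀ i, x i ∈ U)
    (haU : a ∈ U) (hbU : b ∈ U) (hcU : c ∈ U) (hab : a ≠ b) (hbc : b ≠ c) (hac : a ≠ c)
    (hax : ∀ i, a ≠ x i) (hbx : ∀ i, b ≠ x i) (hcx : ∀ i, c ≠ x i)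
    (hb0 : G.Adj b (x 0)) (hb1 : G.Adj b (x 1)) (hb4 : G.Adj b (x 4))
    (ha1 : G.Adj a (x 1)) (ha2 : G.Adj a (x 2)) (ha3 : G.Adj a (x 3))
    (hc3 : G.Adj c (x 3)) (hc4 : G.Adj c (x 4)) : Model G U x := by
  refine model_of_helpers hx hxU ![b, a, c] ?_ ?_ ?_ ![0, 2, 3] ?_ ?_
  · intro p q hpq
    fin_cases p <;> fin_cases q <;> simp_all
  · intro p
    fin_cases p <;> assumption
  · intro p j
    fin_cases p
    · exact hbx j
    · exact hax j
    · exact hcx j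
  · intro p
    fin_cases p <;> assumption
  · intro j
    fin_cases j
    · exact Or.inr (Or.inl ⟨0, rfl, hb1⟩)
    · exact Or.inr (Or.inr (Or.inl ⟨1, rfl, ha1⟩))
    · exact Or.inr (Or.inl ⟨1, rfl, ha3⟩)
    · exact Or.inr (Or.inl ⟨2, rfl, hc4⟩)
    · exact Or.inr (Or.inr (Or.inl ⟨0, rfl, hb4⟩))

/-- `b` serves `x 4, x 0, x 1`, `c` serves `x 1, x 2` and `a` serves `x 2, x 3, x 4`. -/
theorem model_of_three_helpers' (hx : Function.Injective x) (hxU : ∀ i, x i ∈ U)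
    (haU : a ∈ U) (hbU : b ∈ U) (hcU : c ∈ U) (hab : a ≠ b) (hbc : b ≠ c) (hac : a ≠ c)
    (hax : ∀ i, a ≠ x i) (hbx : ∀ i, b ≠ x i) (hcx : ∀ i, c ≠ x i)
    (hb0 : G.Adj b (x 0)) (hb1 : G.Adj b (x 1)) (hb4 : G.Adj b (x 4))
    (ha2 : G.Adj a (x 2)) (ha3 : G.Adj a (x 3)) (ha4 : G.Adj a (x 4))
    (hc1 : G.Adj c (x 1)) (hc2 : G.Adj c (x 2)) : Model G U x := by
  refine model_of_helpers hx hxU ![b, a, c] ?_ ?_ ?_ ![0, 3, 2] ?_ ?_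
  · intro p q hpq
    fin_cases p <;> fin_cases q <;> simp_all
  · intro p
    fin_cases p <;> assumption
  · intro p j
    fin_cases p
    · exact hbx j
    · exact hax j
    · exact hcx j
  · intro p
    fin_cases p <;> assumption
  · intro j
    fin_cases j
    · exact Or.inr (Or.inl ⟨0, rfl, hb1⟩)
    · exact Or.inr (Or.inr (Or.inl ⟨2, rfl, hc1⟩))
    · exact Or.inr (Or.inr (Or.inl ⟨1, rfl, ha2⟩))
    · exact Or.inr (Or.inl ⟨1, rfl, ha4⟩)
    · exact Or.inr (Or.inr (Or.inl ⟨0, rfl, hb4⟩))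

/-- With the root missed by one helper rotated to position 0, the other helper's missed root j
avoids positions 3, 4 or positions 1, 2. This decides which of the two arrangements of three helpers
works. -/
theorem rotation_avoids : ∀ i j : Fin 5, j ≠ i →
    (3 + i ≠ j ∧ 4 + i ≠ j) ∨ (1 + i ≠ j ∧ 2 + i ≠ j) := by
  decide

theorem eq_rotation : ∀ i j : Fin 5, i = j ∨ i = 1 + j ∨ i = 2 + j ∨ i = 3 + j ∨ i = 4 + j := by
  decide

/-- Three vertices, one complete to the roots and each of the other two almost complete. -/
theorem model_of_almost_complete (hx : Function.Injective x) (hxU : ∀ i, x i ∈ U)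
    (haU : a ∈ U) (hbU : b ∈ U) (hcU : c ∈ U) (hab : a ≠ b) (hbc : b ≠ c) (hac : a ≠ c)
    (hax : ∀ i, a ≠ x i) (hbx : ∀ i, b ≠ x i) (hcx : ∀ i, c ≠ x i)
    (hb : ∀ i, G.Adj b (x i)) (hcover : ∀ i, G.Adj a (x i) ∨ G.Adj c (x i))
    (ha : ∃ i, ¬ G.Adj a (x i)) (hc : ∃ i, ¬ G.Adj c (x i)) {F : Finset (Fin 5)}
    (hF : ∀ i ∈ F, G.Adj a (x i) ∧ G.Adj c (x i)) (hF3 : 3 ≤ F.card) : Model G U x := by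
  obtain ⟨i, hi⟩ := ha
  obtain ⟨j, hj⟩ := hc
  have hij : j ≠ i := by
    rintro rfl
    exact (hcover j).elim hi hj
  have hFeq : F = {i, j}ᶜ := by
    refine Finset.eq_of_subset_of_card_le (fun l hl => ?_) ?_
    · simp only [Finset.mem_compl, Finset.mem_insert, Finset.mem_singleton, not_or]
      exact ⟨fun h => hi (h ▸ (hF l hl).1), fun h => hj (h ▸ (hF l hl).2)⟩
    · rw [Finset.card_compl, Finset.card_pair hij.symm, Fintype.card_fin]
      exact hF3
  have hF' : ∀ l, l ≠ i → l ≠ j → G.Adj a (x l) ∧ G.Adj c (x l) := fun l h1 h2 => hF l (by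
    rw [hFeq]
    simp [h1, h2])
  have ha' : ∀ l, l ≠ i → G.Adj a (x l) := by
    intro l hl
    by_cases hlj : l = j
    · exact (hcover l).resolve_right (hlj ▸ hj)
    · exact (hF' l hl hlj).1
  have hc' : ∀ l, l ≠ j → G.Adj c (x l) := by
    intro l hl
    by_cases hli : l = i
    · exact (hcover l).resolve_left (hli ▸ hi)
    · exact (hF' l hli hl).2
  have hne : ∀ l : Fin 5, l ≠ 0 → l + i ≠ i := fun l hl h => hl (by simpa using h)
  refine model_five_of_rotate i ?_
  have hx' : Function.Injective fun j => x (j + i) := fun p q h => add_right_cancel (hx h)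
  rcases rotation_avoids i j hij with ⟨h3, h4⟩ | ⟨h1, h2⟩
  · exact model_of_three_helpers hx' (fun j => hxU _) haU hbU hcU hab hbc hac (fun j => hax _)
      (fun j => hbx _) (fun j => hcx _) (hb _) (hb _) (hb _) (ha' _ (hne 1 (by decide)))
      (ha' _ (hne 2 (by decide))) (ha' _ (hne 3 (by decide))) (hc' _ h3) (hc' _ h4)
  · exact model_of_three_helpers' hx' (fun j => hxU _) haU hbU hcU hab hbc hac (fun j => hax _)
      (fun j => hbx _) (fun j => hcx _) (hb _) (hb _) (hb _) (ha' _ (hne 2 (by decide)))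
      (ha' _ (hne 3 (by decide))) (ha' _ (hne 4 (by decide))) (hc' _ h1) (hc' _ h2)

/-- A vertex `c` attached to `x 0`, with two vertices complete to the other roots. -/
theorem model_of_attached_root (hx : Function.Injective x) (hxU : ∀ i, x i ∈ U)
    (haU : a ∈ U) (hbU : b ∈ U) (hcU : c ∈ U) (hab : a ≠ b) (hbc : b ≠ c) (hac : a ≠ c)
    (hax : ∀ i, a ≠ x i) (hbx : ∀ i, b ≠ x i) (hcx : ∀ i, c ≠ x i)
    (ha : ∀ i, i ≠ 0 → G.Adj a (x i)) (hb : ∀ i, i ≠ 0 → G.Adj b (x i)) (hc0 : G.Adj c (x 0))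
    (h : (G.Adj c (x 1) ∧ (G.Adj c (x 4) ∨ G.Adj b c)) ∨ (G.Adj c (x 4) ∧ G.Adj b c)) :
    Model G U x := by
  have hw : Function.Injective ![c, a, b] := by
    intro p q hpq
    fin_cases p <;> fin_cases q <;> simp_all
  have hwU : ∀ p, ![c, a, b] p ∈ U := by
    intro p
    fin_cases p <;> assumption
  have hwx : ∀ p i, ![c, a, b] p ≠ x i := by
    intro p j
    fin_cases p
    · exact hcx j
    · exact hax j
    · exact hbx j
  rcases h with ⟨h1, h4⟩ | ⟨h4, hbc'⟩
  · refine model_of_helpers hx hxU _ hw hwU hwx ![0, 2, 4] ?_ ?_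
    · intro p
      fin_cases p
      · exact hc0
      · exact ha 2 (by decide)
      · exact hb 4 (by decide)
    · intro j
      fin_cases j
      · exact Or.inr (Or.inl ⟨0, rfl, h1⟩)
      · exact Or.inr (Or.inr (Or.inl ⟨1, rfl, ha 1 (by decide)⟩))
      · exact Or.inr (Or.inl ⟨1, rfl, ha 3 (by decide)⟩)
      · exact Or.inr (Or.inr (Or.inl ⟨2, rfl, hb 3 (by decide)⟩))
      · rcases h4 with h4 | h4
        · exact Or.inr (Or.inr (Or.inl ⟨0, rfl, h4⟩))
        · exact Or.inr (Or.inr (Or.inr ⟨2, 0, rfl, rfl, h4⟩))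
  · refine model_of_helpers hx hxU _ hw hwU hwx ![0, 3, 1] ?_ ?_
    · intro p
      fin_cases p
      · exact hc0
      · exact ha 3 (by decide)
      · exact hb 1 (by decide)
    · intro j
      fin_cases j
      · exact Or.inr (Or.inr (Or.inr ⟨0, 2, rfl, rfl, hbc'.symm⟩))
      · exact Or.inr (Or.inl ⟨2, rfl, hb 2 (by decide)⟩)
      · exact Or.inr (Or.inr (Or.inl ⟨1, rfl, ha 2 (by decide)⟩))
      · exact Or.inr (Or.inl ⟨1, rfl, ha 4 (by decide)⟩)
      · exact Or.inr (Or.inr (Or.inl ⟨0, rfl, h4⟩))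

end FiveRoots

/-! ### Contractions with two apexes are impossible -/

section ContractionApexes

variable {V : Type*} [Fintype V] {G : SimpleGraph V} {W S : Finset V} {x : Fin 5 → V}
  {u v a b : V}

open Classical in
/-- If contracting `uv` produces an exceptional instance with apexes `a, b`, then `u, v` have four
common neighbours, none of them in `W` apart from `a` and `b`. -/
theorem MinCex.lostNbr_of_contract_apexes (h : MinCex G W S x) (hv : v ∈ W) (huv : G.Adj u v)
    (ht : (lostNbr G W u v).card ≤ 4) (ha : a ∈ W.erase v) (hb : b ∈ W.erase v) (hab : a ≠ b)
    (hc : ∀ i, (contract G u v).Adj (x i) a ∧ (contract G u v).Adj (x i) b)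
    (hu : u ∉ W.erase v \ {a, b}) :
    4 ≤ (lostNbr G W u v).card ∧ ∀ w ∈ lostNbr G W u v, w = a ∨ w = b ∨ w ∈ S := by
  have hM := h.mass_contract hv huv ht
  obtain ⟨hno, -, -⟩ := h.apexes_contract hv huv ht
  obtain ⟨-, hrho, hcl⟩ := hM.apex_structure h.inj h.mem_iff hno ha hb hab hc
  have hcard : (W.erase v).card + 1 = W.card := Finset.card_erase_add_one hv
  refine ⟨?_, fun w hw => ?_⟩
  · have h1 := rho_le_contract (G := G) (W := W) huv.ne
    have h2 := h.rho_eq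
    omega
  · obtain ⟨hvw, hwu, huw⟩ := mem_lostNbr.mp hw
    rcases h.mass.adj hv hvw with hwW | hwS
    swap
    · exact Or.inr (Or.inr hwS)
    replace huw : G.Adj u w := huw.resolve_right fun h => h.2 hwW
    by_contra hcon
    push Not at hcon
    obtain ⟨hwa, hwb, -⟩ := hcon
    have hwR : w ∈ W.erase v \ {a, b} := by
      simp only [Finset.mem_sdiff, Finset.mem_erase, Finset.mem_insert, Finset.mem_singleton,
        not_or]
      exact ⟨⟨hvw.ne', hwW⟩, hwa, hwb⟩
    set C := compFinset (contract G u v) (W.erase v \ {a, b}) w with hC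
    have hCR : C ⊆ W.erase v \ {a, b} := compFinset_subset hwR
    have hCcl : ∀ y ∈ C, ∀ z ∈ W.erase v \ {a, b}, (contract G u v).Adj y z → z ∈ C :=
      fun y hy z hz hyz => compFinset_closed hwR hy hz hyz
    have hconn : Conn (contract G u v) ↑C := by
      rw [hC, coe_compFinset]
      exact conn_comp
    have hwC : w ∈ C := by
      rw [← Finset.mem_coe, hC, coe_compFinset]
      exact mem_comp_self _ _ w
    obtain ⟨i, hi⟩ := hM.bdry_comp_subset h.inj h.mem_iff hno ha hb hab hc hconn hCR hCcl
    -- The component of w in the contraction without a and b has order-4 boundary and is tight. It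
    -- obeys the same bound in G, yet has at least one edge more there because w is a common
    -- neighbour of u and v.
    have hblt : (bdry (contract G u v) C).card < S.card := by
      rw [h.card]
      exact lt_of_le_of_lt ((Finset.card_le_card hi).trans Finset.card_le_four) (by norm_num)
    have huC : u ∉ C := fun h => hu (hCR h)
    have hvC : v ∉ C := fun h => (Finset.mem_erase.mp (Finset.mem_sdiff.mp (hCR h)).1).1 rfl
    have hCrho := hcl C hCR hCcl
    have h1 := h.rho_le_of_contract hv huv (hCR.trans Finset.sdiff_subset) huC hblt hCrho.ge
    have h2 := rho_contract_add_le (G := G) huC hvC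
    have h3 : 0 < (C.filter fun w => G.Adj u w ∧ G.Adj v w).card :=
      Finset.card_pos.mpr ⟨w, Finset.mem_filter.mpr ⟨hwC, huw, hvw⟩⟩
    omega

-- Here u and v jointly see all roots and b sees all of them, but neither u nor v alone does, as G
-- has no two apexes. Of the four or more lost neighbours only b can fail to be a root, so u and v
-- share at least three roots and `model_of_almost_complete` applies.
open Classical in
theorem MinCex.false_of_contract_apex (h : MinCex G W S x) (hv : v ∈ W) (huv : G.Adj u v)
    (ht : (lostNbr G W u v).card ≤ 4) (hu : u ∈ W.erase v) (hb : b ∈ W.erase v) (hub : u ≠ b)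
    (hc : ∀ i, (contract G u v).Adj (x i) u ∧ (contract G u v).Adj (x i) b) : False := by
  obtain ⟨h4, hsub⟩ := h.lostNbr_of_contract_apexes hv huv ht hu hb hub hc (by simp)
  have hxW := h.notMem
  have huW := (Finset.mem_erase.mp hu).2
  have hbW := (Finset.mem_erase.mp hb).2
  have hbv := (Finset.mem_erase.mp hb).1
  have hne : ∀ w ∈ W, ∀ i, w ≠ x i := fun w hw i he => hxW i (he ▸ hw)
  have hbx : ∀ i, G.Adj (x i) b := fun i =>
    ((contract_adj_of_ne (hne u huW i).symm hub.symm).mp (hc i).2).2.2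
  have hcover : ∀ i, G.Adj u (x i) ∨ G.Adj v (x i) := by
    intro i
    obtain ⟨-, -, -, h1 | ⟨h1, -⟩ | ⟨-, h1⟩⟩ := (hc i).1
    · exact Or.inl h1.symm
    · exact absurd h1.symm (hne u huW i)
    · exact Or.inr h1
  refine h.no_model (model_of_almost_complete (a := u) (b := b) (c := v) h.inj
    (fun i => Or.inr (h.mem i)) (Or.inl huW) (Or.inl hbW) (Or.inl hv) hub hbv huv.ne
    (hne u huW) (hne b hbW) (hne v hv) (fun i => (hbx i).symm) hcover ?_ ?_
    (F := Finset.univ.filter fun i => G.Adj u (x i) ∧ G.Adj v (x i))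
    (fun i hi => (Finset.mem_filter.mp hi).2) ?_)
  · by_contra hcon
    push Not at hcon
    exact h.no_apex ⟨rfl, u, huW, b, hbW, hub, fun i => ⟨(hcon i).symm, hbx i⟩⟩
  · by_contra hcon
    push Not at hcon
    exact h.no_apex ⟨rfl, v, hv, b, hbW, hbv.symm, fun i => ⟨(hcon i).symm, hbx i⟩⟩
  · have hsub' : lostNbr G W u v ⊆ insert b
        ((Finset.univ.filter fun i => G.Adj u (x i) ∧ G.Adj v (x i)).image x) := by
      intro w hw
      obtain ⟨hvw, hwu, huw⟩ := mem_lostNbr.mp hw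
      rcases hsub w hw with rfl | rfl | hwS
      · exact absurd rfl hwu
      · exact Finset.mem_insert_self _ _
      · obtain ⟨i, rfl⟩ := (h.mem_iff w).mp hwS
        refine Finset.mem_insert_of_mem (Finset.mem_image.mpr ⟨i, ?_, rfl⟩)
        exact Finset.mem_filter.mpr ⟨Finset.mem_univ _, huw.resolve_right fun h => h.1 huW, hvw⟩
    have h5 := (Finset.card_le_card hsub').trans (Finset.card_insert_le _ _)
    have h6 := Finset.card_image_le (s := Finset.univ.filter
      fun i => G.Adj u (x i) ∧ G.Adj v (x i)) (f := x)
    omega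

-- Now v was contracted into a root. As a and b are not both adjacent to this root in G, v is
-- adjacent to one of them, and then a neighbour of v among the two adjacent roots would give a
-- minor. The lost neighbours therefore lie among one apex and two roots, fewer than four.
open Classical in
theorem MinCex.false_of_contract_root (h : MinCex G W S x) (hv : v ∈ W) (i₀ : Fin 5)
    (huv : G.Adj (x i₀) v) (ht : (lostNbr G W (x i₀) v).card ≤ 4) (ha : a ∈ W.erase v)
    (hb : b ∈ W.erase v) (hab : a ≠ b)
    (hc : ∀ i, (contract G (x i₀) v).Adj (x i) a ∧ (contract G (x i₀) v).Adj (x i) b) :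
    False := by
  have hxW := h.notMem
  obtain ⟨h4, hsub⟩ := h.lostNbr_of_contract_apexes hv huv ht ha hb hab hc
    (fun hcon => hxW i₀ (Finset.mem_erase.mp (Finset.mem_sdiff.mp hcon).1).2)
  have haW := (Finset.mem_erase.mp ha).2
  have hbW := (Finset.mem_erase.mp hb).2
  have hav := (Finset.mem_erase.mp ha).1
  have hbv := (Finset.mem_erase.mp hb).1
  have hne : ∀ w ∈ W, ∀ i, w ≠ x i := fun w hw i he => hxW i (he ▸ hw)
  have key : ∀ c ∈ W, (∀ i, (contract G (x i₀) v).Adj (x i) c) →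
      (∀ i, i ≠ i₀ → G.Adj c (x i)) ∧ (G.Adj (x i₀) c ∨ G.Adj v c) := by
    intro c hcW hcx
    refine ⟨fun i hi => ((contract_adj_of_ne (h.inj.ne hi) (hne c hcW i₀)).mp
      (hcx i)).2.2.symm, ?_⟩
    obtain ⟨-, -, -, h1 | ⟨-, h1⟩ | ⟨h1, -⟩⟩ := hcx i₀
    · exact Or.inl h1
    · exact Or.inr h1
    · exact absurd h1 (hne c hcW i₀)
  obtain ⟨ha1, ha2⟩ := key a haW fun i => (hc i).1
  obtain ⟨hb1, hb2⟩ := key b hbW fun i => (hc i).2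
  have hy : Function.Injective fun j => x (j + i₀) := fun p q h' => add_right_cancel (h.inj h')
  have hrot : ∀ c d, c ∈ W → d ∈ W → c ≠ d → c ≠ v → d ≠ v → (∀ i, i ≠ i₀ → G.Adj c (x i)) →
      (∀ i, i ≠ i₀ → G.Adj d (x i)) →
      ¬ ((G.Adj v (x (1 + i₀)) ∧ (G.Adj v (x (4 + i₀)) ∨ G.Adj d v)) ∨
        (G.Adj v (x (4 + i₀)) ∧ G.Adj d v)) := by
    intro c d hcW hdW hcd hcv hdv hcx hdx hcon
    refine h.no_model (model_five_of_rotate i₀ (model_of_attached_root (a := c) (b := d) (c := v) hy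
      (fun i => Or.inr (h.mem _)) (Or.inl hcW) (Or.inl hdW) (Or.inl hv) hcd hdv hcv
      (fun i => hne c hcW _) (fun i => hne d hdW _) (fun i => hne v hv _) (fun i hi => hcx _ ?_)
      (fun i hi => hdx _ ?_) ?_ hcon))
    · simpa using hi
    · simpa using hi
    · simpa using huv.symm
  have hA := hrot a b haW hbW hab hav hbv ha1 hb1
  have hB := hrot b a hbW haW hab.symm hbv hav hb1 ha1
  have hnot : ¬ (G.Adj (x i₀) a ∧ G.Adj (x i₀) b) := by
    rintro ⟨h1, h2⟩
    refine h.no_apex ⟨rfl, a, haW, b, hbW, hab, fun i => ?_⟩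
    by_cases hi : i = i₀
    · exact hi ▸ ⟨h1, h2⟩
    · exact ⟨(ha1 i hi).symm, (hb1 i hi).symm⟩
  have hr : ¬ G.Adj v (x (1 + i₀)) ∧ ¬ G.Adj v (x (4 + i₀)) := by
    have : G.Adj a v ∨ G.Adj b v := by
      by_contra hcon
      push Not at hcon
      exact hnot ⟨ha2.resolve_right fun h => hcon.1 h.symm,
        hb2.resolve_right fun h => hcon.2 h.symm⟩
    tauto
  have hcover : ∀ w ∈ lostNbr G W (x i₀) v,
      (w = a ∧ G.Adj (x i₀) a) ∨ (w = b ∧ G.Adj (x i₀) b) ∨ w = x (2 + i₀) ∨ w = x (3 + i₀) := by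
    intro w hw
    obtain ⟨hvw, hwu, huw⟩ := mem_lostNbr.mp hw
    rcases hsub w hw with rfl | rfl | hwS
    · exact Or.inl ⟨rfl, huw.resolve_right fun h => h.2 haW⟩
    · exact Or.inr (Or.inl ⟨rfl, huw.resolve_right fun h => h.2 hbW⟩)
    · obtain ⟨i, rfl⟩ := (h.mem_iff w).mp hwS
      rcases eq_rotation i i₀ with rfl | rfl | rfl | rfl | rfl
      · exact absurd rfl hwu
      · exact absurd hvw hr.1
      · exact Or.inr (Or.inr (Or.inl rfl))
      · exact Or.inr (Or.inr (Or.inr rfl))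
      · exact absurd hvw hr.2
  have h3 : ∃ c, lostNbr G W (x i₀) v ⊆ {c, x (2 + i₀), x (3 + i₀)} := by
    by_cases hax : G.Adj (x i₀) a
    · refine ⟨a, fun w hw => ?_⟩
      rcases hcover w hw with ⟨rfl, -⟩ | ⟨-, h2⟩ | rfl | rfl
      · simp
      · exact absurd ⟨hax, h2⟩ hnot
      · simp
      · simp
    · refine ⟨b, fun w hw => ?_⟩
      rcases hcover w hw with ⟨-, h2⟩ | ⟨rfl, -⟩ | rfl | rfl
      · exact absurd h2 hax
      · simp
      · simp
      · simp
  obtain ⟨c, hc3⟩ := h3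
  have := (Finset.card_le_card hc3).trans Finset.card_le_three
  omega

end ContractionApexes

/-! ### Every contraction loses five further edges -/

section LostNeighbours

variable {V : Type*} [Fintype V] {G : SimpleGraph V} {W S : Finset V} {k : ℕ} {x : Fin k → V}
  {u v : V}

/-- Contracting any edge of a minimal counterexample loses at least five further edges. -/
theorem MinCex.five_le_lostNbr (h : MinCex G W S x) (hv : v ∈ W) (huv : G.Adj u v) :
    5 ≤ (lostNbr G W u v).card := by
  classical
  by_contra hcon
  have ht : (lostNbr G W u v).card ≤ 4 := by omega
  obtain ⟨-, rfl, a, ha, b, hb, hab, hc⟩ := h.apexes_contract hv huv ht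
  by_cases hua : u = a
  · subst hua
    exact h.false_of_contract_apex hv huv ht ha hb hab hc
  by_cases hub : u = b
  · subst hub
    exact h.false_of_contract_apex hv huv ht hb ha hab.symm fun i => (hc i).symm
  rcases h.mass.adj hv huv.symm with hu | hu
  -- If u lies in W and is neither apex, contraction does not affect edges between roots and apexes,
  -- so a and b are apexes in G.
  · have hne : ∀ i, x i ≠ u := fun i hi => h.notMem i (hi ▸ hu)
    refine h.no_apex ⟨rfl, a, (Finset.mem_erase.mp ha).2, b, (Finset.mem_erase.mp hb).2, hab,
      fun i => ⟨?_, ?_⟩⟩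
    · exact ((contract_adj_of_ne (hne i) (Ne.symm hua)).mp (hc i).1).2.2
    · exact ((contract_adj_of_ne (hne i) (Ne.symm hub)).mp (hc i).2).2.2
  · obtain ⟨i₀, rfl⟩ := (h.mem_iff u).mp hu
    exact h.false_of_contract_root hv i₀ huv ht ha hb hab hc

end LostNeighbours
end RootedCycle
namespace RootedCycle

/-! ### Minors around a vertex complete to five roots -/

section DenseModels

variable {V : Type*} {G : SimpleGraph V} {U R : Set V} {y : Fin 5 → V} {v : V}

/-- The common neighbours in `R` of `y i` and `y (i + 1)`. -/
def commonNbr (G : SimpleGraph V) (R : Set V) (y : Fin 5 → V) (i : Fin 5) : Set V :=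
  {w | w ∈ R ∧ G.Adj (y i) w ∧ G.Adj (y (i + 1)) w}

/-- The vertex `v` is complete to the roots `y`, and `R` is a set of further helpers. -/
structure HelperSet (G : SimpleGraph V) (U R : Set V) (y : Fin 5 → V) (v : V) : Prop where
  inj : Function.Injective y
  root_mem : ∀ i, y i ∈ U
  apex_mem : v ∈ U
  apex_adj : ∀ i, G.Adj v (y i)
  subset : R ⊆ U
  root_notMem : ∀ i, y i ∉ R
  apex_notMem : v ∉ R

theorem HelperSet.rotate (h : HelperSet G U R y v) (c : Fin 5) :
    HelperSet G U R (fun i => y (i + c)) v :=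
  ⟨fun _ _ hpq => add_right_cancel (h.inj hpq), fun _ => h.root_mem _, h.apex_mem,
    fun _ => h.apex_adj _, h.subset, fun _ => h.root_notMem _, h.apex_notMem⟩

/-- With `v` serving `y 0, y 1, y 2`, a set `A` of labelled helpers serves the other links. -/
theorem HelperSet.model_of_labels (h : HelperSet G U R y v) (A : Set (V × Fin 5))
    (hAR : ∀ p ∈ A, p.1 ∈ R) (hadj : ∀ p ∈ A, G.Adj p.1 (y p.2))
    (hfun : ∀ p ∈ A, ∀ p' ∈ A, p.1 = p'.1 → p = p')
    (hlink : ∀ i : Fin 5, i = 2 ∨ i = 3 ∨ i = 4 → G.Adj (y i) (y (i + 1)) ∨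
      (∃ p ∈ A, p.2 = i ∧ G.Adj p.1 (y (i + 1))) ∨ (∃ p ∈ A, p.2 = i + 1 ∧ G.Adj p.1 (y i)) ∨
      (∃ p ∈ A, ∃ p' ∈ A, p.2 = i ∧ p'.2 = i + 1 ∧ G.Adj p.1 p'.1)) : Model G U y := by
  let B : Option A → V := fun o => o.elim v fun p => p.1.1
  let lab : Option A → Fin 5 := fun o => o.elim 1 fun p => p.1.2
  have hBU : ∀ o, B o ∈ U := by
    rintro (_ | p)
    · exact h.apex_mem
    · exact h.subset (hAR _ p.2)
  have hBadj : ∀ o, G.Adj (B o) (y (lab o)) := by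
    rintro (_ | p)
    · exact h.apex_adj 1
    · exact hadj _ p.2
  have hBy : ∀ o i, B o ≠ y i := by
    rintro (_ | p) i
    · exact (h.apex_adj i).ne
    · exact fun he => h.root_notMem i (he ▸ hAR _ p.2)
  have hBinj : Function.Injective B := by
    rintro (_ | p) (_ | p') he
    · rfl
    · have he' : v = p'.1.1 := he
      exact absurd (he' ▸ hAR _ p'.2) h.apex_notMem
    · have he' : p.1.1 = v := he
      exact absurd (he' ▸ hAR _ p.2) h.apex_notMem
    · exact congrArg some (Subtype.ext (hfun _ p.2 _ p'.2 he))
  refine ⟨star y (fun o => {B o}) lab, isCyc_star h.inj (fun o => conn_singleton G _)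
    (fun o o' hne => Set.disjoint_singleton.mpr (hBinj.ne hne)) (fun o i he => hBy o i he.symm)
    (fun o => ⟨B o, rfl, hBadj o⟩) (fun i => ?_), star_subset h.root_mem fun o => by
      simpa using hBU o, fun i => Or.inl rfl⟩
  have hi : i = 0 ∨ i = 1 ∨ (i = 2 ∨ i = 3 ∨ i = 4) := by
    revert i
    decide
  rcases hi with rfl | rfl | hi
  · exact Or.inr (Or.inr (Or.inl ⟨none, rfl, v, rfl, h.apex_adj 0⟩))
  · exact Or.inr (Or.inl ⟨none, rfl, v, rfl, h.apex_adj 2⟩)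
  · rcases hlink i hi with h1 | ⟨p, hp, h1, h2⟩ | ⟨p, hp, h1, h2⟩ | ⟨p, hp, p', hp', h1, h2, h3⟩
    · exact Or.inl h1
    · exact Or.inr (Or.inl ⟨some ⟨p, hp⟩, h1, p.1, rfl, h2⟩)
    · exact Or.inr (Or.inr (Or.inl ⟨some ⟨p, hp⟩, h1, p.1, rfl, h2⟩))
    · exact Or.inr (Or.inr (Or.inr ⟨some ⟨p, hp⟩, some ⟨p', hp'⟩, h1, h2, p.1, rfl, p'.1, rfl,
        h3⟩))

/-- Distinct helpers for the missing links among the last three. -/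
theorem HelperSet.model_of_distinct (h : HelperSet G U R y v) (w : Fin 5 → V)
    (hw : ∀ i : Fin 5, i = 2 ∨ i = 3 ∨ i = 4 → ¬ G.Adj (y i) (y (i + 1)) → w i ∈ commonNbr G R y i)
    (hne : ∀ i j : Fin 5, (i = 2 ∨ i = 3 ∨ i = 4) → (j = 2 ∨ j = 3 ∨ j = 4) →
      ¬ G.Adj (y i) (y (i + 1)) → ¬ G.Adj (y j) (y (j + 1)) → w i = w j → i = j) :
    Model G U y := by
  refine h.model_of_labels {p | (p.2 = 2 ∨ p.2 = 3 ∨ p.2 = 4) ∧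
    ¬ G.Adj (y p.2) (y (p.2 + 1)) ∧ p.1 = w p.2} ?_ ?_ ?_ ?_
  · rintro ⟨z, i⟩ ⟨hi, hl, hz⟩
    obtain rfl : z = w i := hz
    exact (hw i hi hl).1
  · rintro ⟨z, i⟩ ⟨hi, hl, hz⟩
    obtain rfl : z = w i := hz
    exact (hw i hi hl).2.1.symm
  · rintro ⟨z, i⟩ ⟨hi, hl, hz⟩ ⟨z', j⟩ ⟨hj, hl', hz'⟩ he
    obtain rfl : z = w i := hz
    obtain rfl : z' = w j := hz'
    have := hne i j hi hj hl hl' he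
    subst this
    rfl
  · intro i hi
    by_cases hl : G.Adj (y i) (y (i + 1))
    · exact Or.inl hl
    · exact Or.inr (Or.inl ⟨(w i, i), ⟨hi, hl, rfl⟩, rfl, (hw i hi hl).2.2.symm⟩)

/-- One helper for the links `2, 3` and another one for link `4`, if it is missing. -/
theorem HelperSet.model_of_double (h : HelperSet G U R y v) {w w' : V}
    (h2 : w ∈ commonNbr G R y 2) (h3 : w ∈ commonNbr G R y 3)
    (h4 : ¬ G.Adj (y 4) (y 0) → w' ∈ commonNbr G R y 4 ∧ w' ≠ w) : Model G U y := by
  refine h.model_of_labels {p | p = (w, 3) ∨ (p = (w', 4) ∧ ¬ G.Adj (y 4) (y 0))} ?_ ?_ ?_ ?_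
  · rintro p (rfl | ⟨rfl, hl⟩)
    · exact h2.1
    · exact (h4 hl).1.1
  · rintro p (rfl | ⟨rfl, hl⟩)
    · exact h3.2.1.symm
    · exact (h4 hl).1.2.1.symm
  · rintro p (rfl | ⟨rfl, hl⟩) p' (rfl | ⟨rfl, hl'⟩) he
    · rfl
    · exact absurd he.symm (h4 hl').2
    · exact absurd he (h4 hl).2
    · rfl
  · rintro i (rfl | rfl | rfl)
    · exact Or.inr (Or.inr (Or.inl ⟨_, Or.inl rfl, rfl, h2.2.1.symm⟩))
    · exact Or.inr (Or.inl ⟨_, Or.inl rfl, rfl, h3.2.2.symm⟩)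
    · by_cases hl : G.Adj (y 4) (y 0)
      · exact Or.inl hl
      · exact Or.inr (Or.inl ⟨_, Or.inr ⟨rfl, hl⟩, rfl, (h4 hl).1.2.2.symm⟩)

/-- One helper for the links `3, 4`, with link `2` present. -/
theorem HelperSet.model_of_double' (h : HelperSet G U R y v) {w : V} (h2 : G.Adj (y 2) (y 3))
    (h3 : w ∈ commonNbr G R y 3) (h4 : w ∈ commonNbr G R y 4) : Model G U y := by
  refine h.model_of_labels {(w, 4)} ?_ ?_ ?_ ?_
  · rintro p rfl
    exact h3.1
  · rintro p rfl
    exact h4.2.1.symm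
  · rintro p rfl p' rfl _
    rfl
  · rintro i (rfl | rfl | rfl)
    · exact Or.inl h2
    · exact Or.inr (Or.inr (Or.inl ⟨_, rfl, rfl, h3.2.1.symm⟩))
    · exact Or.inr (Or.inl ⟨_, rfl, rfl, h4.2.2.symm⟩)

/-- Two adjacent helpers for link `2`, the links `3` and `4` being present. -/
theorem HelperSet.model_of_pair (h : HelperSet G U R y v) {w w' : V} (hw : w ∈ R) (hw' : w' ∈ R)
    (hww : G.Adj w w') (hy : G.Adj (y 2) w) (hy' : G.Adj (y 3) w') (h3 : G.Adj (y 3) (y 4))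
    (h4 : G.Adj (y 4) (y 0)) : Model G U y := by
  refine h.model_of_labels {(w, 2), (w', 3)} ?_ ?_ ?_ ?_
  · rintro p (rfl | rfl)
    · exact hw
    · exact hw'
  · rintro p (rfl | rfl)
    · exact hy.symm
    · exact hy'.symm
  · rintro p (rfl | rfl) p' (rfl | rfl) he
    · rfl
    · exact absurd he hww.ne
    · exact absurd he.symm hww.ne
    · rfl
  · rintro i (rfl | rfl | rfl)
    · exact Or.inr (Or.inr (Or.inr ⟨_, Or.inl rfl, _, Or.inr rfl, rfl, rfl, hww⟩))
    · exact Or.inl h3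
    · exact Or.inl h4

/-- Three last links, each present or with a suitable common helper. -/
theorem HelperSet.model_of_choice (h : HelperSet G U R y v) {w₂ w₃ w₄ : V}
    (h2 : ¬ G.Adj (y 2) (y 3) → w₂ ∈ commonNbr G R y 2)
    (h3 : ¬ G.Adj (y 3) (y 4) → w₃ ∈ commonNbr G R y 3)
    (h4 : ¬ G.Adj (y 4) (y 0) → w₄ ∈ commonNbr G R y 4)
    (h24 : ¬ G.Adj (y 2) (y 3) → ¬ G.Adj (y 4) (y 0) → w₄ ≠ w₂)
    (h34 : ¬ G.Adj (y 3) (y 4) → ¬ G.Adj (y 4) (y 0) → w₄ ≠ w₃) : Model G U y := by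
  by_cases hd : ¬ G.Adj (y 2) (y 3) ∧ ¬ G.Adj (y 3) (y 4) ∧ w₂ = w₃
  · obtain ⟨l2, l3, rfl⟩ := hd
    exact h.model_of_double (h2 l2) (h3 l3) fun l4 => ⟨h4 l4, h24 l2 l4⟩
  · refine h.model_of_distinct ![w₂, w₂, w₂, w₃, w₄] ?_ ?_
    · rintro i (rfl | rfl | rfl)
      · exact h2
      · exact h3
      · exact h4
    · rintro i j (rfl | rfl | rfl) (rfl | rfl | rfl) hi hj he
      · rfl
      · exact absurd ⟨hi, hj, he⟩ hd
      · exact absurd he.symm (h24 hi hj)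
      · exact absurd ⟨hj, hi, he.symm⟩ hd
      · rfl
      · exact absurd he.symm (h34 hi hj)
      · exact absurd he (h24 hj hi)
      · exact absurd he (h34 hj hi)
      · rfl

theorem exists_of_or {p : Prop} {s : Set V} (h : p ∨ s.Nonempty) (v : V) : ∃ w, ¬ p → w ∈ s := by
  rcases h with h | ⟨w, hw⟩
  · exact ⟨v, fun hp => absurd h hp⟩
  · exact ⟨w, fun _ => hw⟩

/-- A helper is fixed for link 4; two choices at each of links 2 and 3 allow it to be avoided. Links
2 and 3 may share a helper, attached to their common root. -/
theorem HelperSet.model_of_strong (h : HelperSet G U R y v)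
    (h2 : G.Adj (y 2) (y 3) ∨ (commonNbr G R y 2).Nontrivial)
    (h3 : G.Adj (y 3) (y 4) ∨ (commonNbr G R y 3).Nontrivial)
    (h4 : G.Adj (y 4) (y 0) ∨ (commonNbr G R y 4).Nontrivial) : Model G U y := by
  obtain ⟨w₄, hw₄⟩ := exists_of_or (h4.imp_right Set.Nontrivial.nonempty) v
  have key : ∀ s : Set V, s.Nontrivial → (s \ {w₄}).Nonempty := fun s hs => by
    obtain ⟨z, hz, hne⟩ := hs.exists_ne w₄
    exact ⟨z, hz, hne⟩
  obtain ⟨w₂, hw₂⟩ := exists_of_or (h2.imp_right (key _)) v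
  obtain ⟨w₃, hw₃⟩ := exists_of_or (h3.imp_right (key _)) v
  exact h.model_of_choice (fun l => (hw₂ l).1) (fun l => (hw₃ l).1) hw₄
    (fun l _ he => (hw₂ l).2 he.symm) (fun l _ he => (hw₃ l).2 he.symm)

theorem HelperSet.model_of_weak (h : HelperSet G U R y v)
    (h2 : G.Adj (y 2) (y 3) ∨ (commonNbr G R y 2).Nonempty)
    (h3 : G.Adj (y 3) (y 4) ∨ (commonNbr G R y 3).Nonempty)
    (h4 : G.Adj (y 4) (y 0)) : Model G U y := by
  obtain ⟨w₂, hw₂⟩ := exists_of_or h2 v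
  obtain ⟨w₃, hw₃⟩ := exists_of_or h3 v
  exact h.model_of_choice (w₄ := v) hw₂ hw₃ (fun l => absurd h4 l) (fun _ l => absurd h4 l)
    (fun _ l => absurd h4 l)

theorem HelperSet.model_of_weak' (h : HelperSet G U R y v) (h2 : G.Adj (y 2) (y 3))
    (h3 : G.Adj (y 3) (y 4) ∨ (commonNbr G R y 3).Nonempty)
    (h4 : G.Adj (y 4) (y 0) ∨ (commonNbr G R y 4).Nonempty) : Model G U y := by
  obtain ⟨w₃, hw₃⟩ := exists_of_or h3 v
  obtain ⟨w₄, hw₄⟩ := exists_of_or h4 v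
  by_cases hd : ¬ G.Adj (y 3) (y 4) ∧ ¬ G.Adj (y 4) (y 0) ∧ w₄ = w₃
  · obtain ⟨l3, l4, rfl⟩ := hd
    exact h.model_of_double' h2 (hw₃ l3) (hw₄ l4)
  · exact h.model_of_choice (w₂ := v) (fun l => absurd h2 l) hw₃ hw₄ (fun l => absurd h2 l)
      (fun l3 l4 he => hd ⟨l3, l4, he⟩)

end DenseModels

/-! ### The finite analysis of link patterns -/

section LinkPatterns

/-- A link that is missing although its ends are not both in the exceptional set `q`. -/
def honest (l q : Fin 5 → Bool) (i : Fin 5) : Bool := !l i && !(q i && q (i + 1))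

/-- The number of honest missing links at the ends of link `i`. -/
def honestCount (l q : Fin 5 → Bool) (i : Fin 5) : ℕ :=
  (honest l q (i + 4)).toNat + 2 * (honest l q i).toNat + (honest l q (i + 1)).toNat

/-- The link patterns for which a model is found around link `i`. -/
def goodAt (l q : Fin 5 → Bool) (r : ℕ) (i : Fin 5) : Bool :=
  let strong := fun j => l j || Nat.ble r (honestCount l q j)
  let weak := fun j => l j || Nat.ble r (1 + honestCount l q j)
  (strong (2 + i) && strong (3 + i) && strong (4 + i)) ||
  (weak (2 + i) && weak (3 + i) && l (4 + i)) ||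
  (l (2 + i) && weak (3 + i) && weak (4 + i)) ||
  (Nat.beq r 4 && l (1 + i) && l (3 + i) && l (4 + i) && honest l q i && honest l q (2 + i))

/-- A finite check over present links l, roots q outside W, and the number r ≤ 4 of further
neighbours of the centre. The hypothesis on q reflects the degree bounds of the chosen vertex. -/
theorem exists_goodAt : ∀ (l q : Fin 5 → Bool) (r : Fin 5), r ≠ 0 →
    ((∀ i, q i = false) ∨ r.val + ∑ i, (q i).toNat ≤ 5) → ∃ i, goodAt l q r.val i = true := by
  decide +kernel

end LinkPatterns
end RootedCycle
namespace RootedCycle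

/-! ### Dense neighbourhoods contain every five-root cycle -/

section DenseNeighbourhood

variable {V : Type*} [Fintype V] {G : SimpleGraph V} {W : Finset V} {y : Fin 5 → V} {v : V}

/-- Five roots in the neighbourhood of `v`, the other neighbours lying in `W`, such that every
neighbour of `v` has many neighbours in the neighbourhood. -/
structure DenseNbr (G : SimpleGraph V) (W : Finset V) (v : V) (y : Fin 5 → V) : Prop where
  inj : Function.Injective y
  adj : ∀ i, G.Adj v (y i)
  mem_of_adj : ∀ w, G.Adj v w → (∀ i, w ≠ y i) → w ∈ W
  lost : ∀ u, G.Adj v u → 5 ≤ (lostNbr G W u v).card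

open Classical in
/-- The neighbours of `v` that are not roots. -/
noncomputable def freeNbr (G : SimpleGraph V) (v : V) (y : Fin 5 → V) : Finset V :=
  outNbr G ∅ v \ Finset.univ.image y

theorem mem_freeNbr {w : V} : w ∈ freeNbr G v y ↔ G.Adj v w ∧ ∀ i, w ≠ y i := by
  simp only [freeNbr, Finset.mem_sdiff, mem_outNbr, Finset.notMem_empty, not_false_eq_true,
    and_true, Finset.mem_image, Finset.mem_univ, true_and, not_exists]
  exact and_congr_right fun _ => forall_congr' fun _ => ⟨Ne.symm, Ne.symm⟩

theorem DenseNbr.card (h : DenseNbr G W v y) : (freeNbr G v y).card + 5 = (outNbr G ∅ v).card := by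
  classical
  have hsub : Finset.univ.image y ⊆ outNbr G ∅ v := by
    intro w hw
    obtain ⟨i, -, rfl⟩ := Finset.mem_image.mp hw
    exact mem_outNbr.mpr ⟨h.adj i, Finset.notMem_empty _⟩
  have := Finset.card_sdiff_add_card_eq_card hsub
  rwa [Finset.card_image_of_injective _ h.inj, Finset.card_univ, Fintype.card_fin] at this

open Classical in
/-- The neighbours of `v` honestly not adjacent to `u`. -/
noncomputable def missNbr (G : SimpleGraph V) (W : Finset V) (u v : V) : Finset V :=
  (outNbr G ∅ v).filter fun w => w ≠ u ∧ ¬ (G.Adj u w ∨ (u ∉ W ∧ w ∉ W))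

theorem mem_missNbr {u w : V} : w ∈ missNbr G W u v ↔
    G.Adj v w ∧ w ≠ u ∧ ¬ (G.Adj u w ∨ (u ∉ W ∧ w ∉ W)) := by
  simp [missNbr, mem_outNbr]

/-- Of the r + 5 neighbours of v, u itself and at least five lost ones are not honestly missed,
leaving at most r − 1. -/
theorem DenseNbr.card_missNbr (h : DenseNbr G W v y) {u : V} (hu : G.Adj v u) :
    (missNbr G W u v).card + 1 ≤ (freeNbr G v y).card := by
  classical
  have hsub : insert u (lostNbr G W u v ∪ missNbr G W u v) ⊆ outNbr G ∅ v := by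
    intro w hw
    rw [mem_outNbr]
    refine ⟨?_, Finset.notMem_empty _⟩
    rcases Finset.mem_insert.mp hw with rfl | hw
    · exact hu
    · rcases Finset.mem_union.mp hw with hw | hw
      · exact (mem_lostNbr.mp hw).1
      · exact (mem_missNbr.mp hw).1
  have h1 := Finset.card_le_card hsub
  rw [Finset.card_insert_of_notMem, Finset.card_union_of_disjoint] at h1
  · have := h.lost u hu
    have := h.card
    omega
  · exact Finset.disjoint_left.mpr fun w hw hw' =>
      (mem_missNbr.mp hw').2.2 (mem_lostNbr.mp hw).2.2
  · intro hcon
    rcases Finset.mem_union.mp hcon with hw | hw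
    · exact (mem_lostNbr.mp hw).2.1 rfl
    · exact (mem_missNbr.mp hw).2.1 rfl

theorem DenseNbr.rotate (h : DenseNbr G W v y) (c : Fin 5) :
    DenseNbr G W v (fun i => y (i + c)) :=
  ⟨fun _ _ hpq => add_right_cancel (h.inj hpq), fun _ => h.adj _, fun w hw hne =>
    h.mem_of_adj w hw fun i => by simpa using hne (i - c), h.lost⟩

theorem freeNbr_rotate (c : Fin 5) : freeNbr G v (fun i => y (i + c)) = freeNbr G v y := by
  ext w
  rw [mem_freeNbr, mem_freeNbr]
  refine and_congr_right fun _ => ⟨fun h i => by simpa using h (i - c), fun h i => h _⟩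

theorem DenseNbr.helperSet (h : DenseNbr G W v y) :
    HelperSet G (insert v {w | G.Adj v w}) ↑(freeNbr G v y) y v :=
  ⟨h.inj, fun i => Or.inr (h.adj i), Or.inl rfl, h.adj, fun _ hw => Or.inr (mem_freeNbr.mp hw).1,
    fun i hi => (mem_freeNbr.mp hi).2 i rfl, fun hv => (mem_freeNbr.mp hv).1.ne rfl⟩

open Classical in
/-- The free neighbours of `v` not adjacent to the `j`-th root. -/
noncomputable def freeMiss (G : SimpleGraph V) (v : V) (y : Fin 5 → V) (j : Fin 5) : Finset V :=
  (freeNbr G v y).filter fun w => ¬ G.Adj (y j) w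

-- The honest missing links at root j, towards j + 1 and towards j + 4 = j − 1, use up part of its
-- allowance of r − 1 missed neighbours.
open Classical in
theorem DenseNbr.card_freeMiss (h : DenseNbr G W v y) (j : Fin 5) :
    (freeMiss G v y j).card + (honest (fun i => decide (G.Adj (y i) (y (i + 1))))
      (fun i => decide (y i ∉ W)) j).toNat + (honest (fun i => decide (G.Adj (y i) (y (i + 1))))
      (fun i => decide (y i ∉ W)) (j + 4)).toNat + 1 ≤ (freeNbr G v y).card := by
  set l : Fin 5 → Bool := fun i => decide (G.Adj (y i) (y (i + 1))) with hl
  set q : Fin 5 → Bool := fun i => decide (y i ∉ W) with hq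
  have hhon : ∀ i, honest l q i = true ↔
      ¬ G.Adj (y i) (y (i + 1)) ∧ ¬ (y i ∉ W ∧ y (i + 1) ∉ W) := by
    intro i
    simp only [honest, hl, hq, Bool.and_eq_true, Bool.not_eq_true', decide_eq_false_iff_not,
      Bool.and_eq_false_iff, not_and_or]
  have hj : j + 4 + 1 = j := by
    revert j
    decide
  have hne1 : j + 1 ≠ j := by
    revert j
    decide
  have hne4 : j + 4 ≠ j := by
    revert j
    decide
  have hne14 : j + 1 ≠ j + 4 := by
    revert j
    decide
  let A₁ : Finset V := if honest l q j = true then {y (j + 1)} else ∅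
  let A₄ : Finset V := if honest l q (j + 4) = true then {y (j + 4)} else ∅
  have hA₁ : A₁.card = (honest l q j).toNat := by
    cases hh : honest l q j <;> simp [A₁, hh]
  have hA₄ : A₄.card = (honest l q (j + 4)).toNat := by
    cases hh : honest l q (j + 4) <;> simp [A₄, hh]
  have hA₁' : ∀ w ∈ A₁, w = y (j + 1) ∧ honest l q j = true := by
    intro w hw
    by_cases hh : honest l q j = true
    · simp only [A₁, if_pos hh, Finset.mem_singleton] at hw
      exact ⟨hw, hh⟩
    · simp only [A₁, if_neg hh, Finset.notMem_empty] at hw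
  have hA₄' : ∀ w ∈ A₄, w = y (j + 4) ∧ honest l q (j + 4) = true := by
    intro w hw
    by_cases hh : honest l q (j + 4) = true
    · simp only [A₄, if_pos hh, Finset.mem_singleton] at hw
      exact ⟨hw, hh⟩
    · simp only [A₄, if_neg hh, Finset.notMem_empty] at hw
  have hsub : freeMiss G v y j ∪ A₁ ∪ A₄ ⊆ missNbr G W (y j) v := by
    intro w hw
    rcases Finset.mem_union.mp hw with hw | hw
    · rcases Finset.mem_union.mp hw with hw | hw
      · obtain ⟨hwR, hwj⟩ := Finset.mem_filter.mp hw
        have hwR' := mem_freeNbr.mp hwR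
        exact mem_missNbr.mpr ⟨hwR'.1, hwR'.2 j, fun hcon => hcon.elim hwj fun h' =>
          h'.2 (h.mem_of_adj w hwR'.1 hwR'.2)⟩
      · obtain ⟨rfl, hh⟩ := hA₁' w hw
        obtain ⟨h1, h2⟩ := (hhon j).mp hh
        exact mem_missNbr.mpr ⟨h.adj _, h.inj.ne hne1, fun hcon => hcon.elim h1 h2⟩
    · obtain ⟨rfl, hh⟩ := hA₄' w hw
      obtain ⟨h1, h2⟩ := (hhon _).mp hh
      rw [hj] at h1 h2
      exact mem_missNbr.mpr ⟨h.adj _, h.inj.ne hne4, fun hcon =>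
        hcon.elim (fun h => h1 h.symm) fun h => h2 h.symm⟩
  have hfree : ∀ i, y i ∉ freeMiss G v y j := fun i hi =>
    (mem_freeNbr.mp (Finset.mem_filter.mp hi).1).2 i rfl
  have h1 := Finset.card_le_card hsub
  rw [Finset.card_union_of_disjoint, Finset.card_union_of_disjoint, hA₁, hA₄] at h1
  · have := h.card_missNbr (h.adj j)
    omega
  · refine Finset.disjoint_left.mpr fun w hw hw' => ?_
    obtain ⟨rfl, -⟩ := hA₁' w hw'
    exact hfree _ hw
  · refine Finset.disjoint_left.mpr fun w hw hw' => ?_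
    obtain ⟨rfl, -⟩ := hA₄' w hw'
    rcases Finset.mem_union.mp hw with hw | hw
    · exact hfree _ hw
    · exact hne14 (h.inj (hA₁' _ hw).1).symm

-- The allowances of both ends are subtracted from r. Link i itself is charged at both ends, which
-- explains its weight 2 in `honestCount`.
open Classical in
theorem DenseNbr.le_ncard_commonNbr (h : DenseNbr G W v y) (i : Fin 5) :
    2 + honestCount (fun i => decide (G.Adj (y i) (y (i + 1)))) (fun i => decide (y i ∉ W)) i ≤
      (commonNbr G ↑(freeNbr G v y) y i).ncard + (freeNbr G v y).card := by
  have h1 := h.card_freeMiss i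
  have h2 := h.card_freeMiss (i + 1)
  have hi : ∀ i : Fin 5, i + 1 + 4 = i := by decide
  rw [hi] at h2
  have h3 : (freeNbr G v y).card ≤ (commonNbr G ↑(freeNbr G v y) y i).ncard +
      (freeMiss G v y i).card + (freeMiss G v y (i + 1)).card := by
    rw [← Set.ncard_coe_finset, ← Set.ncard_coe_finset (freeMiss G v y i),
      ← Set.ncard_coe_finset (freeMiss G v y (i + 1))]
    refine le_trans (Set.ncard_le_ncard ?_ (Set.toFinite _))
      ((Set.ncard_union_le _ _).trans (Nat.add_le_add_right (Set.ncard_union_le _ _) _))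
    intro w hw
    by_cases ha : G.Adj (y i) w
    · by_cases hb : G.Adj (y (i + 1)) w
      · exact Or.inl (Or.inl ⟨hw, ha, hb⟩)
      · exact Or.inr (Finset.mem_coe.mpr (Finset.mem_filter.mpr ⟨hw, hb⟩))
    · exact Or.inl (Or.inr (Finset.mem_coe.mpr (Finset.mem_filter.mpr ⟨hw, ha⟩)))
  unfold honestCount
  omega

/-- Two isolated missing links, with four free neighbours. -/
theorem DenseNbr.model_of_two_missing (h : DenseNbr G W v y) (hr : (freeNbr G v y).card = 4)
    (h3 : G.Adj (y 3) (y 4)) (h4 : G.Adj (y 4) (y 0))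
    (hm2 : (freeMiss G v y 2).card ≤ 2) (hm3 : (freeMiss G v y 3).card ≤ 2) :
    Model G (insert v {w | G.Adj v w}) y := by
  classical
  by_cases hc2 : (commonNbr G ↑(freeNbr G v y) y 2).Nonempty
  · exact h.helperSet.model_of_weak (Or.inr hc2) (Or.inl h3) h4
  by_cases hc0 : (commonNbr G ↑(freeNbr G v y) y 0).Nonempty
  · exact model_five_of_rotate 1
      ((h.helperSet.rotate 1).model_of_weak' h3 (Or.inl h4) (Or.inr hc0))
  -- Without common helpers for links 2 and 0, roots 2 and 3 still have at least two free neighbours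
  -- each; an edge between the two sides would be the pair needed.
  have hn : ∀ j, (freeMiss G v y j).card ≤ 2 →
      2 ≤ ((freeNbr G v y).filter fun w => G.Adj (y j) w).card := by
    intro j hj
    have := Finset.card_filter_add_card_filter_not (s := freeNbr G v y) (fun w => G.Adj (y j) w)
    have h' : ((freeNbr G v y).filter fun w => ¬ G.Adj (y j) w).card ≤ 2 := hj
    omega
  have hn2 := hn 2 hm2
  have hn3 := hn 3 hm3
  obtain ⟨w, hw⟩ := Finset.card_pos.mp (lt_of_lt_of_le (by norm_num) hn2)
  obtain ⟨hwR, hw2⟩ := Finset.mem_filter.mp hw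
  have hw3 : ¬ G.Adj (y 3) w := fun hcon => hc2 ⟨w, hwR, hw2, hcon⟩
  obtain ⟨hvw, hwy⟩ := mem_freeNbr.mp hwR
  have hwW := h.mem_of_adj w hvw hwy
  by_cases hp : ∃ w' ∈ freeNbr G v y, G.Adj (y 3) w' ∧ G.Adj w w'
  · obtain ⟨w', hw'R, hw'3, hww'⟩ := hp
    exact h.helperSet.model_of_pair hwR hw'R hww' hw2 hw'3 h3 h4
  push Not at hp
  -- Otherwise w misses root 3, another root, and at least two free neighbours of root 3: four in
  -- total, while the allowance is r − 1 = 3.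
  exfalso
  obtain ⟨j, hj, hwj⟩ : ∃ j : Fin 5, j ≠ 3 ∧ ¬ G.Adj (y j) w := by
    by_contra hcon
    push Not at hcon
    exact hc0 ⟨w, hwR, hcon 0 (by decide), hcon 1 (by decide)⟩
  have hsub : insert (y 3) (insert (y j) ((freeNbr G v y).filter fun z => G.Adj (y 3) z)) ⊆
      missNbr G W w v := by
    intro z hz
    rcases Finset.mem_insert.mp hz with rfl | hz
    · exact mem_missNbr.mpr ⟨h.adj 3, (hwy 3).symm, fun hcon =>
        hcon.elim (fun h => hw3 h.symm) fun h => h.1 hwW⟩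
    rcases Finset.mem_insert.mp hz with rfl | hz
    · exact mem_missNbr.mpr ⟨h.adj j, (hwy j).symm, fun hcon =>
        hcon.elim (fun h => hwj h.symm) fun h => h.1 hwW⟩
    · obtain ⟨hzR, hz3⟩ := Finset.mem_filter.mp hz
      refine mem_missNbr.mpr ⟨(mem_freeNbr.mp hzR).1, ?_, fun hcon =>
        hcon.elim (fun h => hp z hzR hz3 h) fun h => h.1 hwW⟩
      rintro rfl
      exact hw3 hz3
  have h5 := Finset.card_le_card hsub
  have hfree : ∀ i, y i ∉ (freeNbr G v y).filter fun z => G.Adj (y 3) z := fun i hi =>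
    (mem_freeNbr.mp (Finset.mem_filter.mp hi).1).2 i rfl
  rw [Finset.card_insert_of_notMem, Finset.card_insert_of_notMem (hfree j)] at h5
  · have := h.card_missNbr hvw
    omega
  · rw [Finset.mem_insert, not_or]
    exact ⟨h.inj.ne hj.symm, hfree 3⟩

open Classical in
theorem DenseNbr.model (h : DenseNbr G W v y) (hr : (freeNbr G v y).card ≤ 4)
    (hq : (∀ i, y i ∈ W) ∨
      (freeNbr G v y).card + (Finset.univ.filter fun i => y i ∉ W).card ≤ 5) :
    Model G (insert v {w | G.Adj v w}) y := by
  set l : Fin 5 → Bool := fun i => decide (G.Adj (y i) (y (i + 1))) with hl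
  set q : Fin 5 → Bool := fun i => decide (y i ∉ W) with hqd
  set r := (freeNbr G v y).card with hrd
  have hrpos : r ≠ 0 := by
    have := h.card_missNbr (h.adj 0)
    omega
  obtain ⟨i, hi⟩ := exists_goodAt l q ⟨r, by omega⟩ (fun h0 => hrpos (congrArg Fin.val h0)) (by
    rcases hq with hq | hq
    · exact Or.inl fun i => by simpa [hqd] using hq i
    · right
      have : ∑ i, (q i).toNat = (Finset.univ.filter fun i => y i ∉ W).card := by
        rw [Finset.card_filter]
        refine Finset.sum_congr rfl fun i _ => ?_
        by_cases hi : y i ∈ W <;> simp [hqd, hi]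
      rw [this]
      exact hq)
  have hL : ∀ j : Fin 5, l (j + i) = true → G.Adj (y (j + i)) (y (j + 1 + i)) := by
    intro j hj
    rw [add_right_comm]
    exact of_decide_eq_true hj
  have hcount : ∀ j : Fin 5, 2 + honestCount l q (j + i) ≤
      (commonNbr G ↑(freeNbr G v fun p => y (p + i)) (fun p => y (p + i)) j).ncard + r := by
    intro j
    rw [freeNbr_rotate]
    have h1 := h.le_ncard_commonNbr (j + i)
    have h2 : commonNbr G ↑(freeNbr G v y) (fun p => y (p + i)) j =
        commonNbr G ↑(freeNbr G v y) y (j + i) := by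
      simp only [commonNbr, add_right_comm]
    rw [h2]
    exact h1
  have hstrong : ∀ j : Fin 5, (l (j + i) || Nat.ble r (honestCount l q (j + i))) = true →
      G.Adj (y (j + i)) (y (j + 1 + i)) ∨
      (commonNbr G ↑(freeNbr G v fun p => y (p + i)) (fun p => y (p + i)) j).Nontrivial := by
    intro j hj
    rcases (Bool.or_eq_true _ _).mp hj with hj | hj
    · exact Or.inl (hL j hj)
    · right
      have h1 := Nat.le_of_ble_eq_true hj
      have h2 := hcount j
      exact Set.one_lt_ncard_iff_nontrivial.mp (by omega)
  have hweak : ∀ j : Fin 5, (l (j + i) || Nat.ble r (1 + honestCount l q (j + i))) = true →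
      G.Adj (y (j + i)) (y (j + 1 + i)) ∨
      (commonNbr G ↑(freeNbr G v fun p => y (p + i)) (fun p => y (p + i)) j).Nonempty := by
    intro j hj
    rcases (Bool.or_eq_true _ _).mp hj with hj | hj
    · exact Or.inl (hL j hj)
    · right
      have h1 := Nat.le_of_ble_eq_true hj
      have h2 := hcount j
      exact (Set.ncard_pos (Set.toFinite _)).mp (by omega)
  have hH := (h.rotate i).helperSet
  refine model_five_of_rotate i ?_
  simp only [goodAt, Bool.or_eq_true, Bool.and_eq_true] at hi
  simp only [Bool.or_eq_true] at hstrong hweak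
  rcases hi with ((⟨⟨h2, h3⟩, h4⟩ | ⟨⟨h2, h3⟩, h4⟩) | ⟨⟨h2, h3⟩, h4⟩) |
    ⟨⟨⟨⟨⟨h5, h1⟩, h3⟩, h4⟩, h0⟩, h2⟩
  · exact hH.model_of_strong (hstrong 2 h2) (hstrong 3 h3) (hstrong 4 h4)
  · exact hH.model_of_weak (hweak 2 h2) (hweak 3 h3) (hL 4 h4)
  · exact hH.model_of_weak' (hL 2 h2) (hweak 3 h3) (hweak 4 h4)
  · have hr4 : r = 4 := Nat.eq_of_beq_eq_true h5
    have h32 : ∀ i : Fin 5, 3 + i + 4 = 2 + i := by decide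
    have hm2 : (freeMiss G v y (2 + i)).card + (honest l q (2 + i)).toNat +
      (honest l q (2 + i + 4)).toNat + 1 ≤ r := h.card_freeMiss (2 + i)
    have hm3 : (freeMiss G v y (3 + i)).card + (honest l q (3 + i)).toNat +
      (honest l q (3 + i + 4)).toNat + 1 ≤ r := h.card_freeMiss (3 + i)
    rw [h32] at hm3
    have hone : (honest l q (2 + i)).toNat = 1 := by rw [h2]; rfl
    refine (h.rotate i).model_of_two_missing (by rw [freeNbr_rotate]; exact hr4) (hL 3 h3) (hL 4 h4) ?_ ?_
    · have : freeMiss G v (fun p => y (p + i)) 2 = freeMiss G v y (2 + i) := by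
        simp only [freeMiss, freeNbr_rotate]
      rw [this]
      omega
    · have : freeMiss G v (fun p => y (p + i)) 3 = freeMiss G v y (3 + i) := by
        simp only [freeMiss, freeNbr_rotate]
      rw [this]
      omega

end DenseNeighbourhood
end RootedCycle
namespace RootedCycle

/-! ### Extending a partial choice of roots to five -/

section Extension

theorem exists_injective_extension {V : Type*} {j : ℕ} (hj : j ≤ 5) {N : Finset V}
    (hN : 5 ≤ N.card) {y : Fin j → V} (hy : Function.Injective y) (hyN : ∀ i, y i ∈ N) :
    ∃ z : Fin 5 → V, Function.Injective z ∧ (∀ i, z i ∈ N) ∧ ∀ i, z (Fin.castLE hj i) = y i := by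
  classical
  have himg : Finset.univ.image y ⊆ N := by
    intro w hw
    obtain ⟨i, -, rfl⟩ := Finset.mem_image.mp hw
    exact hyN i
  have hcard : (Finset.univ.image y).card = j := by
    rw [Finset.card_image_of_injective _ hy, Finset.card_univ, Fintype.card_fin]
  obtain ⟨t, hyt, htN, ht⟩ := Finset.exists_subsuperset_card_eq himg (n := 5) (by omega) hN
  obtain ⟨d, -⟩ : N.Nonempty := Finset.card_pos.mp (by omega)
  let f : Fin 5 → V := fun i => if h : i.val < j then y ⟨i.val, h⟩ else d
  have hf : ∀ i : Fin 5, ∀ h : i.val < j, f i = y ⟨i.val, h⟩ := fun i h => dif_pos h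
  obtain ⟨g, hg⟩ := Finset.exists_equiv_extend_of_card_eq (t := t)
    (s := Finset.univ.filter fun i : Fin 5 => i.val < j) (f := f)
    (by rw [Fintype.card_fin, ht]) (by
      intro w hw
      obtain ⟨i, hi, rfl⟩ := Finset.mem_image.mp hw
      have hi' : i.val < j := (Finset.mem_filter.mp hi).2
      rw [hf i hi']
      exact hyt (Finset.mem_image_of_mem _ (Finset.mem_univ _))) (by
      intro i hi i' hi' h
      have hi1 : i.val < j := (Finset.mem_filter.mp hi).2
      have hi2 : i'.val < j := (Finset.mem_filter.mp hi').2
      rw [hf i hi1, hf i' hi2] at h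
      exact Fin.ext (Fin.mk.inj_iff.mp (hy h)))
  refine ⟨fun i => g i, fun i i' h => g.injective (Subtype.ext h), fun i => htN (g i).2,
    fun i => ?_⟩
  have hi : (Fin.castLE hj i).val < j := i.2
  change ((g (Fin.castLE hj i) : t) : V) = y i
  rw [hg _ (Finset.mem_filter.mpr ⟨Finset.mem_univ _, hi⟩), hf _ hi]
  rfl

end Extension

/-! ### A vertex of small degree yields a rigid set -/

section SmallDegree

variable {V : Type*} [Fintype V] {G : SimpleGraph V} {W S : Finset V} {k : ℕ} {x : Fin k → V}
  {v : V}

/-- A neighbour and its five lost neighbours give six; an isolated vertex is excluded because it is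
rigid over the empty boundary. -/
theorem MinCex.six_le_degree (h : MinCex G W S x) (hv : v ∈ W) : 6 ≤ (outNbr G ∅ v).card := by
  classical
  by_cases hne : (outNbr G ∅ v).Nonempty
  · obtain ⟨u, hu⟩ := hne
    have huv := (mem_outNbr.mp hu).1
    have h5 := h.five_le_lostNbr hv huv.symm
    have hsub : insert u (lostNbr G W u v) ⊆ outNbr G ∅ v := by
      refine Finset.insert_subset hu fun w hw => ?_
      exact mem_outNbr.mpr ⟨(mem_lostNbr.mp hw).1, Finset.notMem_empty _⟩
    have := Finset.card_le_card hsub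
    rw [Finset.card_insert_of_notMem fun hcon => (mem_lostNbr.mp hcon).2.1 rfl] at this
    omega
  · rw [Finset.not_nonempty_iff_eq_empty] at hne
    refine absurd ⟨by simpa using hv, Finset.singleton_nonempty v, bdry_subset_iff.mpr ?_,
      Finset.disjoint_empty_right _, Finset.empty_subset _, by simp, ?_⟩
      (h.not_rigidSep {v} ∅)
    · intro u hu w huw
      rw [Finset.mem_singleton] at hu
      subst hu
      have : w ∈ outNbr G ∅ u := mem_outNbr.mpr ⟨huw, Finset.notMem_empty _⟩
      rw [hne] at this
      exact absurd this (Finset.notMem_empty _)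
    · exact fun s _ _ => model_of_fin_zero G _ s

/-- Some vertex has small degree. -/
theorem MinCex.exists_small_degree (h : MinCex G W S x) (hk : 3 ≤ k) :
    ∃ v ∈ W, ((outNbr G W v).card = 0 ∧ (outNbr G ∅ v).card ≤ 9) ∨
      (1 ≤ (outNbr G W v).card ∧ (outNbr G ∅ v).card + (outNbr G W v).card ≤ 10) := by
  classical
  by_contra hcon
  push Not at hcon
  have hrho := h.rho_eq
  have hS := h.card
  have hk5 := h.le_five
  set B := W.filter fun v => 1 ≤ (outNbr G W v).card with hB
  set D := W.filter fun v => ¬ 1 ≤ (outNbr G W v).card with hD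
  have hBD : B.card + D.card = W.card := Finset.card_filter_add_card_filter_not _
  have hB2 : B.card ≤ 2 := by
    have h1 := two_mul_rho G W
    -- A vertex with a neighbour outside W contributes at least 11 and any other at least 10, while
    -- the sum is 2ρ(W) = 10|W| + 2.
    have h2 : 10 * W.card + B.card ≤
        ∑ v ∈ W, ((outNbr G ∅ v).card + (outNbr G W v).card) := by
      rw [hB, Finset.card_filter, mul_comm, ← smul_eq_mul, ← Finset.sum_const,
        ← Finset.sum_add_distrib]
      refine Finset.sum_le_sum fun v hv => ?_
      obtain ⟨h3, h4⟩ := hcon v hv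
      split_ifs with h5
      · have := h4 h5
        omega
      · have := h3 (by omega)
        omega
    omega
  have hDW : D ⊆ W := Finset.filter_subset _ _
  have hbD : bdry G D ⊆ B := by
    refine bdry_subset_iff.mpr fun u hu w huw => ?_
    obtain ⟨huW, hu0⟩ := Finset.mem_filter.mp hu
    have hwW : w ∈ W := by
      by_contra hw
      exact hu0 (Finset.card_pos.mpr ⟨w, mem_outNbr.mpr ⟨huw, hw⟩⟩)
    by_cases hw : 1 ≤ (outNbr G W w).card
    · exact Or.inr (Finset.mem_filter.mpr ⟨hwW, hw⟩)
    · exact Or.inl (Finset.mem_filter.mpr ⟨hwW, hw⟩)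
  -- The only use of three roots: the boundary of D lies in B, of order at most 2 < |S|.
  have hrhoD := h.mass.sep D hDW (lt_of_le_of_lt (Finset.card_le_card hbD) (by omega))
  have hmem : ∀ w ∈ W, w ∉ B → w ∈ D := by
    intro w hw hwB
    exact Finset.mem_filter.mpr ⟨hw, fun h1 => hwB (Finset.mem_filter.mpr ⟨hw, h1⟩)⟩
  have hBW : B ⊆ W := Finset.filter_subset _ _
  have hBnD : ∀ w ∈ B, w ∉ D := fun w hw hw' =>
    (Finset.mem_filter.mp hw').2 (Finset.mem_filter.mp hw).2
  obtain hB0 | hB1 | hB2' : B.card = 0 ∨ B.card = 1 ∨ B.card = 2 := by omega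
  · rw [Finset.card_eq_zero] at hB0
    have : W = D := Finset.Subset.antisymm (fun w hw => hmem w hw (by simp [hB0])) hDW
    rw [← this] at hrhoD
    omega
  · obtain ⟨a, ha⟩ := Finset.card_eq_one.mp hB1
    have haB : a ∈ B := by simp [ha]
    have hW : W = insert a D := by
      refine Finset.Subset.antisymm (fun w hw => ?_) (Finset.insert_subset (hBW haB) hDW)
      by_cases hwB : w ∈ B
      · rw [ha, Finset.mem_singleton] at hwB
        exact hwB ▸ Finset.mem_insert_self _ _
      · exact Finset.mem_insert_of_mem (hmem w hw hwB)
    have h1 := rho_insert G (hBnD a haB)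
    rw [← hW] at h1
    have h2 : outNbr G D a ⊆ S := by
      intro w hw
      obtain ⟨haw, hwD⟩ := mem_outNbr.mp hw
      refine (h.mass.adj (hBW haB) haw).resolve_left fun hwW => ?_
      rw [hW] at hwW
      exact (Finset.mem_insert.mp hwW).elim (fun he => haw.ne he.symm) hwD
    have h3 := Finset.card_le_card h2
    omega
  · obtain ⟨a, b, hab, hBab⟩ := Finset.card_eq_two.mp hB2'
    have haB : a ∈ B := by simp [hBab]
    have hbB : b ∈ B := by simp [hBab]
    have hW : W = insert a (insert b D) := by
      refine Finset.Subset.antisymm (fun w hw => ?_)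
        (Finset.insert_subset (hBW haB) (Finset.insert_subset (hBW hbB) hDW))
      by_cases hwB : w ∈ B
      · rw [hBab, Finset.mem_insert, Finset.mem_singleton] at hwB
        rcases hwB with rfl | rfl
        · exact Finset.mem_insert_self _ _
        · exact Finset.mem_insert_of_mem (Finset.mem_insert_self _ _)
      · exact Finset.mem_insert_of_mem (Finset.mem_insert_of_mem (hmem w hw hwB))
    have hanot : a ∉ insert b D := by
      rw [Finset.mem_insert, not_or]
      exact ⟨hab, hBnD a haB⟩
    have h1 := rho_insert G hanot
    rw [← hW, rho_insert G (hBnD b hbB)] at h1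
    have ha2 : outNbr G (insert b D) a ⊆ S := by
      intro w hw
      obtain ⟨haw, hwD⟩ := mem_outNbr.mp hw
      refine (h.mass.adj (hBW haB) haw).resolve_left fun hwW => ?_
      rw [hW] at hwW
      exact (Finset.mem_insert.mp hwW).elim (fun he => haw.ne he.symm) hwD
    have hb2 : outNbr G D b ⊆ insert a S := by
      intro w hw
      obtain ⟨hbw, hwD⟩ := mem_outNbr.mp hw
      rcases h.mass.adj (hBW hbB) hbw with hwW | hwS
      · rw [hW] at hwW
        rcases Finset.mem_insert.mp hwW with rfl | hwW
        · exact Finset.mem_insert_self _ _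
        · exact absurd ((Finset.mem_insert.mp hwW).resolve_left hbw.ne') hwD
      · exact Finset.mem_insert_of_mem hwS
    have ha3 := Finset.card_le_card ha2
    have hb3 := Finset.card_le_card hb2
    have hins := Finset.card_insert_le a S
    -- Since ρ(W) = 5|D| + 11, the bounds |S| and |S| + 1 for a and b must be attained with |S| = 5,
    -- which makes a and b apexes.
    have ha4 := Finset.eq_of_subset_of_card_le ha2 (by omega)
    have hb4 := Finset.eq_of_subset_of_card_le hb2 (by omega)
    refine h.no_apex ⟨by omega, a, hBW haB, b, hBW hbB, hab, fun i => ⟨?_, ?_⟩⟩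
    · have hi := h.mem i
      rw [← ha4] at hi
      exact (mem_outNbr.mp hi).1.symm
    · have hi : x i ∈ insert a S := Finset.mem_insert_of_mem (h.mem i)
      rw [← hb4] at hi
      exact (mem_outNbr.mp hi).1.symm

/-- Disjoint connected sets reaching the neighbourhood of a vertex of small degree can be completed
to a cycle minor. -/
theorem MinCex.model_of_linked (h : MinCex G W S x) (hv : v ∈ W)
    (hdeg : ((outNbr G W v).card = 0 ∧ (outNbr G ∅ v).card ≤ 9) ∨
      (1 ≤ (outNbr G W v).card ∧ (outNbr G ∅ v).card + (outNbr G W v).card ≤ 10))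
    {j : ℕ} (hj0 : 0 < j) (hj : j ≤ 5) {t : Fin j → V} {U : Set V} (hvU : v ∉ U)
    (hNU : ∀ w, G.Adj v w → w ∈ U) {Z : Fin j → Set V} (hZU : ∀ i, Z i ⊆ U)
    (hZ : ∀ i, Conn G (Z i)) (htZ : ∀ i, t i ∈ Z i) (hmeet : ∀ i, (Z i ∩ {w | G.Adj v w}).Nonempty)
    (hd : ∀ i i', i ≠ i' → Disjoint (Z i) (Z i'))
    (hS : ∀ w ∈ S, G.Adj v w → ∃ i, w = t i) : Model G (insert v U) t := by
  classical
  choose Z' hZ'Z hZ'c htZ' y₀ hy₀ using fun i => (hZ i).truncate (htZ i) (hmeet i)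
  have hy₀Z : ∀ i, y₀ i ∈ Z' i ∧ G.Adj v (y₀ i) := by
    intro i
    have : y₀ i ∈ Z' i ∩ {w | G.Adj v w} := by
      rw [hy₀ i]
      rfl
    exact this
  have hZ'N : ∀ i w, w ∈ Z' i → G.Adj v w → w = y₀ i := by
    intro i w hw hvw
    have : w ∈ Z' i ∩ {w | G.Adj v w} := ⟨hw, hvw⟩
    rwa [hy₀ i] at this
  have hd' : ∀ i i', i ≠ i' → Disjoint (Z' i) (Z' i') := fun i i' hii =>
    (hd i i' hii).mono (hZ'Z i) (hZ'Z i')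
  have hy₀inj : Function.Injective y₀ := by
    intro i i' hii
    by_contra hne
    exact Set.disjoint_left.mp (hd' i i' hne) (hy₀Z i).1 (hii ▸ (hy₀Z i').1)
  have h6 := h.six_le_degree hv
  obtain ⟨y, hyinj, hyN, hyy⟩ := exists_injective_extension hj (N := outNbr G ∅ v) (by omega)
    hy₀inj fun i => mem_outNbr.mpr ⟨(hy₀Z i).2, Finset.notMem_empty _⟩
  -- All neighbours of v in S are among the t i, hence among the chosen roots: a set starting at a
  -- neighbour of v meets N(v) only there. So the remaining neighbours of v lie in W.
  have hdense : DenseNbr G W v y := by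
    refine ⟨hyinj, fun i => (mem_outNbr.mp (hyN i)).1, fun w hvw hwy => ?_,
      fun u hu => h.five_le_lostNbr hv hu.symm⟩
    refine (h.mass.adj hv hvw).resolve_right fun hwS => ?_
    obtain ⟨i, rfl⟩ := hS w hwS hvw
    refine hwy (Fin.castLE hj i) ?_
    rw [hyy]
    exact hZ'N i _ (htZ' i) hvw
  have hcard := hdense.card
  have hq : (Finset.univ.filter fun i => y i ∉ W).card ≤ (outNbr G W v).card := by
    rw [← Finset.card_image_of_injective _ hyinj]
    refine Finset.card_le_card fun w hw => ?_
    obtain ⟨i, hi, rfl⟩ := Finset.mem_image.mp hw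
    exact mem_outNbr.mpr ⟨hdense.adj i, (Finset.mem_filter.mp hi).2⟩
  -- Subtracting the five chosen roots from the degree turns the two alternatives of `hdeg` into the
  -- two hypotheses on r.
  obtain ⟨H, hH, hHU, hyH⟩ := hdense.model (by omega) (by
    rcases hdeg with ⟨h0, -⟩ | ⟨-, h1⟩
    · left
      intro i
      by_contra hi
      rw [Finset.card_eq_zero] at h0
      have : y i ∈ outNbr G W v := mem_outNbr.mpr ⟨hdense.adj i, hi⟩
      rw [h0] at this
      exact absurd this (Finset.notMem_empty _)
    · right
      omega)
  obtain ⟨H', hH', hHH', hH'm⟩ := hH.castLE hj0 hj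
  have hy₀H : ∀ i, y₀ i ∈ H (Fin.castLE hj i) := fun i => hyy i ▸ hyH _
  have hZH : ∀ i i', i ≠ i' → ∀ w ∈ Z' i, w ∉ H' i' := by
    intro i i' hii w hw hw'
    obtain ⟨m, hm, hm'⟩ := hH'm i' w hw'
    have hwv : w ≠ v := fun he => hvU (he ▸ hZU i (hZ'Z i hw))
    have hwy : w = y₀ i := hZ'N i w hw ((hHU m hm).resolve_left hwv)
    have hne : m ≠ Fin.castLE hj i := by
      rintro rfl
      rcases hm' with hm' | hm'
      · exact hii (Fin.castLE_injective hj hm')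
      · exact absurd i.2 (not_lt.mpr hm')
    exact Set.disjoint_left.mp (hH.disj _ _ hne) hm (hwy ▸ hy₀H i)
  refine ⟨fun i => Z' i ∪ H' i, ⟨fun i i' hii => ?_, fun i => ?_, fun i i' hii => ?_⟩,
    fun i => ?_, fun i => Or.inl (htZ' i)⟩
  · refine Set.disjoint_left.mpr ?_
    rintro w (hw | hw) (hw' | hw')
    · exact Set.disjoint_left.mp (hd' i i' hii) hw hw'
    · exact hZH i i' hii w hw hw'
    · exact hZH i' i hii.symm w hw' hw
    · exact Set.disjoint_left.mp (hH'.disj i i' hii) hw hw'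
  · exact (hZ'c i).union (hH'.conn i) ⟨y₀ i, (hy₀Z i).1, y₀ i, hHH' i (hy₀H i), Or.inl rfl⟩
  · exact (hH'.touch i i' hii).mono Set.subset_union_right Set.subset_union_right
  · rintro w (hw | hw)
    · exact Or.inr (hZU i (hZ'Z i hw))
    · obtain ⟨m, hm, -⟩ := hH'm i w hw
      exact (hHU m hm).imp id fun hvw => hNU w hvw

/-- Cut S from N(v) in G − v by a minimum separation. The cut is linked to N(v), so every ordering
of it has a cycle minor beyond the cut; v together with the far side is a rigid set over at most |S|
vertices. -/
theorem MinCex.lt_three (h : MinCex G W S x) : k < 3 := by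
  classical
  by_contra hk
  obtain ⟨v, hv, hdeg⟩ := h.exists_small_degree (not_lt.mp hk)
  have hvS : v ∉ S := Finset.disjoint_left.mp h.mass.disj hv
  set A := (W ∪ S).erase v with hA
  have hSA : S ⊆ A := fun w hw => Finset.mem_erase.mpr
    ⟨fun he => hvS (he ▸ hw), Finset.mem_union_right _ hw⟩
  have hNA : outNbr G ∅ v ⊆ A := fun w hw => Finset.mem_erase.mpr
    ⟨(mem_outNbr.mp hw).1.ne', Finset.mem_union.mpr (h.mass.adj hv (mem_outNbr.mp hw).1)⟩
  obtain ⟨P, Q, hPQ, hcase, -, Z, hZ, hd⟩ := exists_separation_linked G hSA hNA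
  have hQA : Q ⊆ A := fun w hw => (hPQ.mem_or w).mpr (Or.inr hw)
  have hvQ : v ∉ Q := fun hvQ => (Finset.mem_erase.mp (hQA hvQ)).1 rfl
  have hNQ : ∀ w, G.Adj v w → w ∈ Q := fun w hvw =>
    hPQ.right (mem_outNbr.mpr ⟨hvw, Finset.notMem_empty _⟩)
  have hTle : (P ∩ Q).card ≤ S.card := by
    rcases hcase with hcase | hcase
    · rw [hcase]
    · exact hcase.le
  have hT5 : (P ∩ Q).card ≤ 5 := by
    have := h.card
    have := h.le_five
    omega
  refine h.not_rigidSep (insert v (Q \ P)) (P ∩ Q) ⟨?_, ⟨v, Finset.mem_insert_self _ _⟩,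
    bdry_subset_iff.mpr ?_, ?_, ?_, hTle, ?_⟩
  · refine Finset.insert_subset hv fun w hw => ?_
    rw [Finset.mem_sdiff] at hw
    exact (Finset.mem_union.mp (Finset.mem_erase.mp (hQA hw.1)).2).resolve_right fun hwS =>
      hw.2 (hPQ.left hwS)
  · intro u hu w huw
    by_cases hwv : w = v
    · exact Or.inl (hwv ▸ Finset.mem_insert_self _ _)
    have hwQ : w ∈ Q := by
      rcases Finset.mem_insert.mp hu with rfl | hu
      · exact hNQ w huw
      · rw [Finset.mem_sdiff] at hu
        have huW : u ∈ W := (Finset.mem_union.mp (Finset.mem_erase.mp (hQA hu.1)).2).resolve_right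
          fun huS => hu.2 (hPQ.left huS)
        have hwA : w ∈ A := Finset.mem_erase.mpr ⟨hwv, Finset.mem_union.mpr (h.mass.adj huW huw)⟩
        by_contra hwQ
        exact hPQ.no_edge w (((hPQ.mem_or w).mp hwA).resolve_right hwQ) hwQ u hu.1 hu.2 huw.symm
    by_cases hwP : w ∈ P
    · exact Or.inr (Finset.mem_inter.mpr ⟨hwP, hwQ⟩)
    · exact Or.inl (Finset.mem_insert_of_mem (Finset.mem_sdiff.mpr ⟨hwQ, hwP⟩))
  · refine Finset.disjoint_left.mpr fun w hw hw' => ?_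
    rw [Finset.mem_inter] at hw'
    rcases Finset.mem_insert.mp hw with rfl | hw
    · exact hvQ hw'.2
    · exact (Finset.mem_sdiff.mp hw).2 hw'.1
  · exact fun w hw => (Finset.mem_erase.mp (hQA (Finset.mem_inter.mp hw).2)).2
  · intro s hsinj hsr
    have hsT : ∀ i, s i ∈ P ∩ Q := fun i => by
      rw [← Finset.mem_coe, ← hsr]
      exact ⟨i, rfl⟩
    have hsub : insert v (↑Q : Set V) ⊆ ↑(insert v (Q \ P)) ∪ ↑(P ∩ Q) := by
      rintro w (rfl | hw)
      · exact Or.inl (Finset.mem_insert_self _ _)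
      · by_cases hwP : w ∈ P
        · exact Or.inr (Finset.mem_inter.mpr ⟨hwP, hw⟩)
        · exact Or.inl (Finset.mem_insert_of_mem (Finset.mem_sdiff.mpr ⟨hw, hwP⟩))
    rcases Nat.eq_zero_or_pos (P ∩ Q).card with h0 | hpos
    · have : IsEmpty (Fin (P ∩ Q).card) := by
        rw [h0]
        infer_instance
      exact ⟨fun _ => ∅, ⟨fun i => isEmptyElim i, fun i => isEmptyElim i, fun i => isEmptyElim i⟩,
        fun i => isEmptyElim i, fun i => isEmptyElim i⟩
    · refine (h.model_of_linked hv hdeg hpos hT5 (U := ↑Q) hvQ hNQ (Z := fun i => Z (s i))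
        (fun i => (hZ _ (hsT i)).2.1) (fun i => (hZ _ (hsT i)).2.2.1) (fun i => (hZ _ (hsT i)).1)
        (fun i => ?_) (fun i i' hii => hd _ (hsT i) _ (hsT i') (hsinj.ne hii))
        fun w hwS hvw => ?_).mono le_rfl hsub
      · obtain ⟨w, hw, hwN⟩ := (hZ _ (hsT i)).2.2.2
        exact ⟨w, hw, (mem_outNbr.mp hwN).1⟩
      · have : w ∈ (↑(P ∩ Q) : Set V) := Finset.mem_inter.mpr ⟨hPQ.left hwS, hNQ w hvw⟩
        rw [← hsr] at this
        obtain ⟨i, hi⟩ := this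
        exact ⟨i, hi.symm⟩

end SmallDegree

/-! ### Two roots -/

section TwoRoots

variable {V : Type*} [Fintype V] {G : SimpleGraph V} {W S : Finset V}

/-- If W did not connect the roots, it would split into two parts without edges to each other, each
with a boundary of at most one root. Both would satisfy ρ ≤ 5|·|, and so would W. -/
theorem Mass.model_of_two (h : Mass G W S) {x : Fin 2 → V} (hx : Function.Injective x)
    (hS : ∀ v, v ∈ S ↔ v ∈ Set.range x) : Model G (↑W ∪ ↑S) x := by
  classical
  have hxS : ∀ i, x i ∈ S := fun i => (hS _).mpr ⟨i, rfl⟩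
  have hxW : ∀ i, x i ∉ W := fun i hi => Finset.disjoint_left.mp h.disj hi (hxS i)
  have hcard := card_of_mem_range hx hS
  set R := insert (x 0) W with hR
  have h0R : x 0 ∈ R := Finset.mem_insert_self _ _
  set Y := compFinset G R (x 0) with hY
  have hYR : Y ⊆ R := compFinset_subset h0R
  have hYc : Conn G (↑Y : Set V) := by
    rw [hY, coe_compFinset]
    exact conn_comp
  have h0Y : x 0 ∈ (↑Y : Set V) := by
    rw [hY, coe_compFinset]
    exact mem_comp_self G _ _
  have hne : x 1 ≠ x 0 := hx.ne (by decide)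
  have h1Y : x 1 ∉ (↑Y : Set V) := fun hcon =>
    (Finset.mem_insert.mp (hYR hcon)).elim hne (hxW 1)
  by_cases hadj : ∃ u ∈ Y, G.Adj u (x 1)
  · obtain ⟨u, hu, hux⟩ := hadj
    have ht : Touch G (↑Y : Set V) {x 1} := ⟨u, hu, x 1, rfl, Or.inr hux⟩
    have hd : Disjoint (↑Y : Set V) {x 1} := Set.disjoint_singleton_right.mpr h1Y
    refine ⟨![↑Y, {x 1}], ⟨?_, ?_, ?_⟩, ?_, ?_⟩
    · rw [Fin.forall_fin_two]
      refine ⟨Fin.forall_fin_two.mpr ⟨fun h => absurd rfl h, fun _ => hd⟩,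
        Fin.forall_fin_two.mpr ⟨fun _ => hd.symm, fun h => absurd rfl h⟩⟩
    · exact Fin.forall_fin_two.mpr ⟨hYc, conn_singleton G _⟩
    · rw [Fin.forall_fin_two]
      refine ⟨Fin.forall_fin_two.mpr ⟨fun _ => Touch.refl hYc.1, fun _ => ht⟩,
        Fin.forall_fin_two.mpr ⟨fun _ => ht.symm, fun _ => Touch.refl ⟨x 1, rfl⟩⟩⟩
    · refine Fin.forall_fin_two.mpr ⟨fun w hw => ?_, ?_⟩
      · rcases Finset.mem_insert.mp (hYR hw) with rfl | hw
        · exact Or.inr (hxS 0)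
        · exact Or.inl hw
      · rintro w rfl
        exact Or.inr (hxS 1)
    · exact Fin.forall_fin_two.mpr ⟨h0Y, rfl⟩
  · exfalso
    push Not at hadj
    have hSx : ∀ v ∈ S, v = x 0 ∨ v = x 1 := by
      intro v hv
      obtain ⟨i, rfl⟩ := (hS v).mp hv
      fin_cases i
      · exact Or.inl rfl
      · exact Or.inr rfl
    have hb1 : bdry G (W ∩ Y) ⊆ {x 0} := by
      refine bdry_subset_iff.mpr fun u hu w huw => ?_
      obtain ⟨huW, huY⟩ := Finset.mem_inter.mp hu
      rcases h.adj huW huw with hw | hw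
      · exact Or.inl (Finset.mem_inter.mpr
          ⟨hw, compFinset_closed h0R huY (Finset.mem_insert_of_mem hw) huw⟩)
      · rcases hSx w hw with rfl | rfl
        · exact Or.inr (Finset.mem_singleton_self _)
        · exact absurd huw (hadj u huY)
    have hb2 : bdry G (W \ Y) ⊆ {x 1} := by
      refine bdry_subset_iff.mpr fun u hu w huw => ?_
      obtain ⟨huW, huY⟩ := Finset.mem_sdiff.mp hu
      have hwY : w ∉ Y := fun hwY =>
        huY (compFinset_closed h0R hwY (Finset.mem_insert_of_mem huW) huw.symm)
      rcases h.adj huW huw with hw | hw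
      · exact Or.inl (Finset.mem_sdiff.mpr ⟨hw, hwY⟩)
      · rcases hSx w hw with rfl | rfl
        · exact absurd h0Y hwY
        · exact Or.inr (Finset.mem_singleton_self _)
    have h1 := h.sep _ Finset.inter_subset_left
      (lt_of_le_of_lt (Finset.card_le_card hb1) (by simp [hcard]))
    have h2 := h.sep _ Finset.sdiff_subset
      (lt_of_le_of_lt (Finset.card_le_card hb2) (by simp [hcard]))
    have h3 := rho_union_le G ↑(W ∩ Y) ↑(W \ Y)
    have h4 : (↑(W ∩ Y) ∪ ↑(W \ Y) : Set V) = ↑W := by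
      rw [← Finset.coe_union, Finset.union_comm, Finset.sdiff_union_inter]
    have h5 := Finset.card_inter_add_card_sdiff W Y
    have h6 := h.mass
    rw [h4] at h3
    omega

end TwoRoots

/-! ### The lexicographic induction -/

section Induction

variable {V : Type*} [Fintype V]

theorem good_of_smaller {G : SimpleGraph V} {W : Finset V}
    (ih : ∀ (G' : SimpleGraph V) (W' : Finset V),
      W'.card < W.card ∨ (W'.card = W.card ∧ rho G' ↑W' < rho G ↑W) → Good G' W') : Good G W := by
  intro k x S hk hx hS hM
  by_contra hcon
  rw [not_or] at hcon
  have h : MinCex G W S x := ⟨hk, hx, hS, hM, hcon.1, hcon.2, ih⟩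
  have h3 := h.lt_three
  obtain rfl | rfl | rfl : k = 0 ∨ k = 1 ∨ k = 2 := by omega
  · exact h.no_model (model_of_fin_zero G _ x)
  · exact h.no_model (model_of_fin_one G x (Or.inr (h.mem 0)))
  · exact h.no_model (hM.model_of_two hx hS)

theorem good (G : SimpleGraph V) (W : Finset V) : Good G W := by
  have key : ∀ n m : ℕ, ∀ (G : SimpleGraph V) (W : Finset V), W.card = n → rho G ↑W = m →
      Good G W := by
    intro n
    induction n using Nat.strong_induction_on with
    | _ n ihn =>
    intro m
    induction m using Nat.strong_induction_on with
    | _ m ihm =>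
    intro G W hn hm
    refine good_of_smaller fun G' W' h => ?_
    rcases h with h | ⟨h1, h2⟩
    · exact ihn _ (hn ▸ h) _ G' W' rfl rfl
    · exact ihm _ (hm ▸ h2) G' W' (h1.trans hn) rfl
  exact key _ _ G W rfl rfl

end Induction
end RootedCycle
namespace RootedCycle

/-! ### Passing between the stated definitions and the working ones -/

section Conversion

variable {V : Type*} {G : SimpleGraph V} {X : Set V}

theorem Massed.mass_finset [Fintype V] (h : Massed 5 G X) {W S : Finset V}
    (hW : (↑W : Set V) = Xᶜ) (hS : (↑S : Set V) = X) : Mass G W S := by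
  have hWS : ∀ v, v ∈ W ↔ v ∉ S := fun v => by
    rw [← Finset.mem_coe, ← Finset.mem_coe, hW, hS, Set.mem_compl_iff]
  refine ⟨Finset.disjoint_left.mpr fun v hv => (hWS v).mp hv, bdry_subset_iff.mpr fun u _ v _ => ?_,
    ?_, fun D hD hlt => ?_⟩
  · by_cases hv : v ∈ S
    · exact Or.inr hv
    · exact Or.inl ((hWS v).mpr hv)
  · have := h.mass
    rw [← hW, Set.ncard_coe_finset] at this
    exact_mod_cast this
  · have h1 : (↑D : Set V)ᶜ ∩ (↑D ∪ ↑(bdry G D)) = ↑(bdry G D) := by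
      ext v
      simp only [Set.mem_inter_iff, Set.mem_compl_iff, Set.mem_union, Finset.mem_coe]
      exact ⟨fun h => h.2.resolve_left h.1, fun h => ⟨(mem_bdry.mp h).1, Or.inr h⟩⟩
    have h2 : (↑D ∪ ↑(bdry G D)) \ (↑D : Set V)ᶜ = ↑D := by
      ext v
      simp only [Set.mem_sdiff, Set.mem_compl_iff, Set.mem_union, Finset.mem_coe, not_not]
      exact ⟨And.right, fun h => ⟨Or.inl h, h⟩⟩
    -- A set D ⊆ W with its boundary corresponds to the separation whose sides are the complement of
    -- D and D with its boundary; these intersect in the boundary.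
    have := h.separation_le (↑D)ᶜ (↑D ∪ ↑(bdry G D)) ⟨?_, ?_, ?_⟩ ?_
    · rw [h2, Set.ncard_coe_finset] at this
      exact_mod_cast this
    · rw [← Set.union_assoc, Set.compl_union_self, Set.univ_union]
    · intro v hv hvD
      exact (hWS v).mp (hD hvD) (by rwa [← Finset.mem_coe, hS])
    · rintro u ⟨-, hu⟩ v ⟨-, hv⟩ huv
      rw [Set.mem_compl_iff, not_not] at hv
      have hu' : u ∉ D := fun h => hu (Or.inl h)
      exact hu (Or.inr (mem_bdry.mpr ⟨hu', v, hv, huv.symm⟩))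
    · rwa [h1, Set.ncard_coe_finset, ← hS, Set.ncard_coe_finset]

theorem Model.reachable_of_two {U : Set V} {x : Fin 2 → V} (h : Model G U x) :
    G.Reachable (x 0) (x 1) := by
  obtain ⟨Y, hY, -, hx⟩ := h
  exact ((hY.conn 0).union (hY.conn 1) (hY.touch 0 1 (Or.inl rfl))).exists_walk (Or.inl (hx 0))
    (Or.inr (hx 1))

theorem cycleLinked_of_models (hne : X.Nonempty) (hfin : X.Finite)
    (h : ∀ (k : ℕ) (x : Fin k → V), Function.Injective x → Set.range x = X → k = X.ncard →
      ∃ U, Model G U x) : CycleLinked G X := by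
  have hpos := hne.ncard_pos hfin
  obtain h1 | h2 | h3 : X.ncard = 1 ∨ X.ncard = 2 ∨ 3 ≤ X.ncard := by omega
  · refine Or.inr ⟨Or.inl h1, fun u hu v hv => ?_⟩
    obtain ⟨a, rfl⟩ := Set.ncard_eq_one.mp h1
    obtain rfl : u = a := hu
    obtain rfl : v = u := hv
    exact ⟨SimpleGraph.Walk.nil, SimpleGraph.Walk.IsPath.nil⟩
  · refine Or.inr ⟨Or.inr h2, fun u hu v hv => ?_⟩
    suffices hr : G.Reachable u v from hr.exists_isPath
    obtain ⟨a, b, hab, rfl⟩ := Set.ncard_eq_two.mp h2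
    obtain ⟨U, hU⟩ := h 2 ![a, b] (by
      intro i j
      fin_cases i <;> fin_cases j <;> simp [hab, hab.symm]) (by simp [Set.pair_comm]) h2.symm
    have hr : G.Reachable a b := hU.reachable_of_two
    rcases hu with rfl | rfl <;> rcases hv with rfl | rfl
    · exact SimpleGraph.Reachable.refl _
    · exact hr
    · exact hr.symm
    · exact SimpleGraph.Reachable.refl _
  · refine Or.inl ⟨h3, fun x hx hr => ?_⟩
    obtain ⟨U, hU⟩ := h _ x hx hr rfl
    exact hU.hasCycleMinor (by omega)

theorem conn_image_supp {A : Set V} (C : (G.induce A).ConnectedComponent) :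
    Conn G (Subtype.val '' C.supp) := by
  refine ⟨C.nonempty_supp.image _, ?_⟩
  rintro P ⟨_, huP, u, hu, rfl⟩ hc _ ⟨v, hv, rfl⟩
  have hr : (G.induce A).Reachable u v := SimpleGraph.ConnectedComponent.exact (hu.trans hv.symm)
  obtain ⟨p⟩ := hr
  induction p with
  | nil => exact huP
  | @cons u w v huw p ih =>
    have hw : w ∈ C.supp := (C.mem_supp_congr_adj huw).mp hu
    exact ih hw (hc _ huP ⟨_, hu, rfl⟩ _ ⟨w, hw, rfl⟩ huw) hv

theorem image_supp_closed {A : Set V} (C : (G.induce A).ConnectedComponent) {u v : V}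
    (hu : u ∈ Subtype.val '' C.supp) (hv : v ∈ A) (huv : G.Adj u v) :
    v ∈ Subtype.val '' C.supp := by
  obtain ⟨u, hu, rfl⟩ := hu
  exact ⟨⟨v, hv⟩, (C.mem_supp_congr_adj (v := u) (w := ⟨v, hv⟩) huv).mp hu, rfl⟩

end Conversion
end RootedCycle
-- Failure of cycle-linkedness supplies an ordering with no model anywhere, and the two apexes found
-- for this ordering determine everything else. Consecutive roots are nonadjacent since such an
-- edge, with the apexes serving the other four links, would complete the cycle.
theorem mainTheorem1 {V : Type*} [Finite V] (G : SimpleGraph V) (X : Set V)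
    (hXne : X.Nonempty) (hX5 : X.ncard ≤ 5)
    (hmassed : RootedCycle.Massed 5 G X)
    (hlinked : ¬ RootedCycle.CycleLinked G X) :
    X.ncard = 5 ∧
    RootedCycle.rho G Xᶜ = 5 * Xᶜ.ncard + 1 ∧
    ∃ x : Fin 5 → V, Function.Injective x ∧ Set.range x = X ∧
      (∀ i : Fin 5, ¬ G.Adj (x i) (x (i + 1))) ∧
      ∃ a b : V, a ∉ X ∧ b ∉ X ∧ G.Adj a b ∧
        (∀ i : Fin 5, G.Adj (x i) a ∧ G.Adj (x i) b) ∧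
        ∀ C : (G.induce (X ∪ {a, b})ᶜ).ConnectedComponent,
          RootedCycle.rho G (Subtype.val '' C.supp) = 5 * (Subtype.val '' C.supp).ncard ∧
          ∃ i : Fin 5,
            RootedCycle.nbhd G (Subtype.val '' C.supp) ⊆ {a, b, x i, x (i + 2)} := by
  classical
  have := Fintype.ofFinite V
  obtain ⟨W, hW⟩ : ∃ W : Finset V, (↑W : Set V) = Xᶜ := ⟨Xᶜ.toFinset, Set.coe_toFinset _⟩
  obtain ⟨S, hS⟩ : ∃ S : Finset V, (↑S : Set V) = X := ⟨X.toFinset, Set.coe_toFinset _⟩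
  have hM := hmassed.mass_finset hW hS
  obtain ⟨k, x, hx, hr, hk, hno⟩ : ∃ (k : ℕ) (x : Fin k → V), Function.Injective x ∧
      Set.range x = X ∧ k = X.ncard ∧ ∀ U, ¬ RootedCycle.Model G U x := by
    by_contra hcon
    push Not at hcon
    exact hlinked (RootedCycle.cycleLinked_of_models hXne X.toFinite hcon)
  have hSx : ∀ v, v ∈ S ↔ v ∈ Set.range x := fun v => by rw [hr, ← hS, Finset.mem_coe]
  obtain ⟨rfl, a, ha, b, hb, hab, hcomp⟩ :=
    (RootedCycle.good G W k x S (hk ▸ hX5) hx hSx hM).resolve_left (hno _)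
  obtain ⟨hadj, hrho, hcl⟩ := hM.apex_structure hx hSx (hno _) ha hb hab hcomp
  have hWX : ∀ v, v ∈ W ↔ v ∉ X := fun v => by rw [← Finset.mem_coe, hW, Set.mem_compl_iff]
  refine ⟨hk.symm, ?_, x, hx, hr, fun i hi => ?_, a, b, (hWX a).mp ha, (hWX b).mp hb, hadj, hcomp,
    fun C => ?_⟩
  · rw [← hW, hrho, Set.ncard_coe_finset]
  · exact hno Set.univ (RootedCycle.model_of_adj hx (fun _ => Set.mem_univ _) hab (Set.mem_univ _)
      (Set.mem_univ _) (fun j => (hcomp j).1) (fun j => (hcomp j).2) i hi)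
  · obtain ⟨C', hC'⟩ : ∃ C' : Finset V, (↑C' : Set V) = Subtype.val '' C.supp :=
      ⟨(Subtype.val '' C.supp).toFinset, Set.coe_toFinset _⟩
    have hmem : ∀ v, v ∈ W \ {a, b} ↔ v ∈ (X ∪ {a, b})ᶜ := fun v => by
      simp only [Finset.mem_sdiff, hWX, Finset.mem_insert, Finset.mem_singleton, Set.mem_compl_iff,
        Set.mem_union, Set.mem_insert_iff, Set.mem_singleton_iff, not_or]
    have hCsub : C' ⊆ W \ {a, b} := by
      intro v hv
      rw [← Finset.mem_coe, hC'] at hv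
      obtain ⟨v, -, rfl⟩ := hv
      exact (hmem _).mpr v.2
    have hCcl : ∀ u ∈ C', ∀ v ∈ W \ {a, b}, G.Adj u v → v ∈ C' := by
      intro u hu v hv huv
      rw [← Finset.mem_coe, hC'] at hu ⊢
      exact RootedCycle.image_supp_closed C hu ((hmem v).mp hv) huv
    have hCconn : RootedCycle.Conn G (↑C' : Set V) := hC' ▸ RootedCycle.conn_image_supp C
    obtain ⟨i, hi⟩ := hM.bdry_comp_subset hx hSx (hno _) ha hb hab hcomp hCconn hCsub hCcl
    rw [← hC', Set.ncard_coe_finset]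
    refine ⟨hcl C' hCsub hCcl, i, fun v hv => ?_⟩
    have := hi (RootedCycle.mem_bdry.mpr hv)
    simpa only [Finset.mem_insert, Finset.mem_singleton, Set.mem_insert_iff,
      Set.mem_singleton_iff] using this
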